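/- Let $k \ge 1$, $C \ge 0$ and $0 \le n \le kC$ be integers. Consider $k$ bins, each of capacity $C$, arranged on a ring, and insert $n$ objects one after the other into the initially empty bins; a bin is called full if it holds $C$ objects and available otherwise. Each object is first hashed, independently of the past, to a uniformly random bin among the $k$ bins, and is put there if that bin is available. If that bin is full, then * under CH-BL (consistent hashing with bounded loads) the object is put into the nearest available bin in the clockwise direction; * under RJ-CH (random jump consistent hashing) the object is put into a bin chosen uniformly at random, with fresh randomness, among the available bins. Let $X^{(CH-BL)}_i$ and $X^{(RJ-CH)}_i$ denote the number of objects in bin $i$ after all $n$ objects have been inserted following CH-BL and RJ-CH, respectively. Then, for every convex function $f:\{0,1,\dots,C\}\to\mathbb{R}$, $$\sum_{i=1}^k E\bigl[f(X^{(RJ-CH)}_i)\bigr] \le \sum_{i=1}^k E\bigl[f(X^{(CH-BL)}_i)\bigr],$$ and, moreover, $$E\bigl[f(X^{(RJ-CH)}_i)\bigr] \le E\bigl[f(X^{(CH-BL)}_i)\bigr] \qquad \text{for every } i=1,\dots,k.$$ -/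

import Mathlib

open MeasureTheory
open scoped BigOperators

/-- The loads of `k` bins placed on a ring. The bins are indexed by `ZMod k`, and bin `i + 1` is the
clockwise neighbour of bin `i`. -/
abbrev Loads (k : ℕ) : Type := ZMod k → ℕ

/-- Put one more object into bin `j`. -/
def place {k : ℕ} (x : Loads k) (j : ZMod k) : Loads k :=
  Function.update x j (x j + 1)

/-- The available (non-full) bins when every bin has capacity `C`. -/
def availableBins {k : ℕ} [NeZero k] (C : ℕ) (x : Loads k) : Finset (ZMod k) :=
  Finset.univ.filter fun i => x i < C

/-- CH-BL: the first available bin met when walking clockwise from bin `i`, starting with `i`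
itself. (If every bin is full, the value is the irrelevant default `i`.) -/
noncomputable def clockwiseTarget {k : ℕ} (C : ℕ) (x : Loads k) (i : ZMod k) : ZMod k :=
  open scoped Classical in
  if h : ∃ d : ℕ, x (i + (d : ZMod k)) < C then i + (Nat.find h : ZMod k) else i

/-- RJ-CH: an object hashed to bin `i` stays there if `i` is available; otherwise it is reassigned
uniformly at random to the available bins. (If every bin is full, the value is the irrelevant
default `i`.) -/
noncomputable def randomJumpTarget {k : ℕ} [NeZero k] (C : ℕ) (x : Loads k) (i : ZMod k) :
    PMF (ZMod k) :=
  open scoped Classical in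
  if x i < C then PMF.pure i
  else if h : (availableBins C x).Nonempty then PMF.uniformOfFinset (availableBins C x) h
  else PMF.pure i

/-- One CH-BL insertion into the loads `x`: hash the object to a uniformly random bin, then walk
clockwise to the nearest available bin. -/
noncomputable def chblStep {k : ℕ} [NeZero k] (C : ℕ) (x : Loads k) : PMF (Loads k) :=
  (PMF.uniformOfFintype (ZMod k)).bind fun i => PMF.pure (place x (clockwiseTarget C x i))

/-- One RJ-CH insertion into the loads `x`: hash the object to a uniformly random bin, then jump to
a uniformly random available bin if that bin is full. -/
noncomputable def rjchStep {k : ℕ} [NeZero k] (C : ℕ) (x : Loads k) : PMF (Loads k) :=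
  (PMF.uniformOfFintype (ZMod k)).bind fun i =>
    (randomJumpTarget C x i).bind fun j => PMF.pure (place x j)

/-- The joint law of the bin loads after inserting `n` objects one after the other, with fresh
randomness for every object, into `k` empty bins of capacity `C` following CH-BL. -/
noncomputable def chblLaw (k : ℕ) [NeZero k] (C : ℕ) : ℕ → PMF (Loads k)
  | 0 => PMF.pure 0
  | n + 1 => (chblLaw k C n).bind (chblStep C)

/-- The joint law of the bin loads after inserting `n` objects one after the other, with fresh
randomness for every object, into `k` empty bins of capacity `C` following RJ-CH. -/
noncomputable def rjchLaw (k : ℕ) [NeZero k] (C : ℕ) : ℕ → PMF (Loads k)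
  | 0 => PMF.pure 0
  | n + 1 => (rjchLaw k C n).bind (rjchStep C)

/-- `f` is convex on the set of integers `{0, 1, ..., C}`; its values elsewhere do not matter. -/
def ConvexOnUpTo (C : ℕ) (f : ℕ → ℝ) : Prop :=
  ∀ x y z : ℕ, x ≤ C → y ≤ C → ∀ a b : ℝ, 0 ≤ a → 0 ≤ b → a + b = 1 →
    (z : ℝ) = a * x + b * y → f z ≤ a * f x + b * f y

/-! For `n = k * C` every bin is full under both rules, so let `n < k * C` and write `C = K + 1`: an
available bin holds at most `K` objects. Condition on the set `S` of full bins. RJ-CH chooses a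
uniformly random available bin at every step, so given `S` the loads of the available bins have the
exchangeable law with weights `∏ 1 / x_b!`, restricted to `x_b ≤ K` and to the remaining total
(`rjchLaw_apply`). Under CH-BL the full bins cut the ring into clusters, each ending in one
available bin. The law is again a product (`chblLaw_apply`), an available bin fed by `r` full bins
having weight `W_r = overflowWeight C r`. The density of the second law relative to the first is, up
to a constant, `∏ x_b! W_r(x_b)`, and `l ↦ l! W_r(l)` acts like a mixture of geometric tilts `θ ^ l`
with `θ ≥ 1` (`isMomentSeq_overflowWeight`).

Three facts give the inequality for the sums, where `f` is convex. (a) Tilting the exchangeable law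
by `∏ θ_b ^ x_b` does not lower the mean of `∑ f(x_b)` (`levelSum_pow_mul_sub_nonneg`), hence
neither does reweighting by moment sequences (`levelSum_prod_moment_nonneg`). (b) The number of full
bins is stochastically larger under CH-BL. Bins with more overflow attract more hashes and are more
likely to be one object short of full, so Chebyshev's sum inequality, together with (a) for the
indicator of load `K`, compares the chances that the next object fills a bin
(`levelSum_overflow_chebyshev`). (c) Under the exchangeable law the mean of `∑ f` increases with the
number of full bins (`levelMean_le_add_levelMean`). Both laws are invariant under rotation of the
ring, so the inequality for the sums is also the one for each bin.

For (a), remove the bin with the smallest `θ`; relative to it all other tilts are at least 1. The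
conditional mean of `∑ f` given the load `l` of this bin, and that of the remaining tilt, are convex
in `l`. By exchangeability `l` is uncorrelated with `∑ f`, and a convex sequence uncorrelated with
the identity is nonnegatively correlated with every convex sequence (`SeqConvexOn.cov_nonneg`). Fact
(c) is a variant, `SeqConvexOn.mean_le_right`.

The convexity used here is `levelMean_convex`: exchangeable means of a directionally convex function
are convex in the total load. Resampling two coordinates given their sum preserves directional
convexity, and a function of least quadratic norm with prescribed level sums is fixed by all
resamplings, hence constant on levels. This reduces the claim to two bins. There the mean excess
over each threshold is convex in the total (`twoBinSecondDiff_nonneg`) and its increments interlace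
(`twoBinMeanExcess_transfer`); the first of these rests on explicit estimates for binomial
coefficients. -/

/-! ### Two bins: estimates for ratios of binomial coefficients -/

/-- A lower bound for sequences with the ratios of binomial coefficients. -/
lemma ratioSeq_quadratic_le {R : ℝ} (hR : 1 ≤ R) {s : ℕ} {c : ℕ → ℝ} (h0 : c 0 = 1)
    (hc : ∀ i, i ≤ s → c (i + 1) * (R + i) = c i * (R + s - i)) :
    ∀ i : ℕ, 2 * i ≤ s + 2 → R + i * (s + 1 - i) ≤ R * c i := by
  intro i
  induction i with
  | zero => intro _; simp [h0]
  | succ i ih =>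
    intro hi
    have h1 := ih (by omega)
    have h2 := hc i (by omega)
    have hq : (i : ℝ) ≤ s - i := by
      have : ((2 * i : ℕ) : ℝ) ≤ (s : ℕ) := by exact_mod_cast (by omega)
      push_cast at this; linarith
    have hi0 : (0 : ℝ) ≤ i := Nat.cast_nonneg i
    obtain ⟨q, hq'⟩ : ∃ q : ℝ, (s : ℝ) = i + q := ⟨s - i, by ring⟩
    rw [hq'] at h1 h2 hq ⊢
    push_cast
    have hq2 : (i : ℝ) ≤ q := by linarith
    have hpos : 0 < R + i := by linarith
    have h3 : (R + (i + 1) * q) * (R + i) ≤ R * c (i + 1) * (R + i) := by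
      have : R * c (i + 1) * (R + i) = (R * c i) * (R + q) := by
        rw [mul_assoc, h2]; ring
      rw [this]
      have h4 : (R + i * (q + 1)) * (R + q) ≤ R * c i * (R + q) := by
        apply mul_le_mul_of_nonneg_right _ (by linarith)
        calc R + i * (q + 1) = R + i * (i + q + 1 - i) := by ring
          _ ≤ _ := h1
      -- The two sides of the induction step differ by exactly `i * q * (q - i)`, which is
      -- nonnegative on the increasing half of the sequence.
      have h5 : 0 ≤ i * q * (q - i) := by
        apply mul_nonneg (mul_nonneg hi0 (by linarith)) (by linarith)
      nlinarith
    have h6 := le_of_mul_le_mul_right h3 hpos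
    calc R + ((i : ℝ) + 1) * (i + q + 1 - (i + 1)) = R + (i + 1) * q := by ring
      _ ≤ _ := h6

/-- The second-order improvement of `ratioSeq_quadratic_le` for small offsets. -/
lemma ratioSeq_linear_le {R : ℝ} (hR : 1 ≤ R) {s τ : ℕ} {c : ℕ → ℝ} (h0 : c 0 = 1)
    (hc : ∀ i, i ≤ s → c (i + 1) * (R + i) = c i * (R + s - i))
    (hs : 2 * τ + 1 ≤ s) (hτ : 2 ≤ τ) (hsmall : 2 * R ≤ τ * (τ - 1)) :
    R + s * τ ≤ R * c τ := by
  have hs' : (2 * τ + 1 : ℝ) ≤ s := by exact_mod_cast hs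
  have hτ' : (2 : ℝ) ≤ τ := by exact_mod_cast hτ
  -- The gain `i * q * (q - i)` that the quadratic bound discards is kept here. It gets divided by
  -- `R + i`, and `B` dominates `2 * (R + i)` for all `i < τ` because of `hsmall`.
  set B : ℝ := (τ - 1) * (τ + 2) with hB
  have hBpos : 0 < B := by rw [hB]; nlinarith
  -- The second term is the closed form of the sum of `2 * j * (2 * τ + 1 - j) * (2 * τ + 1 - 2 *
  -- j)` over `j < i`, the accumulated gains with `q` replaced by its least possible value `2 * τ +
  -- 1 - j`.
  have key : ∀ i : ℕ, i ≤ τ →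
      (R + i * (s + 1 - i)) * B + i * (i - 1) * ((2 * τ + 1) ^ 2
        - (2 * τ + 1) * (2 * i - 1) + i * (i - 1)) ≤ R * c i * B := by
    intro i
    induction i with
    | zero => intro _; simp [h0]
    | succ i ih =>
      intro hi
      have h1 := ih (by omega)
      have h2 := hc i (by omega)
      have hi0 : (0 : ℝ) ≤ i := Nat.cast_nonneg i
      have hi1 : (i : ℝ) + 1 ≤ τ := by exact_mod_cast hi
      obtain ⟨q, hq'⟩ : ∃ q : ℝ, (s : ℝ) = i + q := ⟨s - i, by ring⟩
      obtain ⟨a, ha'⟩ : ∃ a : ℝ, (τ : ℝ) = i + 1 + a := ⟨τ - (i + 1), by ring⟩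
      have ha : 0 ≤ a := by linarith
      have hq : i + 2 * a + 3 ≤ q := by linarith
      have hpos : 0 < R + i := by linarith
      have hRB : 2 * (R + i) ≤ B := by rw [hB]; nlinarith
      set T : ℝ := i * (i - 1) * ((2 * τ + 1) ^ 2
        - (2 * τ + 1) * (2 * i - 1) + i * (i - 1)) with hT
      have hT0 : 0 ≤ T := by
        rw [hT]
        rcases Nat.eq_zero_or_pos i with h | h
        · simp [h]
        · have : (1 : ℝ) ≤ i := by exact_mod_cast h
          apply mul_nonneg (mul_nonneg hi0 (by linarith))
          rw [ha']; nlinarith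
      have hgain : (i * q * (q - i)) * B ≥ 2 * (i * (2 * τ + 1 - i) * (2 * τ + 1 - 2 * i)) * (R + i) := by
        have e1 : (2 * τ + 1 - i : ℝ) ≤ q := by linarith
        have e2 : (2 * τ + 1 - 2 * i : ℝ) ≤ q - i := by linarith
        have e3 : (0 : ℝ) ≤ 2 * τ + 1 - 2 * i := by linarith
        have e4 : (0 : ℝ) ≤ 2 * τ + 1 - i := by linarith
        have e5 : i * (2 * τ + 1 - i) * (2 * τ + 1 - 2 * i) ≤ i * q * (q - i) :=
          mul_le_mul (mul_le_mul_of_nonneg_left e1 hi0) e2 e3 (mul_nonneg hi0 (by linarith))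
        have e6 : (0 : ℝ) ≤ i * (2 * τ + 1 - i) * (2 * τ + 1 - 2 * i) :=
          mul_nonneg (mul_nonneg hi0 e4) e3
        calc 2 * (i * (2 * τ + 1 - i) * (2 * τ + 1 - 2 * i)) * (R + i)
            = (i * (2 * τ + 1 - i) * (2 * τ + 1 - 2 * i)) * (2 * (R + i)) := by ring
          _ ≤ (i * q * (q - i)) * B := mul_le_mul e5 hRB (by linarith) (le_trans e6 e5)
      have hstep : R * c (i + 1) * B * (R + i) = (R * c i * B) * (R + q) := by
        have : R * c (i + 1) * B * (R + i) = R * B * (c (i + 1) * (R + i)) := by ring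
        rw [this, h2, hq']; ring
      have h3 : ((R + (i + 1) * q) * B + (T + 2 * (i * (2 * τ + 1 - i) * (2 * τ + 1 - 2 * i))))
          * (R + i) ≤ R * c (i + 1) * B * (R + i) := by
        rw [hstep]
        have h4 : ((R + i * (q + 1)) * B + T) * (R + q) ≤ R * c i * B * (R + q) := by
          apply mul_le_mul_of_nonneg_right _ (by linarith)
          calc (R + i * (q + 1)) * B + T = (R + i * (s + 1 - i)) * B + T := by rw [hq']; ring
            _ ≤ _ := h1
        have h5 : T * (R + i) ≤ T * (R + q) := mul_le_mul_of_nonneg_left (by linarith) hT0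
        nlinarith
      have h6 := le_of_mul_le_mul_right h3 hpos
      refine le_trans (le_of_eq ?_) h6
      rw [hT]; push_cast; rw [hq']; ring
  have h := key τ le_rfl
  -- At `i = τ` the accumulated gain is `τ * (τ + 1) * B`, more than the deficit `τ * (τ - 1) * B`
  -- of the quadratic bound against the linear one.
  have h7 : (R + s * τ) * B ≤ R * c τ * B := by
    refine le_trans ?_ h
    have : (τ : ℝ) * (τ - 1) * ((2 * τ + 1) ^ 2 - (2 * τ + 1) * (2 * τ - 1) + τ * (τ - 1))
        = τ * (τ - 1) * ((τ + 1) * (τ + 2)) := by ring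
    rw [this, hB]
    have : 0 ≤ (τ : ℝ) * (τ - 1) * (τ + 2) * ((τ + 1) - (τ - 1)) := by
      apply mul_nonneg (mul_nonneg (mul_nonneg (by linarith) (by linarith)) (by linarith))
      linarith
    nlinarith
  exact le_of_mul_le_mul_right h7 hBpos

/-- The final numerical inequality for the lower half of the window. -/
lemma ratioSeq_sum_bound {R : ℝ} (hR : 1 ≤ R) {s τ : ℕ} {c : ℕ → ℝ} (h0 : c 0 = 1)
    (hc : ∀ i, i ≤ s → c (i + 1) * (R + i) = c i * (R + s - i))
    (hs : 2 * τ + 1 ≤ s) {X Y : ℝ}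
    (hX : 0 ≤ X) (hX1 : τ = 1 → X = s / R)
    (hY : (s - 2 * τ) * (c (τ + 1 - 1) - 1) ≤ Y) (hY0 : τ = 0 → s * (s / R) ≤ Y) :
    0 ≤ 4 * R * (X + Y + s - 2 * τ - 1) + (R * (c τ - 1) - s * τ) * (s + 1 + 2 * X + Y)
      + s * (τ + 1) * (τ - 2) := by
  have hs' : (2 * τ + 1 : ℝ) ≤ s := by exact_mod_cast hs
  have hR0 : 0 < R := by linarith
  simp only [Nat.add_sub_cancel] at hY
  rcases Nat.eq_zero_or_pos τ with rfl | hτ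
  · have := hY0 rfl
    have h1 : R * Y ≥ s * s := by
      calc R * Y ≥ R * (s * (s / R)) := mul_le_mul_of_nonneg_left this hR0.le
        _ = s * s := by field_simp
    simp only [h0, CharP.cast_eq_zero]
    simp only [CharP.cast_eq_zero] at hs'
    nlinarith
  rcases Nat.lt_or_ge τ 2 with h2 | hτ2
  · obtain rfl : τ = 1 := by omega
    have hx := hX1 rfl
    have hc1 : R * c 1 = R + s := by
      have := hc 0 (by omega); simp [h0] at this; linarith
    have h1 : R * X = s := by rw [hx]; field_simp
    have hY1 : 0 ≤ Y := by
      refine le_trans ?_ hY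
      have : 0 ≤ R * (c 1 - 1) := by
        have : (0 : ℝ) ≤ s := Nat.cast_nonneg s
        linarith
      have := nonneg_of_mul_nonneg_right this hR0
      apply mul_nonneg _ this
      push_cast at hs' ⊢; linarith
    push_cast at hs' ⊢
    have : R * (c 1 - 1) - s * 1 = 0 := by linarith
    rw [this]
    nlinarith [mul_nonneg hR0.le hY1]
  have hτ' : (2 : ℝ) ≤ τ := by exact_mod_cast hτ2
  have hquad := ratioSeq_quadratic_le hR h0 hc τ (by omega)
  have hcτ : R * (c τ - 1) ≥ τ * (s + 1 - τ) := by linarith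
  have hRY : R * Y ≥ (s - 2 * τ) * (τ * (s + 1 - τ)) := by
    calc R * Y ≥ R * ((s - 2 * τ) * (c τ - 1)) := mul_le_mul_of_nonneg_left hY hR0.le
      _ = (s - 2 * τ) * (R * (c τ - 1)) := by ring
      _ ≥ _ := mul_le_mul_of_nonneg_left hcτ (by linarith)
  have hY1 : 0 ≤ Y := by
    have : 0 ≤ R * Y := le_trans (mul_nonneg (by linarith) (mul_nonneg (by linarith) (by linarith))) hRY
    exact nonneg_of_mul_nonneg_right this hR0
  set φ : ℝ := R * (c τ - 1) - s * τ with hφ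
  have hφ1 : -(τ * (τ - 1)) ≤ φ := by rw [hφ]; nlinarith
  have hpos : 0 ≤ 4 * R * (X + Y + s - 2 * τ - 1) := by
    apply mul_nonneg (by linarith); linarith
  have hpos2 : (0 : ℝ) ≤ s * (τ + 1) * (τ - 2) := by
    apply mul_nonneg (mul_nonneg (Nat.cast_nonneg s) (by linarith)) (by linarith)
  rcases le_or_gt 0 φ with h | h
  · have : 0 ≤ φ * (s + 1 + 2 * X + Y) := mul_nonneg h (by linarith)
    linarith
  -- Otherwise `2 * R < -φ ≤ τ * (τ - 1)`, so the linear bound applies and makes `φ` nonnegative.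
  have hlarge : -φ ≤ 2 * R := by
    by_contra hcon
    push Not at hcon
    have := ratioSeq_linear_le hR h0 hc hs hτ2 (by linarith)
    rw [hφ] at h; linarith
  have e1 : -φ * (2 * X + Y) ≤ 2 * R * (2 * X + Y) :=
    mul_le_mul_of_nonneg_right hlarge (by linarith)
  have e2 : -φ * (s + 1) ≤ τ * (τ - 1) * (s + 1) :=
    mul_le_mul_of_nonneg_right (by linarith) (by linarith)
  have e3 : (1 : ℝ) * (τ * (s + 1 - τ)) ≤ (s - 2 * τ) * (τ * (s + 1 - τ)) :=
    mul_le_mul_of_nonneg_right (by linarith) (mul_nonneg (by linarith) (by linarith))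
  have e4 : 0 ≤ R * (s - 2 * τ - 1) := mul_nonneg hR0.le (by linarith)
  have e5 : (0 : ℝ) ≤ (τ - 1) * (2 * s - 3 * τ) := mul_nonneg (by linarith) (by linarith)
  nlinarith

lemma ratioSeq_pos {R : ℝ} (hR : 1 ≤ R) {s : ℕ} {c : ℕ → ℝ} (h0 : c 0 = 1)
    (hc : ∀ i, i ≤ s → c (i + 1) * (R + i) = c i * (R + s - i)) :
    ∀ i, i ≤ s + 1 → 0 < c i := by
  intro i
  induction i with
  | zero => intro _; simp [h0]
  | succ i ih =>
    intro hi
    have h1 := ih (by omega)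
    have h2 := hc i (by omega)
    have h3 : (i : ℝ) ≤ s := by exact_mod_cast (by omega)
    have h4 : (0 : ℝ) < R + i := by positivity
    have : 0 < c (i + 1) * (R + i) := by rw [h2]; apply mul_pos h1; linarith
    exact pos_of_mul_pos_left this h4.le

lemma ratioSeq_mono {R : ℝ} (hR : 1 ≤ R) {s : ℕ} {c : ℕ → ℝ} (h0 : c 0 = 1)
    (hc : ∀ i, i ≤ s → c (i + 1) * (R + i) = c i * (R + s - i)) (a : ℕ) :
    ∀ d, 2 * (a + d) ≤ s + 2 → c a ≤ c (a + d) := by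
  intro d
  induction d with
  | zero => intro _; exact le_rfl
  | succ d ih =>
    intro hd
    refine (ih (by omega)).trans ?_
    have h1 := ratioSeq_pos hR h0 hc (a + d) (by omega)
    have h2 := hc (a + d) (by omega)
    have h4 : (0 : ℝ) < R + (a + d : ℕ) := by positivity
    have h3 : ((2 * (a + d) : ℕ) : ℝ) ≤ (s : ℕ) := by exact_mod_cast (by omega)
    push_cast at h2 h3 h4
    have h5 : c (a + d) * (R + (a + d)) ≤ c (a + (d + 1)) * (R + (a + d)) := by
      rw [show a + (d + 1) = a + d + 1 from rfl, h2]
      exact mul_le_mul_of_nonneg_left (by linarith) h1.le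
    exact le_of_mul_le_mul_right h5 h4

lemma ratioSeq_le_of_window {R : ℝ} (hR : 1 ≤ R) {s : ℕ} {c : ℕ → ℝ} (h0 : c 0 = 1)
    (hc : ∀ i, i ≤ s → c (i + 1) * (R + i) = c i * (R + s - i))
    (hsym : ∀ i, i ≤ s + 1 → c (s + 1 - i) = c i) {a l : ℕ} (h1 : a ≤ l) (h2 : l ≤ s + 1 - a)
    (h3 : a ≤ s + 1) : c a ≤ c l := by
  rcases le_total (2 * l) (s + 1) with h | h
  · obtain ⟨d, rfl⟩ := Nat.exists_eq_add_of_le h1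
    exact ratioSeq_mono hR h0 hc a d (by omega)
  · rw [← hsym l (by omega)]
    obtain ⟨d, hd⟩ := Nat.exists_eq_add_of_le (show a ≤ s + 1 - l by omega)
    rw [hd]
    exact ratioSeq_mono hR h0 hc a d (by omega)

/-- This is the numerator of the second difference of the mean excess, in the units of
`twoBinSecondDiff_nonneg_of_le_half`. The sequence is symmetric and unimodal, so all its terms are
at least 1 and the middle ones at least `c τ`. After `G` is bounded below, the claim becomes
`ratioSeq_sum_bound`. -/
lemma ratioSeq_window {R : ℝ} (hR : 1 ≤ R) {s τ : ℕ} {c : ℕ → ℝ} (h0 : c 0 = 1)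
    (hc : ∀ i, i ≤ s → c (i + 1) * (R + i) = c i * (R + s - i))
    (hsym : ∀ i, i ≤ s + 1 → c (s + 1 - i) = c i) (hs : 2 * τ + 1 ≤ s) {W C G N : ℝ}
    (hW : W = ∑ l ∈ Finset.range (s + 2), c l) (hC : C = ∑ l ∈ Finset.range (τ + 1), c l)
    (hG : G = ∑ i ∈ Finset.range (τ + 1), ∑ l ∈ Finset.range (i + 1), c l) (hN : N = 2 * R + s) :
    0 ≤ (W - 1) * (R * (c τ + 3) - s * τ) - 2 * N * (C + τ + 1)
      + 2 * G / W * (2 * N + s * (W - 1)) := by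
  have hs' : (2 * τ + 1 : ℝ) ≤ s := by exact_mod_cast hs
  have hR0 : 0 < R := by linarith
  have hs0 : (0 : ℝ) ≤ s := Nat.cast_nonneg s
  have hone : ∀ l, l ≤ s + 1 → 1 ≤ c l := by
    intro l hl
    have := ratioSeq_le_of_window hR h0 hc hsym (a := 0) (l := l) (by omega) (by omega) (by omega)
    rwa [h0] at this
  have hc1 : c 1 = 1 + s / R := by
    have := hc 0 (by omega)
    simp [h0] at this
    field_simp; linarith
  set M : ℝ := ∑ l ∈ Finset.Ico (τ + 1) (s + 1 - τ), c l with hM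
  have hW2 : W = 2 * C + M := by
    have e1 : ∑ l ∈ Finset.range (s + 2), c l
        = ∑ l ∈ Finset.range (τ + 1), c l + M + ∑ l ∈ Finset.Ico (s + 1 - τ) (s + 2), c l := by
      rw [hM, Finset.range_eq_Ico, Finset.range_eq_Ico,
        Finset.sum_Ico_consecutive _ (by omega) (by omega),
        Finset.sum_Ico_consecutive _ (by omega) (by omega)]
    have e2 : ∑ l ∈ Finset.Ico (s + 1 - τ) (s + 2), c l = ∑ l ∈ Finset.range (τ + 1), c l := by
      rw [Finset.sum_Ico_eq_sum_range, show s + 2 - (s + 1 - τ) = τ + 1 by omega,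
        ← Finset.sum_range_reflect]
      apply Finset.sum_congr rfl
      intro i hi
      have := Finset.mem_range.1 hi
      rw [← hsym i (by omega)]
      congr 1; omega
    rw [hW, e1, e2, ← hC]; ring
  -- `X` and `Y` are the excesses of the lower and of the middle part of the sum over their numbers
  -- of terms.
  set X : ℝ := C - (τ + 1) with hXdef
  set Y : ℝ := M - (s - 2 * τ) with hYdef
  have hcard : ((Finset.Ico (τ + 1) (s + 1 - τ)).card : ℝ) = s - 2 * τ := by
    rw [Nat.card_Ico, show s + 1 - τ - (τ + 1) = s - 2 * τ by omega, Nat.cast_sub (by omega)]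
    push_cast; ring
  have hX : 0 ≤ X := by
    have : ∑ _l ∈ Finset.range (τ + 1), (1 : ℝ) ≤ C := by
      rw [hC]
      apply Finset.sum_le_sum
      intro i hi
      have := Finset.mem_range.1 hi
      exact hone i (by omega)
    simp at this
    linarith
  have hX1 : τ = 1 → X = s / R := by
    rintro rfl
    rw [hXdef, hC, Finset.sum_range_succ, Finset.sum_range_one, h0, hc1]
    push_cast; ring
  have hYge : ∀ b : ℝ, (∀ l ∈ Finset.Ico (τ + 1) (s + 1 - τ), b ≤ c l) →
      (s - 2 * τ) * (b - 1) ≤ Y := by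
    intro b hb
    have : ∑ _l ∈ Finset.Ico (τ + 1) (s + 1 - τ), b ≤ M := by
      rw [hM]
      exact Finset.sum_le_sum hb
    rw [Finset.sum_const, nsmul_eq_mul, hcard] at this
    rw [hYdef]; linarith
  have hY : (s - 2 * τ) * (c (τ + 1 - 1) - 1) ≤ Y := by
    apply hYge
    intro l hl
    have := Finset.mem_Ico.1 hl
    rw [Nat.add_sub_cancel]
    exact ratioSeq_le_of_window hR h0 hc hsym (by omega) (by omega) (by omega)
  have hY0 : τ = 0 → s * (s / R) ≤ Y := by
    rintro rfl
    have := hYge (1 + s / R) (by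
      intro l hl
      have := Finset.mem_Ico.1 hl
      rw [← hc1]
      exact ratioSeq_le_of_window hR h0 hc hsym (by omega) (by omega) (by omega))
    simpa using this
  have hmain := ratioSeq_sum_bound hR h0 hc hs hX hX1 hY hY0
  have hGge : C + τ * (τ + 1) / 2 ≤ G := by
    rw [hG, Finset.sum_range_succ, ← hC]
    have h1 : ∀ m : ℕ, m ≤ s + 1 → (m : ℝ) * (m + 1) / 2
        ≤ ∑ i ∈ Finset.range m, ∑ l ∈ Finset.range (i + 1), c l := by
      intro m
      induction m with
      | zero => intro _; simp
      | succ m ih =>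
        intro hm
        rw [Finset.sum_range_succ]
        have h2 : ∑ _l ∈ Finset.range (m + 1), (1 : ℝ) ≤ ∑ l ∈ Finset.range (m + 1), c l := by
          apply Finset.sum_le_sum
          intro i hi
          have := Finset.mem_range.1 hi
          exact hone i (by omega)
        have h3 := ih (by omega)
        simp at h2
        push_cast; linarith
    have := h1 τ (by omega)
    linarith
  have hWpos : 0 < W := by
    have : (0 : ℝ) ≤ τ := Nat.cast_nonneg τ
    have hYpos : 0 ≤ M := Finset.sum_nonneg (fun l hl => by
      have := Finset.mem_Ico.1 hl
      linarith [hone l (by omega)])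
    linarith
  -- The denominator `W` disappears because `s ≤ 2 * N`; what remains is linear in `G`, with a
  -- nonnegative coefficient.
  have hfrac : 2 * s * G ≤ 2 * G / W * (2 * N + s * (W - 1)) := by
    have hG0 : 0 ≤ G := by
      have : (0 : ℝ) ≤ τ := Nat.cast_nonneg τ
      have : 0 ≤ (τ : ℝ) * (τ + 1) / 2 := by positivity
      linarith
    have : s * W ≤ 2 * N + s * (W - 1) := by linarith
    calc 2 * s * G = 2 * G / W * (s * W) := by field_simp
      _ ≤ _ := mul_le_mul_of_nonneg_left this (by positivity)
  have hCX : C = τ + 1 + X := by rw [hXdef]; ring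
  have hMY : M = s - 2 * τ + Y := by rw [hYdef]; ring
  have hsG : 2 * s * (C + τ * (τ + 1) / 2) ≤ 2 * s * G := mul_le_mul_of_nonneg_left hGge (by linarith)
  rw [hN] at hfrac ⊢
  have heq : (W - 1) * (R * (c τ + 3) - s * τ) - 2 * (2 * R + s) * (C + τ + 1)
      + 2 * s * (C + τ * (τ + 1) / 2)
      = 4 * R * (X + Y + s - 2 * τ - 1) + (R * (c τ - 1) - s * τ) * (s + 1 + 2 * X + Y)
      + s * (τ + 1) * (τ - 2) := by
    rw [hW2, hMY, hCX]; ring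
  linarith

/-! ### Two bins: truncated binomial sums and their recursions -/

/-- Sums over the words of length `n` in two letters that use each letter at most `K` times, of a
function of the number of occurrences of the first letter. -/
noncomputable def twoBinSum (K n : ℕ) (f : ℕ → ℝ) : ℝ :=
  ∑ i ∈ Finset.range (K + 1), if n ≤ i + K then (n.choose i : ℝ) * f i else 0

lemma twoBinSum_congr {K n : ℕ} {f g : ℕ → ℝ}
    (h : ∀ i, i ≤ K → i ≤ n → n ≤ i + K → f i = g i) : twoBinSum K n f = twoBinSum K n g := by
  unfold twoBinSum
  apply Finset.sum_congr rfl
  intro i hi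
  have hi := Finset.mem_range.1 hi
  split_ifs with h1
  · rcases le_or_gt i n with h2 | h2
    · rw [h i (by omega) h2 h1]
    · simp [Nat.choose_eq_zero_of_lt h2]
  · rfl

lemma twoBinSum_mono {K n : ℕ} {f g : ℕ → ℝ}
    (h : ∀ i, i ≤ K → i ≤ n → n ≤ i + K → f i ≤ g i) : twoBinSum K n f ≤ twoBinSum K n g := by
  unfold twoBinSum
  apply Finset.sum_le_sum
  intro i hi
  have hi := Finset.mem_range.1 hi
  split_ifs with h1
  · rcases le_or_gt i n with h2 | h2
    · exact mul_le_mul_of_nonneg_left (h i (by omega) h2 h1) (Nat.cast_nonneg _)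
    · simp [Nat.choose_eq_zero_of_lt h2]
  · exact le_rfl

lemma twoBinSum_add (K n : ℕ) (f g : ℕ → ℝ) :
    twoBinSum K n (fun i => f i + g i) = twoBinSum K n f + twoBinSum K n g := by
  unfold twoBinSum
  rw [← Finset.sum_add_distrib]
  apply Finset.sum_congr rfl
  intro i _
  split_ifs <;> ring

lemma twoBinSum_mul (K n : ℕ) (a : ℝ) (f : ℕ → ℝ) :
    twoBinSum K n (fun i => a * f i) = a * twoBinSum K n f := by
  unfold twoBinSum
  rw [Finset.mul_sum]
  apply Finset.sum_congr rfl
  intro i _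
  split_ifs <;> ring

lemma twoBinSum_nonneg {K n : ℕ} {f : ℕ → ℝ} (h : ∀ i, i ≤ K → 0 ≤ f i) :
    0 ≤ twoBinSum K n f := by
  have := twoBinSum_mono (K := K) (n := n) (f := fun _ => 0) (g := f) (fun i hi _ _ => h i hi)
  simpa [twoBinSum] using this

lemma twoBinSum_pos {K n : ℕ} (hn : n ≤ 2 * K) : 0 < twoBinSum K n (fun _ => 1) := by
  unfold twoBinSum
  apply Finset.sum_pos'
  · intro i _
    split_ifs <;> positivity
  · refine ⟨min n K, by simp, ?_⟩
    rw [if_pos (by omega)]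
    have : 0 < n.choose (min n K) := Nat.choose_pos (by omega)
    simpa using this

lemma twoBinSum_symm (K n : ℕ) (f : ℕ → ℝ) :
    twoBinSum K n f = twoBinSum K n (fun i => f (n - i)) := by
  have key : ∀ g : ℕ → ℝ, twoBinSum K n g
      = ∑ i ∈ (Finset.range (K + 1)).filter (fun i => i ≤ n ∧ n ≤ i + K), (n.choose i : ℝ) * g i := by
    intro g
    unfold twoBinSum
    rw [Finset.sum_filter]
    apply Finset.sum_congr rfl
    intro i _
    by_cases h : i ≤ n
    · simp [h]
    · simp [h, Nat.choose_eq_zero_of_lt (not_le.1 h)]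
  rw [key, key]
  refine Finset.sum_nbij' (fun i => n - i) (fun i => n - i) ?_ ?_ ?_ ?_ ?_
  · intro i hi; simp only [Finset.mem_filter, Finset.mem_range] at hi ⊢; omega
  · intro i hi; simp only [Finset.mem_filter, Finset.mem_range] at hi ⊢; omega
  · intro i hi; simp only [Finset.mem_filter, Finset.mem_range] at hi; omega
  · intro i hi; simp only [Finset.mem_filter, Finset.mem_range] at hi; omega
  · intro i hi
    simp only [Finset.mem_filter, Finset.mem_range] at hi
    rw [Nat.choose_symm hi.2.1, Nat.sub_sub_self hi.2.1]

/-- Pascal's rule: append a last letter to a word of length `n`. The subtracted terms are the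
forbidden extensions, where a letter already used `K` times is appended; there are `n.choose K` of
them for each letter. -/
lemma twoBinSum_succ {K n : ℕ} (hn : n ≤ 2 * K) (f : ℕ → ℝ) :
    twoBinSum K (n + 1) f = twoBinSum K n f + twoBinSum K n (fun i => f (i + 1))
      - (n.choose K : ℝ) * (f (K + 1) + f (n - K)) := by
  have hA : twoBinSum K n (fun i => f (i + 1))
      = (∑ j ∈ Finset.range K, if n ≤ j + K then (n.choose j : ℝ) * f (j + 1) else 0)
        + (n.choose K : ℝ) * f (K + 1) := by
    unfold twoBinSum
    rw [Finset.sum_range_succ, if_pos (by omega)]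
  have hB : (∑ i ∈ Finset.range (K + 1), if n + 1 ≤ i + K then (n.choose i : ℝ) * f i else 0)
      = twoBinSum K n f - (n.choose K : ℝ) * f (n - K) := by
    have h1 : ∑ i ∈ Finset.range (K + 1), (if n = i + K then (n.choose i : ℝ) * f i else 0)
        = (n.choose K : ℝ) * f (n - K) := by
      rcases le_or_gt K n with h | h
      · rw [Finset.sum_eq_single (n - K)]
        · rw [if_pos (by omega), Nat.choose_symm h]
        · intro b _ hb
          rw [if_neg (by omega)]
        · intro hh
          exact absurd (Finset.mem_range.2 (by omega)) hh
      · rw [Nat.choose_eq_zero_of_lt h]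
        simp only [CharP.cast_eq_zero, zero_mul]
        apply Finset.sum_eq_zero
        intro i _
        rw [if_neg (by omega)]
    rw [← h1]
    unfold twoBinSum
    rw [← Finset.sum_sub_distrib]
    apply Finset.sum_congr rfl
    intro i _
    by_cases h2 : n = i + K
    · simp [h2]
    · by_cases h3 : n ≤ i + K
      · rw [if_pos (by omega), if_pos h3, if_neg h2]; ring
      · rw [if_neg (by omega), if_neg h3, if_neg h2]; ring
  have hC : twoBinSum K (n + 1) f
      = (∑ j ∈ Finset.range K, if n ≤ j + K then (n.choose j : ℝ) * f (j + 1) else 0)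
        + (∑ i ∈ Finset.range (K + 1), if n + 1 ≤ i + K then (n.choose i : ℝ) * f i else 0) := by
    unfold twoBinSum
    rw [Finset.sum_range_succ' _ K, Finset.sum_range_succ' _ K, ← add_assoc,
      ← Finset.sum_add_distrib]
    congr 1
    · apply Finset.sum_congr rfl
      intro j _
      by_cases h : n ≤ j + K
      · rw [if_pos (by omega), if_pos h, if_pos (by omega), Nat.choose_succ_succ]
        push_cast; ring
      · rw [if_neg (by omega), if_neg h, if_neg (by omega)]; ring
    · simp
  rw [hC, hB, hA]
  ring

/-- The total weight of level `n`. -/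
noncomputable def twoBinMass (K n : ℕ) : ℝ := twoBinSum K n (fun _ => 1)

/-- The weighted sum of the excess over the threshold `t`. -/
noncomputable def twoBinExcess (K n t : ℕ) : ℝ := twoBinSum K n (fun i => ((i - t : ℕ) : ℝ))

/-- The weighted count of the words in which the first letter occurs at least `t` times. -/
noncomputable def twoBinTail (K n t : ℕ) : ℝ := twoBinSum K n (fun i => if t ≤ i then 1 else 0)

lemma twoBinMass_pos {K n : ℕ} (hn : n ≤ 2 * K) : 0 < twoBinMass K n := twoBinSum_pos hn

lemma twoBinMass_succ {K n : ℕ} (hn : n ≤ 2 * K) :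
    twoBinMass K (n + 1) = 2 * (twoBinMass K n - n.choose K) := by
  unfold twoBinMass
  rw [twoBinSum_succ hn]; ring

lemma twoBinExcess_succ {K n t : ℕ} (hn : n ≤ 2 * K) (ht : n ≤ t + K) (htK : t ≤ K + 1) :
    twoBinExcess K (n + 1) t = 2 * twoBinExcess K n t + twoBinTail K n t
      - n.choose K * (K + 1 - t) := by
  have h : twoBinSum K n (fun i => ((i + 1 - t : ℕ) : ℝ))
      = twoBinExcess K n t + twoBinTail K n t := by
    unfold twoBinExcess twoBinTail
    rw [← twoBinSum_add]
    apply twoBinSum_congr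
    intro i _ _ _
    split_ifs with h
    · rw [show i + 1 - t = (i - t) + 1 by omega]; push_cast; ring
    · rw [show i + 1 - t = 0 by omega, show i - t = 0 by omega]; simp
  unfold twoBinExcess at h ⊢
  rw [twoBinSum_succ hn, h, Nat.cast_sub htK, show n - K - t = 0 by omega]
  push_cast; ring

lemma twoBinSum_single {K n j : ℕ} (hj : j ≤ K) (hn : n ≤ j + K) :
    twoBinSum K n (fun i => if i = j then 1 else 0) = n.choose j := by
  unfold twoBinSum
  rw [Finset.sum_eq_single j]
  · simp [hn]
  · intro b _ hb; simp [hb]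
  · intro h; exact absurd (Finset.mem_range.2 (by omega)) h

lemma twoBinTail_succ {K n t : ℕ} (hn : n ≤ 2 * K) (ht : n ≤ t + K) (htK : t ≤ K) :
    twoBinTail K (n + 1) (t + 1) = 2 * twoBinTail K n (t + 1) + n.choose t - n.choose K := by
  have h : twoBinSum K n (fun i => if t + 1 ≤ i + 1 then (1 : ℝ) else 0)
      = twoBinTail K n (t + 1) + n.choose t := by
    rw [← twoBinSum_single htK ht]
    unfold twoBinTail
    rw [← twoBinSum_add]
    apply twoBinSum_congr
    intro i _ _ _
    by_cases h1 : i = t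
    · simp [h1]
    · by_cases h2 : t ≤ i
      · rw [if_pos (by omega), if_pos (by omega), if_neg h1]; ring
      · rw [if_neg (by omega), if_neg (by omega), if_neg h1]; ring
  unfold twoBinTail at h ⊢
  rw [twoBinSum_succ hn, h, if_pos (by omega), if_neg (by omega)]
  ring

lemma twoBinTail_eq_add {K n t : ℕ} (ht : n ≤ t + K) (htK : t ≤ K) :
    twoBinTail K n t = twoBinTail K n (t + 1) + n.choose t := by
  rw [← twoBinSum_single htK ht]
  unfold twoBinTail
  rw [← twoBinSum_add]
  apply twoBinSum_congr
  intro i _ _ _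
  by_cases h1 : i = t
  · simp [h1]
  · by_cases h2 : t ≤ i
    · rw [if_pos (by omega), if_pos (by omega), if_neg h1]; ring
    · rw [if_neg (by omega), if_neg (by omega), if_neg h1]; ring

lemma twoBinExcess_eq_add (K n t : ℕ) :
    twoBinExcess K n t = twoBinExcess K n (t + 1) + twoBinTail K n (t + 1) := by
  unfold twoBinExcess twoBinTail
  rw [← twoBinSum_add]
  apply twoBinSum_congr
  intro i _ _ _
  split_ifs with h
  · rw [show i - t = (i - (t + 1)) + 1 by omega]; push_cast; ring
  · rw [show i - t = 0 by omega, show i - (t + 1) = 0 by omega]; simp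

/-- By symmetry the mean of the first count is `n / 2`. -/
lemma twoBinSum_id (K n : ℕ) : 2 * twoBinSum K n (fun i => (i : ℝ)) = n * twoBinMass K n := by
  have h := twoBinSum_symm K n (fun i => (i : ℝ))
  have : twoBinSum K n (fun i => (i : ℝ)) + twoBinSum K n (fun i => ((n - i : ℕ) : ℝ))
      = n * twoBinMass K n := by
    unfold twoBinMass
    rw [← twoBinSum_add, ← twoBinSum_mul]
    apply twoBinSum_congr
    intro i _ h _
    rw [Nat.cast_sub h]; ring
  linarith

/-- Writing `(i - t)⁺ = (i - t) + (t - i)⁺` trades the excess over `t` for the shortfall below `t`,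
which involves only the lower end of the window. -/
lemma two_mul_twoBinExcess (K n t : ℕ) : 2 * twoBinExcess K n t
    = (n - 2 * t) * twoBinMass K n + 2 * twoBinSum K n (fun i => ((t - i : ℕ) : ℝ)) := by
  have h := twoBinSum_id K n
  have : twoBinExcess K n t + t * twoBinMass K n
      = twoBinSum K n (fun i => (i : ℝ)) + twoBinSum K n (fun i => ((t - i : ℕ) : ℝ)) := by
    unfold twoBinExcess twoBinMass
    rw [← twoBinSum_add, ← twoBinSum_mul, ← twoBinSum_add]
    apply twoBinSum_congr
    intro i _ _ _
    rcases le_total t i with h | h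
    · rw [Nat.cast_sub h, show t - i = 0 by omega]; push_cast; ring
    · rw [Nat.cast_sub h, show i - t = 0 by omega]; push_cast; ring
  linarith

lemma twoBinExcess_of_le {K n t : ℕ} (h : t + K ≤ n) :
    2 * twoBinExcess K n t = (n - 2 * t) * twoBinMass K n := by
  rw [two_mul_twoBinExcess]
  have : twoBinSum K n (fun i => ((t - i : ℕ) : ℝ)) = twoBinSum K n (fun i => 0 * 1) := by
    apply twoBinSum_congr
    intro i _ _ h3
    rw [show t - i = 0 by omega]; simp
  rw [this, twoBinSum_mul]; ring

lemma twoBinExcess_zero (K n : ℕ) : 2 * twoBinExcess K n 0 = n * twoBinMass K n := by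
  rw [two_mul_twoBinExcess]
  have : twoBinSum K n (fun i => ((0 - i : ℕ) : ℝ)) = twoBinSum K n (fun i => 0 * 1) := by
    apply twoBinSum_congr
    intro i _ _ h3
    simp
  rw [this, twoBinSum_mul]; push_cast; ring

lemma twoBinExcess_eq_zero {K n t : ℕ} (h : K ≤ t) : twoBinExcess K n t = 0 := by
  have : twoBinExcess K n t = twoBinSum K n (fun i => 0 * 1) := by
    apply twoBinSum_congr
    intro i h1 _ _
    rw [show i - t = 0 by omega]; simp
  rw [this, twoBinSum_mul]; ring

lemma twoBinSum_shift (K r : ℕ) (f : ℕ → ℝ) :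
    twoBinSum K (r + K) f
      = ∑ i ∈ Finset.range (K + 1 - r), ((r + K).choose (r + i) : ℝ) * f (r + i) := by
  unfold twoBinSum
  rw [← Finset.sum_filter]
  have : (Finset.range (K + 1)).filter (fun i => r + K ≤ i + K) = Finset.Ico r (K + 1) := by
    ext i; simp; omega
  rw [this, Finset.sum_Ico_eq_sum_range]

/-! ### Two bins: convexity in the level of the mean excess -/

/-- The second difference, in the level, of the mean excess over `t`. -/
noncomputable def twoBinSecondDiff (K n t : ℕ) : ℝ :=
  twoBinExcess K (n + 2) t / twoBinMass K (n + 2) - 2 * (twoBinExcess K (n + 1) t / twoBinMass K (n + 1))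
    + twoBinExcess K n t / twoBinMass K n

/-- Everything is in units of `n.choose K`: `W`, `G`, `E` are mass, excess and tail at level `n`,
`P` is the binomial coefficient at `t - 1`, `L = K + 1 - t`, and `N / R` is the ratio of `(n +
1).choose K` to `n.choose K`. -/
lemma twoBinSecondDiff_algebra {W G E P L R N : ℝ} (hW : W ≠ 0) (hw : W - 1 ≠ 0) (hR : R ≠ 0)
    (h : 2 * R * (W - 1) - N ≠ 0) :
    (2 * (2 * G + E - L) + (2 * E + P - 1) - N / R * L) / (2 * (2 * (W - 1) - N / R))
      - 2 * ((2 * G + E - L) / (2 * (W - 1))) + G / W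
    = (R * (P - 1) * (W - 1) + 2 * N * (E - (L - 2 * G / W)) - (N - 2 * R) * (L - 2 * G / W) * (W - 1))
      / (2 * (W - 1) * (2 * R * (W - 1) - N)) := by
  have e : 2 * (2 * (W - 1) - N / R) = 2 * (2 * R * (W - 1) - N) / R := by field_simp
  rw [e]
  field_simp
  ring

/-- For `n ≥ K` the first count runs over the window from `r = n - K` to `K`, of length `s + 2`, and
`t = r + 1 + τ`. The normalised binomial coefficients on it form a sequence as in `ratioSeq_window`;
the condition `2 * t ≤ n` becomes `2 * τ + 1 ≤ s`. -/
lemma twoBinSecondDiff_nonneg_of_le_half {K n t : ℕ} (hn : n + 2 ≤ 2 * K) (hKn : K ≤ n)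
    (ht : n < t + K) (h2 : 2 * t ≤ n) : 0 ≤ twoBinSecondDiff K n t := by
  obtain ⟨r, hnK⟩ := Nat.exists_eq_add_of_le' hKn
  obtain ⟨s, hK⟩ : ∃ s, K = r + s + 1 := ⟨K - r - 1, by omega⟩
  obtain ⟨τ, rfl⟩ : ∃ τ, t = r + 1 + τ := ⟨t - r - 1, by omega⟩
  have hκ : (0 : ℝ) < n.choose K := by exact_mod_cast Nat.choose_pos hKn
  set κ : ℝ := ((n.choose K : ℕ) : ℝ) with hκdef
  set R : ℝ := (r : ℝ) + 1 with hR
  have hR1 : 1 ≤ R := by rw [hR]; linarith [(Nat.cast_nonneg r : (0 : ℝ) ≤ r)]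
  set c : ℕ → ℝ := fun i => (n.choose (r + i) : ℝ) / κ with hc
  have hchoose : ∀ i, (n.choose (r + i) : ℝ) = κ * c i := by
    intro i; rw [hc]; field_simp
  have hκr : (n.choose r : ℝ) = κ := by
    rw [hκdef, hnK, Nat.choose_symm_add]
  have h0 : c 0 = 1 := by
    rw [hc]; simp only [Nat.add_zero]; rw [hκr]; field_simp
  have hrec : ∀ i, i ≤ s → c (i + 1) * (R + i) = c i * (R + s - i) := by
    intro i hi
    have := Nat.choose_succ_right_eq n (r + i)
    have h3 : ((n.choose (r + i + 1) * (r + i + 1) : ℕ) : ℝ)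
        = (n.choose (r + i) * (n - (r + i)) : ℕ) := by rw [this]
    rw [show n - (r + i) = r + (s - i) + 1 by omega] at h3
    push_cast [Nat.cast_sub hi] at h3
    rw [hc]; dsimp only
    rw [show r + (i + 1) = r + i + 1 by ring, div_mul_eq_mul_div, div_mul_eq_mul_div]
    congr 1
    rw [hR]; linarith
  have hsym : ∀ i, i ≤ s + 1 → c (s + 1 - i) = c i := by
    intro i hi
    rw [hc]; dsimp only
    congr 2
    rw [← Nat.choose_symm (show r + i ≤ n by omega)]
    congr 1; omega
  have hsum : ∀ f : ℕ → ℝ, twoBinSum K n f = κ * ∑ i ∈ Finset.range (s + 2), c i * f (r + i) := by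
    intro f
    rw [hnK, twoBinSum_shift, Finset.mul_sum, ← hnK, show K + 1 - r = s + 2 by omega]
    apply Finset.sum_congr rfl
    intro i _
    rw [hchoose]; ring
  set W : ℝ := ∑ i ∈ Finset.range (s + 2), c i with hW
  set C : ℝ := ∑ i ∈ Finset.range (τ + 1), c i with hC
  set G' : ℝ := ∑ i ∈ Finset.range (τ + 1), ∑ l ∈ Finset.range (i + 1), c l with hG'
  set N : ℝ := 2 * R + s with hN
  set G : ℝ := ((s : ℝ) - 1 - 2 * τ) / 2 * W + G' with hG
  set E : ℝ := W - C with hE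
  have hmass : twoBinMass K n = κ * W := by
    unfold twoBinMass; rw [hsum]; simp [hW]
  have hn' : (n : ℝ) = 2 * r + s + 1 := by rw [hnK, hK]; push_cast; ring
  -- The shortfall below `t` is a double sum over the lowest `τ + 1` terms only, by summation by
  -- parts.
  have hlow : twoBinSum K n (fun i => ((r + 1 + τ - i : ℕ) : ℝ)) = κ * G' := by
    rw [hsum]
    congr 1
    have e1 : ∑ i ∈ Finset.range (s + 2), c i * ((r + 1 + τ - (r + i) : ℕ) : ℝ)
        = ∑ i ∈ Finset.range (τ + 1), c i * ((τ + 1 - i : ℕ) : ℝ) := by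
      symm
      apply Finset.sum_subset_zero_on_sdiff
      · intro i hi; simp only [Finset.mem_range] at hi ⊢; omega
      · intro i hi
        simp only [Finset.mem_sdiff, Finset.mem_range] at hi
        rw [show r + 1 + τ - (r + i) = 0 by omega]; simp
      · intro i _
        rw [show r + 1 + τ - (r + i) = τ + 1 - i by omega]
    rw [e1, hG']
    generalize τ + 1 = m
    induction m with
    | zero => simp
    | succ m ih =>
      rw [Finset.sum_range_succ, Finset.sum_range_succ _ m, ← ih, Finset.sum_range_succ _ m,
        ← add_assoc, ← Finset.sum_add_distrib]
      congr 1
      · apply Finset.sum_congr rfl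
        intro i hi
        have := Finset.mem_range.1 hi
        rw [show m + 1 - i = (m - i) + 1 by omega]; push_cast; ring
      · simp
  have hexc : twoBinExcess K n (r + 1 + τ) = κ * G := by
    have := two_mul_twoBinExcess K n (r + 1 + τ)
    rw [hlow, hmass, hn'] at this
    push_cast at this
    rw [hG]
    linarith
  have htail : twoBinTail K n (r + 1 + τ) = κ * E := by
    unfold twoBinTail
    rw [hsum]
    congr 1
    have e1 : C = ∑ i ∈ Finset.range (s + 2), c i * (if r + 1 + τ ≤ r + i then 0 else 1) := by
      rw [hC]
      apply Finset.sum_subset_zero_on_sdiff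
      · intro i hi; simp only [Finset.mem_range] at hi ⊢; omega
      · intro i hi
        simp only [Finset.mem_sdiff, Finset.mem_range] at hi
        rw [if_pos (by omega)]; simp
      · intro i hi
        simp only [Finset.mem_range] at hi
        rw [if_neg (by omega)]; simp
    rw [hE, e1, hW, ← Finset.sum_sub_distrib]
    apply Finset.sum_congr rfl
    intro i _
    split_ifs <;> ring
  have hP : (n.choose (r + τ) : ℝ) = κ * c τ := hchoose τ
  -- Here `N = n + 1` and `R = r + 1`; by symmetry `(n + 1).choose K = (n + 1).choose (r + 1)`.
  have hκ' : ((n + 1).choose K : ℝ) = κ * (N / R) := by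
    have h3 := Nat.add_one_mul_choose_eq n r
    have h4 : (n + 1).choose K = (n + 1).choose (r + 1) := by
      rw [show n + 1 = (r + 1) + K by omega, Nat.choose_symm_add]
    have h5 : ((n + 1 : ℕ) : ℝ) * n.choose r = (n + 1).choose (r + 1) * ((r + 1 : ℕ) : ℝ) := by
      exact_mod_cast h3
    rw [h4]
    rw [hκr] at h5
    push_cast at h5
    rw [hn'] at h5
    have : R ≠ 0 := by linarith
    field_simp
    rw [hN, hR]; linarith
  have hM1 : twoBinMass K (n + 1) = κ * (2 * (W - 1)) := by
    rw [twoBinMass_succ (by omega), hmass]; ring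
  have hM2 : twoBinMass K (n + 2) = κ * (2 * (2 * (W - 1) - N / R)) := by
    rw [twoBinMass_succ (n := n + 1) (by omega), hM1, hκ']; ring
  have hLcast : ((K : ℝ) + 1 - ((r + 1 + τ : ℕ) : ℝ)) = s + 1 - τ := by
    rw [hK]; push_cast; ring
  have hE1 : twoBinExcess K (n + 1) (r + 1 + τ) = κ * (2 * G + E - (s + 1 - τ)) := by
    rw [twoBinExcess_succ (by omega) (by omega) (by omega), hexc, htail, hLcast]; ring
  have hT1 : twoBinTail K (n + 1) (r + 1 + τ) = κ * (2 * E + c τ - 1) := by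
    have := twoBinTail_succ (K := K) (n := n) (t := r + τ) (by omega) (by omega) (by omega)
    rw [show r + τ + 1 = r + 1 + τ by ring] at this
    rw [this, htail, hP]; ring
  have hE2 : twoBinExcess K (n + 2) (r + 1 + τ)
      = κ * (2 * (2 * G + E - (s + 1 - τ)) + (2 * E + c τ - 1) - N / R * (s + 1 - τ)) := by
    rw [twoBinExcess_succ (n := n + 1) (by omega) (by omega) (by omega), hE1, hT1, hκ', hLcast]
    ring
  have hWpos : 0 < W := by
    have := twoBinMass_pos (K := K) (n := n) (by omega)
    rw [hmass] at this
    exact pos_of_mul_pos_right this hκ.le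
  have hwpos : 0 < W - 1 := by
    have := twoBinMass_pos (K := K) (n := n + 1) (by omega)
    rw [hM1] at this
    have := pos_of_mul_pos_right this hκ.le
    linarith
  have hRpos : 0 < R := by linarith
  have hdpos : 0 < 2 * R * (W - 1) - N := by
    have := twoBinMass_pos (K := K) (n := n + 2) (by omega)
    rw [hM2] at this
    have := pos_of_mul_pos_right this hκ.le
    have h6 : 0 < R * (2 * (W - 1) - N / R) := mul_pos hRpos (by linarith)
    have : R * (2 * (W - 1) - N / R) = 2 * R * (W - 1) - N := by field_simp
    linarith
  unfold twoBinSecondDiff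
  rw [hE2, hM2, hE1, hM1, hexc, hmass, mul_div_mul_left _ _ hκ.ne', mul_div_mul_left _ _ hκ.ne',
    mul_div_mul_left _ _ hκ.ne', twoBinSecondDiff_algebra hWpos.ne' hwpos.ne' hRpos.ne' hdpos.ne']
  apply div_nonneg _ (by positivity)
  have hwin := ratioSeq_window hR1 h0 hrec hsym (τ := τ) (by omega) hW hC hG' hN
  refine hwin.trans (le_of_eq ?_)
  have e1 : 2 * G / W = (s : ℝ) - 1 - 2 * τ + 2 * G' / W := by
    rw [hG]; field_simp
  have e2 : 2 * G' / W * (2 * N + s * (W - 1)) = 2 * N * (2 * G' / W) + s * (2 * G' / W) * (W - 1) := by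
    ring
  rw [e1, e2, hE, hN]
  ring

lemma twoBinSecondDiff_zero {K n : ℕ} (hn : n + 2 ≤ 2 * K) : twoBinSecondDiff K n 0 = 0 := by
  have h : ∀ m, m ≤ 2 * K → twoBinExcess K m 0 / twoBinMass K m = m / 2 := by
    intro m hm
    have h1 := twoBinMass_pos hm
    have h2 := twoBinExcess_zero K m
    field_simp
    linarith
  unfold twoBinSecondDiff
  rw [h n (by omega), h (n + 1) (by omega), h (n + 2) hn]
  push_cast; ring

lemma twoBinSecondDiff_of_le {K n t : ℕ} (hn : n + 2 ≤ 2 * K) (ht : t + K ≤ n) :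
    twoBinSecondDiff K n t = 0 := by
  have h : ∀ m, n ≤ m → m ≤ 2 * K → twoBinExcess K m t / twoBinMass K m = (m - 2 * t) / 2 := by
    intro m hm hm'
    have h1 := twoBinMass_pos hm'
    have h2 := twoBinExcess_of_le (K := K) (n := m) (t := t) (by omega)
    field_simp
    linarith
  unfold twoBinSecondDiff
  rw [h n le_rfl (by omega), h (n + 1) (by omega) (by omega), h (n + 2) (by omega) hn]
  push_cast; ring

lemma twoBinSecondDiff_eq_zero {K n t : ℕ} (h : K ≤ t) : twoBinSecondDiff K n t = 0 := by
  unfold twoBinSecondDiff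
  simp [twoBinExcess_eq_zero h]

/-- The capacity is not felt up to level `n + 2`, the mass doubles at each step, and for `0 < t < K`
the second difference is a quarter of the probability of the point `t - 1`. -/
lemma twoBinSecondDiff_nonneg_of_lt {K n t : ℕ} (hn : n + 2 ≤ K) :
    0 ≤ twoBinSecondDiff K n t := by
  rcases Nat.eq_zero_or_pos t with rfl | ht
  · exact (twoBinSecondDiff_zero (by omega)).ge
  rcases le_or_gt K t with h | h
  · exact (twoBinSecondDiff_eq_zero h).ge
  obtain ⟨t, rfl⟩ := Nat.exists_eq_add_of_le' ht
  have hM := twoBinMass_pos (K := K) (n := n) (by omega)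
  unfold twoBinSecondDiff
  rw [twoBinExcess_succ (n := n + 1) (by omega) (by omega) (by omega),
    twoBinTail_succ (by omega) (by omega) (by omega),
    twoBinMass_succ (n := n + 1) (by omega), twoBinMass_succ (n := n) (by omega),
    twoBinExcess_succ (n := n) (by omega) (by omega) (by omega),
    Nat.choose_eq_zero_of_lt (show n < K by omega),
    Nat.choose_eq_zero_of_lt (show n + 1 < K by omega)]
  have : (0 : ℝ) ≤ n.choose t / (4 * twoBinMass K n) := by positivity
  convert this using 1
  simp only [Nat.cast_zero, sub_zero, zero_mul]
  field_simp
  ring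

/-- The borderline case: levels `n` and `n + 1` are unrestricted, level `n + 2` lacks just the two
constant words. -/
lemma twoBinSecondDiff_nonneg_of_eq {n t : ℕ} (h2 : 2 * t ≤ n) (hn : 1 ≤ n) :
    0 ≤ twoBinSecondDiff (n + 1) n t := by
  rcases Nat.eq_zero_or_pos t with rfl | ht
  · exact (twoBinSecondDiff_zero (by omega)).ge
  obtain ⟨t, rfl⟩ := Nat.exists_eq_add_of_le' ht
  have hM := twoBinMass_pos (K := n + 1) (n := n) (by omega)
  have hM2 := twoBinMass_pos (K := n + 1) (n := n + 2) (by omega)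
  unfold twoBinSecondDiff
  rw [twoBinMass_succ (n := n + 1) (by omega), twoBinMass_succ (n := n) (by omega),
    Nat.choose_eq_zero_of_lt (show n < n + 1 by omega), Nat.choose_self] at hM2
  rw [twoBinExcess_succ (n := n + 1) (by omega) (by omega) (by omega),
    twoBinTail_succ (by omega) (by omega) (by omega),
    twoBinMass_succ (n := n + 1) (by omega), twoBinMass_succ (n := n) (by omega),
    twoBinExcess_succ (n := n) (by omega) (by omega) (by omega),
    Nat.choose_eq_zero_of_lt (show n < n + 1 by omega), Nat.choose_self]
  have h3 := two_mul_twoBinExcess (n + 1) n t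
  rw [twoBinExcess_eq_add] at h3
  have h4 : 0 ≤ twoBinSum (n + 1) n (fun i => ((t - i : ℕ) : ℝ)) :=
    twoBinSum_nonneg (fun i _ => Nat.cast_nonneg _)
  have h5 : ((t + 1 : ℕ) : ℝ) ≤ n.choose t := by
    have : t + 1 ≤ n.choose t := by
      calc t + 1 = (t + 1).choose t := by simp
        _ ≤ _ := Nat.choose_mono t (by omega)
    exact_mod_cast this
  set M := twoBinMass (n + 1) n
  set G := twoBinExcess (n + 1) n (t + 1)
  set E := twoBinTail (n + 1) n (t + 1)
  -- With `t + 1` as the threshold, `n.choose t ≥ t + 1` and `2 * (G + E) ≥ (n - 2 * t) * M`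
  -- together cancel the negative term `(n + 1 - t) * M` exactly.
  have h6 : 0 ≤ (M * (n.choose t - (n + 1 - t)) + 2 * (G + E)) / (M * (4 * M - 2)) := by
    push_cast at h5 hM2
    apply div_nonneg _ (mul_nonneg hM.le (by linarith))
    have := mul_le_mul_of_nonneg_left h5 hM.le
    nlinarith
  push_cast at hM2 ⊢
  simp only [sub_zero, zero_mul] at hM2 ⊢
  have h8 : 2 * M - 1 ≠ 0 := by linarith
  rw [show 4 * M - 2 = 2 * (2 * M - 1) by ring] at h6
  convert h6 using 1
  field_simp
  ring

/-- The weight of the words in which the first letter occurs exactly `j` times. -/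
noncomputable def twoBinPoint (K n j : ℕ) : ℝ := twoBinSum K n (fun i => if i = j then 1 else 0)

lemma twoBinPoint_of_le {K n j : ℕ} (hj : j ≤ K) (hn : n ≤ j + K) :
    twoBinPoint K n j = n.choose j := twoBinSum_single hj hn

lemma twoBinPoint_eq_zero {K n j : ℕ} (hj : K < j) : twoBinPoint K n j = 0 := by
  have : twoBinPoint K n j = twoBinSum K n (fun i => 0 * 1) := by
    apply twoBinSum_congr
    intro i h1 _ _
    rw [if_neg (by omega)]; simp
  rw [this, twoBinSum_mul]; ring

lemma twoBinExcess_second_diff (K n t : ℕ) : twoBinExcess K n t - 2 * twoBinExcess K n (t + 1)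
    + twoBinExcess K n (t + 2) = twoBinPoint K n (t + 1) := by
  have h : twoBinExcess K n t + twoBinExcess K n (t + 2)
      = 2 * twoBinExcess K n (t + 1) + twoBinPoint K n (t + 1) := by
    unfold twoBinExcess twoBinPoint
    rw [← twoBinSum_add, ← twoBinSum_mul, ← twoBinSum_add]
    apply twoBinSum_congr
    intro i _ _ _
    rcases lt_trichotomy i (t + 1) with h | h | h
    · rw [if_neg (by omega), show i - t = 0 by omega, show i - (t + 1) = 0 by omega,
        show i - (t + 2) = 0 by omega]; simp
    · rw [if_pos h, show i - t = 1 by omega, show i - (t + 1) = 0 by omega,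
        show i - (t + 2) = 0 by omega]; simp
    · obtain ⟨d, rfl⟩ := Nat.exists_eq_add_of_lt h
      rw [if_neg (by omega), show t + 1 + d + 1 - t = d + 2 by omega,
        show t + 1 + d + 1 - (t + 1) = d + 1 by omega, show t + 1 + d + 1 - (t + 2) = d by omega]
      push_cast; ring
  linarith

/-- The second difference, in the level, of the point probabilities. -/
noncomputable def twoBinPointDiff (K n j : ℕ) : ℝ :=
  twoBinPoint K (n + 2) j / twoBinMass K (n + 2) - 2 * (twoBinPoint K (n + 1) j / twoBinMass K (n + 1))
    + twoBinPoint K n j / twoBinMass K n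

lemma twoBinSecondDiff_second_diff (K n t : ℕ) : twoBinSecondDiff K n t
    - 2 * twoBinSecondDiff K n (t + 1) + twoBinSecondDiff K n (t + 2)
    = twoBinPointDiff K n (t + 1) := by
  unfold twoBinSecondDiff twoBinPointDiff
  rw [← twoBinExcess_second_diff, ← twoBinExcess_second_diff, ← twoBinExcess_second_diff]
  ring

lemma twoBinPointDiff_eq_zero {K n j : ℕ} (h : K < j) : twoBinPointDiff K n j = 0 := by
  unfold twoBinPointDiff
  simp [twoBinPoint_eq_zero h]

lemma twoBinPointDiff_nonneg_of_lt {K n j : ℕ} (hn : n + 2 ≤ 2 * K) (h : n + 1 < j) :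
    0 ≤ twoBinPointDiff K n j := by
  rcases lt_or_ge K j with h1 | h1
  · exact (twoBinPointDiff_eq_zero h1).ge
  unfold twoBinPointDiff
  rw [twoBinPoint_of_le h1 (by omega), twoBinPoint_of_le h1 (by omega),
    twoBinPoint_of_le h1 (by omega), Nat.choose_eq_zero_of_lt (show n < j by omega),
    Nat.choose_eq_zero_of_lt h]
  have := twoBinMass_pos (K := K) (n := n + 2) (by omega)
  simp
  positivity

/-- Expressing the three binomial coefficients through `(n + 1).choose j` leaves a bracket quadratic
in `m = n + 1 - j`, whose sign can be followed as `j` varies. -/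
lemma twoBinPointDiff_eq {K m j : ℕ} (hn : m + j + 1 ≤ 2 * K) (hj : j ≤ K) (hm : m ≤ j)
    {n : ℕ} (hv : n + 1 = m + j) :
    twoBinPointDiff K n j = ((n + 1).choose j : ℝ) / (twoBinMass K (n + 1) * (m + 1))
      * ((n + 2) * (twoBinMass K (n + 1) / twoBinMass K (n + 2))
        + twoBinMass K (n + 1) / twoBinMass K n / (n + 1) * (m * (m + 1)) - 2 * (m + 1)) := by
  have h0 := twoBinMass_pos (K := K) (n := n) (by omega)
  have h1 := twoBinMass_pos (K := K) (n := n + 1) (by omega)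
  have h2 := twoBinMass_pos (K := K) (n := n + 2) (by omega)
  unfold twoBinPointDiff
  rw [twoBinPoint_of_le hj (by omega), twoBinPoint_of_le hj (by omega),
    twoBinPoint_of_le hj (by omega)]
  have e2 : ((n + 2).choose j : ℝ) * (m + 1) = (n + 1).choose j * (n + 2) := by
    have := Nat.choose_mul_succ_eq (n + 1) j
    rw [show n + 1 + 1 - j = m + 1 by omega] at this
    have h3 : (((n + 1).choose j * (n + 1 + 1) : ℕ) : ℝ) = ((n + 1 + 1).choose j * (m + 1) : ℕ) := by
      rw [this]
    push_cast at h3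
    rw [← h3]; ring
  have e0 : ((n + 1).choose j : ℝ) * m = n.choose j * (n + 1) := by
    have := Nat.choose_mul_succ_eq n j
    rw [show n + 1 - j = m by omega] at this
    have h3 : ((n.choose j * (n + 1) : ℕ) : ℝ) = ((n + 1).choose j * m : ℕ) := by
      rw [this]
    push_cast at h3
    rw [← h3]
  have hm1 : ((m : ℝ) + 1) ≠ 0 := by positivity
  have hn1 : ((n : ℝ) + 1) ≠ 0 := by positivity
  have e2' : ((n + 2).choose j : ℝ) = (n + 1).choose j * (n + 2) / (m + 1) := by
    field_simp; exact e2
  have e0' : (n.choose j : ℝ) = (n + 1).choose j * m / (n + 1) := by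
    field_simp; linarith
  rw [e2', e0']
  field_simp
  ring

/-- When `j` increases, the parameter `m + 1` of the bracket drops to `m` and the bracket grows by
`2 - 2 * b * (m + 1)`, where `b` is the coefficient of `m * (m + 1)`. In the upper half `b * (m + 1)
≤ 1`, as the mass at most doubles and `2 * (m + 1) ≤ n + 1`. -/
lemma twoBinPointDiff_pos_succ {K n j : ℕ} (hn : n + 2 ≤ 2 * K) (hj : j + 1 ≤ K)
    (hjn : j ≤ n) (h2 : n + 1 ≤ 2 * j) (h : 0 < twoBinPointDiff K n j) :
    0 < twoBinPointDiff K n (j + 1) := by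
  obtain ⟨m, hm⟩ := Nat.exists_eq_add_of_le' hjn
  have h0 := twoBinMass_pos (K := K) (n := n) (by omega)
  have h1 := twoBinMass_pos (K := K) (n := n + 1) (by omega)
  rw [twoBinPointDiff_eq (m := m + 1) (by omega) (by omega) (by omega) (by omega)] at h
  rw [twoBinPointDiff_eq (m := m) (by omega) (by omega) (by omega) (by omega)]
  have hc : ∀ i, i ≤ n + 1 → (0 : ℝ) < (n + 1).choose i := by
    intro i hi
    exact_mod_cast Nat.choose_pos hi
  have hq := pos_of_mul_pos_right h (by have := hc j (by omega); positivity)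
  apply mul_pos
  · have := hc (j + 1) (by omega); positivity
  have hb : twoBinMass K (n + 1) / twoBinMass K n / (n + 1) * (m + 1) ≤ 1 := by
    have e1 : twoBinMass K (n + 1) / twoBinMass K n ≤ 2 := by
      rw [div_le_iff₀ h0, twoBinMass_succ (by omega)]
      have : (0 : ℝ) ≤ n.choose K := Nat.cast_nonneg _
      linarith
    have e2 : (2 * (m + 1) : ℝ) ≤ n + 1 := by exact_mod_cast (by omega)
    rw [div_mul_eq_mul_div, div_le_one (by positivity)]
    have : (0 : ℝ) ≤ m + 1 := by positivity
    nlinarith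
  push_cast at hq
  nlinarith

lemma twoBinPointDiff_sign {K n : ℕ} (hn : n + 2 ≤ 2 * K) {i j : ℕ} (h2 : n + 1 ≤ 2 * i)
    (hij : i ≤ j) (h : twoBinPointDiff K n j < 0) : twoBinPointDiff K n i ≤ 0 := by
  by_contra hi
  push Not at hi
  obtain ⟨d, rfl⟩ := Nat.exists_eq_add_of_le hij
  have hjn : i + d ≤ n + 1 := by
    by_contra hc
    exact absurd h (twoBinPointDiff_nonneg_of_lt hn (by omega)).not_gt
  have hjK : i + d ≤ K := by
    by_contra hc
    exact absurd h (twoBinPointDiff_eq_zero (by omega)).not_lt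
  have : ∀ e, e ≤ d → 0 < twoBinPointDiff K n (i + e) := by
    intro e
    induction e with
    | zero => intro _; exact hi
    | succ e ih =>
      intro he
      rw [← add_assoc]
      exact twoBinPointDiff_pos_succ hn (by omega) (by omega) (by omega) (ih (by omega))
  exact absurd h (this d le_rfl).not_gt

/-- Concavity carries the nonnegative slope at `m` to all earlier places, so the values can only
decrease on the way down to 0. -/
lemma neg_of_concave_of_neg {L : ℕ → ℝ} : ∀ m : ℕ,
    (∀ i, i < m → L i - 2 * L (i + 1) + L (i + 2) ≤ 0) → L m < 0 → L m ≤ L (m + 1) → L 0 < 0 := by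
  intro m
  induction m with
  | zero => intro _ h _; exact h
  | succ m ih =>
    intro h h1 h2
    have h3 := h m (by omega)
    rw [show m + 1 + 1 = m + 2 from rfl] at h2
    exact ih (fun i hi => h i (by omega)) (by linarith) (by linarith)

/-- `L` is first concave and then convex. On the convex part it decreases to its eventual value 0.
On the concave part a negative value followed by a nonnegative one would force `L 0 < 0`. -/
lemma nonneg_of_concave_convex {L D : ℕ → ℝ} {K : ℕ} (hD : ∀ i, L i - 2 * L (i + 1) + L (i + 2) = D (i + 1))
    (hK : ∀ i, K ≤ i → L i = 0) (h0 : 0 ≤ L 0)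
    (hsign : ∀ i j, 1 ≤ i → i ≤ j → D j < 0 → D i ≤ 0) (t : ℕ) : 0 ≤ L t := by
  rcases le_or_gt K t with h | h
  · exact (hK t h).ge
  suffices H : ∀ d t, t + d = K → 0 ≤ L t from H (K - t) t (by omega)
  intro d
  induction d with
  | zero => intro t ht; exact (hK t (by omega)).ge
  | succ d ih =>
  intro t ht
  have hnext := ih (t + 1) (by omega)
  by_cases hall : ∀ j, t < j → 0 ≤ D j
  · have hdec : ∀ d, d ≤ K - t → L (K - d + 1) ≤ L (K - d) ∧ 0 ≤ L (K - d) := by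
      intro d
      induction d with
      | zero => intro _; simp [hK K le_rfl, hK (K + 1) (by omega)]
      | succ d ihd =>
        intro hd
        have h1 := ihd (by omega)
        have h2 := hD (K - (d + 1))
        rw [show K - (d + 1) + 2 = K - d + 1 by omega, show K - (d + 1) + 1 = K - d by omega] at h2
        rw [show K - (d + 1) + 1 = K - d by omega]
        have h3 := hall (K - d) (by omega)
        constructor <;> linarith
    have := (hdec (K - t) le_rfl).2
    rwa [show K - (K - t) = t by omega] at this
  · push Not at hall
    obtain ⟨j, hj, hDj⟩ := hall
    by_contra hneg
    push Not at hneg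
    have hconc : ∀ i, i < t + 1 → L i - 2 * L (i + 1) + L (i + 2) ≤ 0 := by
      intro i hi
      rw [hD]
      exact hsign _ j (by omega) (by omega) hDj
    exact absurd h0 (neg_of_concave_of_neg t (fun i hi => hconc i (by omega)) hneg (by linarith)).not_ge

/-- Thresholds up to `n / 2` are treated explicitly. As a function of the threshold, the second
difference in the level has itself the second difference `twoBinPointDiff`, which in the upper half
changes sign at most once, from nonpositive to nonnegative; `nonneg_of_concave_convex` then applies
from `n / 2` on. -/
theorem twoBinSecondDiff_nonneg {K n : ℕ} (hn : n + 2 ≤ 2 * K) (t : ℕ) :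
    0 ≤ twoBinSecondDiff K n t := by
  have hleft : ∀ t, 2 * t ≤ n → 0 ≤ twoBinSecondDiff K n t := by
    intro t ht
    rcases le_or_gt K n with h | h
    · rcases le_or_gt (t + K) n with h1 | h1
      · exact (twoBinSecondDiff_of_le hn h1).ge
      · exact twoBinSecondDiff_nonneg_of_le_half hn h h1 ht
    · rcases le_or_gt (n + 2) K with h1 | h1
      · exact twoBinSecondDiff_nonneg_of_lt h1
      · obtain rfl : K = n + 1 := by omega
        rcases Nat.eq_zero_or_pos t with rfl | h3
        · exact (twoBinSecondDiff_zero hn).ge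
        · exact twoBinSecondDiff_nonneg_of_eq ht (by omega)
  rcases le_or_gt (2 * t) n with h | h
  · exact hleft t h
  obtain ⟨d, rfl⟩ := Nat.exists_eq_add_of_le (show n / 2 ≤ t by omega)
  exact nonneg_of_concave_convex (L := fun i => twoBinSecondDiff K n (n / 2 + i))
    (D := fun i => twoBinPointDiff K n (n / 2 + i)) (K := K)
    (fun i => twoBinSecondDiff_second_diff K n (n / 2 + i))
    (fun i hi => twoBinSecondDiff_eq_zero (by omega)) (hleft _ (by omega))
    (fun i j hi hij => twoBinPointDiff_sign hn (by omega) (by omega)) d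

/-! ### Two bins: interlacing increments and directionally convex functions -/

/-- The mean excess over `t` at level `n`. -/
noncomputable def twoBinMeanExcess (K n t : ℕ) : ℝ := twoBinExcess K n t / twoBinMass K n

/-- The tail probability at level `n`. -/
noncomputable def twoBinTailProb (K n t : ℕ) : ℝ := twoBinTail K n t / twoBinMass K n

lemma twoBinMeanExcess_convex {K n : ℕ} (hn : n + 2 ≤ 2 * K) (t : ℕ) :
    0 ≤ twoBinMeanExcess K (n + 2) t - 2 * twoBinMeanExcess K (n + 1) t
      + twoBinMeanExcess K n t := twoBinSecondDiff_nonneg hn t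

lemma twoBinMeanExcess_of_le {K n t : ℕ} (hn : n ≤ 2 * K) (h : t + K ≤ n) :
    twoBinMeanExcess K n t = (n - 2 * t) / 2 := by
  have h1 := twoBinMass_pos hn
  have h2 := twoBinExcess_of_le h
  unfold twoBinMeanExcess
  field_simp
  linarith

lemma twoBinMeanExcess_zero {K n : ℕ} (hn : n ≤ 2 * K) : twoBinMeanExcess K n 0 = n / 2 := by
  have h1 := twoBinMass_pos hn
  have h2 := twoBinExcess_zero K n
  unfold twoBinMeanExcess
  field_simp
  linarith

lemma twoBinMeanExcess_eq_zero {K n t : ℕ} (h : K ≤ t) : twoBinMeanExcess K n t = 0 := by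
  simp [twoBinMeanExcess, twoBinExcess_eq_zero h]

lemma twoBinMeanExcess_eq_zero' {K n t : ℕ} (h : n ≤ t) : twoBinMeanExcess K n t = 0 := by
  have : twoBinExcess K n t = twoBinSum K n (fun i => 0 * 1) := by
    apply twoBinSum_congr
    intro i _ h1 _
    rw [show i - t = 0 by omega]; simp
  rw [twoBinMeanExcess, this, twoBinSum_mul]; simp

lemma twoBinMeanExcess_eq_add (K n t : ℕ) :
    twoBinMeanExcess K n t = twoBinMeanExcess K n (t + 1) + twoBinTailProb K n (t + 1) := by
  unfold twoBinMeanExcess twoBinTailProb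
  rw [twoBinExcess_eq_add]; ring

lemma choose_le_choose_of_window {n K t : ℕ} (h1 : n ≤ t + K) (h2 : t ≤ K) :
    n.choose K ≤ n.choose t := by
  rcases lt_or_ge n K with h | h
  · simp [Nat.choose_eq_zero_of_lt h]
  have mono : ∀ a b, a ≤ b → 2 * b ≤ n + 1 → n.choose a ≤ n.choose b := by
    intro a b hab hb
    induction b, hab using Nat.le_induction with
    | base => exact le_rfl
    | succ b hab ih =>
      rcases lt_or_ge (2 * b + 1) n with h | h
      · exact (ih (by omega)).trans (Nat.choose_le_succ_of_lt_half_left (by omega))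
      · refine (ih (by omega)).trans (le_of_eq ?_)
        rw [← Nat.choose_symm (show b ≤ n by omega)]
        congr 1; omega
  rcases le_total (2 * t) n with h4 | h4
  · rw [← Nat.choose_symm h]
    exact mono _ _ (by omega) (by omega)
  · rcases le_or_gt t n with h5 | h5
    · rw [← Nat.choose_symm h, ← Nat.choose_symm h5]
      exact mono _ _ (by omega) (by omega)
    · omega

lemma two_mul_choose_le_mass {K n : ℕ} (hn : n < 2 * K) :
    2 * (n.choose K : ℝ) ≤ twoBinMass K n := by
  rcases lt_or_ge n K with h | h
  · rw [Nat.choose_eq_zero_of_lt h]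
    have := twoBinMass_pos (K := K) (n := n) (by omega)
    simpa using this.le
  have e1 := twoBinSum_single (K := K) (n := n) (j := K) le_rfl (by omega)
  have e2 := twoBinSum_single (K := K) (n := n) (j := n - K) (by omega) (by omega)
  rw [Nat.choose_symm h] at e2
  have : (n.choose K : ℝ) + n.choose K ≤ twoBinMass K n := by
    nth_rewrite 1 [← e1]
    rw [← e2, ← twoBinSum_add]
    apply twoBinSum_mono
    intro i _ _ _
    by_cases h1 : i = K
    · rw [if_pos h1, if_neg (by omega)]; norm_num
    · rw [if_neg h1]; split_ifs <;> norm_num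
  linarith

lemma two_mul_choose_le_choose_succ {K n : ℕ} (hn : n < 2 * K) :
    2 * n.choose K ≤ (n + 1).choose K := by
  obtain ⟨J, rfl⟩ := Nat.exists_eq_add_of_le' (show 1 ≤ K by omega)
  rw [Nat.choose_succ_succ']
  have := choose_le_choose_of_window (n := n) (K := J + 1) (t := J) (by omega) (by omega)
  omega

lemma two_mul_twoBinExcess_le {K n t : ℕ} (h : n ≤ t + K) (ht : t ≤ K) :
    2 * twoBinExcess K n t ≤ (K - t) * twoBinMass K n := by
  have h1 := twoBinSum_symm K n (fun i => ((i - t : ℕ) : ℝ))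
  have h2 : twoBinExcess K n t + twoBinExcess K n t ≤ (K - t) * twoBinMass K n := by
    unfold twoBinExcess twoBinMass
    nth_rewrite 2 [h1]
    rw [← twoBinSum_add, ← twoBinSum_mul]
    apply twoBinSum_mono
    intro i hi hin _
    rw [mul_one, ← Nat.cast_sub ht]
    exact_mod_cast (by omega)
  linarith

/-- The point weights `y`, `p` and the quantities `e`, `g` are divided by the mass at level `n`,
`y'` by that at level `n + 1`, and `T = K - t`. The gap in `twoBinMeanExcess_transfer` then has a
numerator with two separately nonnegative summands. -/
lemma twoBin_transfer_algebra {W y y' e p g T : ℝ} (hW : W ≠ 0) (hy : 1 - y ≠ 0) (hy' : 1 - y' ≠ 0) :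
    (W * (2 * g + (e + p) - y * (T + 1))) / (2 * (W - W * y)) - W * g / W
      - ((2 * (W * (2 * (g - e) + e - y * T)) + W * (2 * e + p - y) - 2 * (W - W * y) * y' * T)
          / (2 * (2 * (W - W * y) - 2 * (W - W * y) * y'))
        - (W * (2 * (g - e) + e - y * T)) / (2 * (W - W * y)))
    = ((p - y) * (1 / 2 - y') + (T - 2 * g) * (y' * (1 + y) - y)) / (2 * (1 - y) * (1 - y')) := by
  rw [show 2 * (2 * (W - W * y) - 2 * (W - W * y) * y') = 4 * W * (1 - y) * (1 - y') by ring,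
    show 2 * (W - W * y) = 2 * W * (1 - y) by ring]
  field_simp
  ring

/-- With `S j` the increment of the mean excess over `j` from level `n` to `n + 1`, and `S' j` the
next one, this and convexity give the interlacing `S (j + 1) ≤ S' (j + 1) ≤ S j` used in
`twoBinFlux_mono`. Inside the window the sign follows from `y ≤ p`, `y' ≤ 1 / 2`, `2 * g ≤ K - t`
and `y ≤ y' * (1 - y)`. -/
lemma twoBinMeanExcess_transfer {K n : ℕ} (hn : n + 2 ≤ 2 * K) (t : ℕ) :
    twoBinMeanExcess K (n + 2) (t + 1) - twoBinMeanExcess K (n + 1) (t + 1)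
      ≤ twoBinMeanExcess K (n + 1) t - twoBinMeanExcess K n t := by
  rcases le_or_gt (t + K) n with h1 | h1
  · rw [twoBinMeanExcess_of_le (by omega) (by omega), twoBinMeanExcess_of_le (by omega) (by omega),
      twoBinMeanExcess_of_le (by omega) (by omega), twoBinMeanExcess_of_le (by omega) (by omega)]
    push_cast
    linarith
  rcases le_or_gt K t with h2 | h2
  · rw [twoBinMeanExcess_eq_zero (by omega), twoBinMeanExcess_eq_zero (by omega),
      twoBinMeanExcess_eq_zero (by omega), twoBinMeanExcess_eq_zero (by omega)]
  have hM0 := twoBinMass_pos (K := K) (n := n) (by omega)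
  have hM1 := twoBinMass_pos (K := K) (n := n + 1) (by omega)
  have hM2 := twoBinMass_pos (K := K) (n := n + 2) (by omega)
  have hy2 := two_mul_choose_le_mass (K := K) (n := n + 1) (by omega)
  have hκ2 : (2 * n.choose K : ℝ) ≤ (n + 1).choose K := by
    exact_mod_cast two_mul_choose_le_choose_succ (K := K) (n := n) (by omega)
  have hpy : (n.choose K : ℝ) ≤ n.choose t := by
    exact_mod_cast choose_le_choose_of_window (K := K) (n := n) (t := t) (by omega) (by omega)
  have hU := two_mul_twoBinExcess_le (K := K) (n := n) (t := t) (by omega) (by omega)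
  have e1 := twoBinExcess_succ (K := K) (n := n) (t := t) (by omega) (by omega) (by omega)
  have e2 := twoBinExcess_succ (K := K) (n := n) (t := t + 1) (by omega) (by omega) (by omega)
  have e3 := twoBinExcess_succ (K := K) (n := n + 1) (t := t + 1) (by omega) (by omega) (by omega)
  have e4 := twoBinTail_succ (K := K) (n := n) (t := t) (by omega) (by omega) (by omega)
  have e5 := twoBinTail_eq_add (K := K) (n := n) (t := t) (by omega) (by omega)
  have e6 := twoBinExcess_eq_add K n t
  have m1 := twoBinMass_succ (K := K) (n := n) (by omega)
  have m2 := twoBinMass_succ (K := K) (n := n + 1) (by omega)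
  unfold twoBinMeanExcess
  set W := twoBinMass K n
  obtain ⟨y, hy⟩ : ∃ y, (n.choose K : ℝ) = W * y := ⟨n.choose K / W, by field_simp⟩
  obtain ⟨p, hp⟩ : ∃ y, (n.choose t : ℝ) = W * y := ⟨n.choose t / W, by field_simp⟩
  obtain ⟨e, he⟩ : ∃ y, twoBinTail K n (t + 1) = W * y := ⟨twoBinTail K n (t + 1) / W, by field_simp⟩
  obtain ⟨g, hg⟩ : ∃ y, twoBinExcess K n t = W * y := ⟨twoBinExcess K n t / W, by field_simp⟩
  obtain ⟨y', hy'⟩ : ∃ y, ((n + 1).choose K : ℝ) = twoBinMass K (n + 1) * y :=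
    ⟨(n + 1).choose K / twoBinMass K (n + 1), by field_simp⟩
  have hy0 : 0 ≤ y := by
    have : 0 ≤ W * y := by rw [← hy]; positivity
    exact nonneg_of_mul_nonneg_right this hM0
  have hyy : y ≤ p := by
    rw [hy, hp] at hpy
    exact le_of_mul_le_mul_left hpy hM0
  have hyhalf : y' ≤ 1 / 2 := by
    have : twoBinMass K (n + 1) * y' ≤ twoBinMass K (n + 1) * (1 / 2) := by linarith
    exact le_of_mul_le_mul_left this hM1
  rw [hy] at m1
  have hy1 : 0 < 1 - y := by
    have : 0 < W * (1 - y) := by linarith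
    exact pos_of_mul_pos_right this hM0.le
  have hyy' : y ≤ y' * (1 - y) := by
    have : W * (2 * y) ≤ W * (2 * (y' * (1 - y))) := by
      calc W * (2 * y) = 2 * n.choose K := by rw [hy]; ring
        _ ≤ (n + 1).choose K := hκ2
        _ = _ := by rw [hy', m1]; ring
    have := le_of_mul_le_mul_left this hM0
    linarith
  have hg2 : 0 ≤ (K - t) - 2 * g := by
    have : W * (2 * g) ≤ W * (K - t) := by rw [hg] at hU; linarith
    have := le_of_mul_le_mul_left this hM0
    linarith
  have hy'0 : 0 ≤ y' := by
    have : 0 ≤ twoBinMass K (n + 1) * y' := by rw [← hy']; positivity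
    exact nonneg_of_mul_nonneg_right this hM1
  have e6' : twoBinExcess K n (t + 1) = W * (g - e) := by
    rw [hg, he] at e6; linarith
  rw [he, hp] at e5
  rw [hg, e5, hy] at e1
  rw [e6', he, hy] at e2
  rw [he, hp, hy] at e4
  rw [e2, e4, hy', m1] at e3
  rw [hy', m1] at m2
  rw [e1, e2, e3, m2, m1, hg, ← sub_nonneg]
  have key := twoBin_transfer_algebra (W := W) (y := y) (y' := y') (e := e) (p := p) (g := g)
    (T := K - t) hM0.ne' hy1.ne' (by linarith)
  refine le_of_le_of_eq ?_ (key.symm.trans ?_)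
  · apply div_nonneg
    · have a1 : 0 ≤ (p - y) * (1 / 2 - y') := mul_nonneg (by linarith) (by linarith)
      have a2 : 0 ≤ (K - t - 2 * g) * (y' * (1 + y) - y) := by
        apply mul_nonneg hg2
        nlinarith [mul_nonneg hy'0 hy0]
      linarith
    · have : 0 ≤ 1 - y' := by linarith
      positivity
  · push_cast
    ring

lemma twoBinTailProb_eq_one {K n t : ℕ} (hn : n ≤ 2 * K) (h : t + K ≤ n ∨ t = 0) :
    twoBinTailProb K n t = 1 := by
  have : twoBinTail K n t = twoBinMass K n := by
    apply twoBinSum_congr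
    intro i _ _ _
    rw [if_pos (by omega)]
  rw [twoBinTailProb, this, div_self (twoBinMass_pos hn).ne']

lemma twoBinTailProb_eq_zero {K n t : ℕ} (h : K < t ∨ n < t) : twoBinTailProb K n t = 0 := by
  have : twoBinTail K n t = twoBinSum K n (fun _ => 0 * 1) := by
    apply twoBinSum_congr
    intro i _ _ _
    rw [if_neg (by omega)]; simp
  rw [twoBinTailProb, this, twoBinSum_mul]; simp

lemma twoBinTail_le_mass (K n t : ℕ) : twoBinTail K n t ≤ twoBinMass K n := by
  apply twoBinSum_mono
  intro i _ _ _
  split_ifs <;> norm_num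

lemma twoBinTail_nonneg (K n t : ℕ) : 0 ≤ twoBinTail K n t := by
  apply twoBinSum_nonneg
  intro i _
  split_ifs <;> norm_num

lemma twoBinTailProb_le_one {K n : ℕ} (hn : n ≤ 2 * K) (t : ℕ) : twoBinTailProb K n t ≤ 1 := by
  rw [twoBinTailProb, div_le_one (twoBinMass_pos hn)]
  exact twoBinTail_le_mass K n t

lemma twoBinTailProb_succ_ge {K n : ℕ} (hn : n + 1 ≤ 2 * K) (t : ℕ) :
    twoBinTailProb K n t ≤ twoBinTailProb K (n + 1) t := by
  rcases Nat.eq_zero_or_pos t with rfl | ht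
  · rw [twoBinTailProb_eq_one (by omega) (Or.inr rfl), twoBinTailProb_eq_one hn (Or.inr rfl)]
  rcases le_or_gt (t + K) (n + 1) with h1 | h1
  · rw [twoBinTailProb_eq_one hn (Or.inl h1)]
    exact twoBinTailProb_le_one (by omega) t
  rcases lt_or_ge K t with h2 | h2
  · rw [twoBinTailProb_eq_zero (Or.inl h2), twoBinTailProb_eq_zero (Or.inl h2)]
  obtain ⟨t, rfl⟩ := Nat.exists_eq_add_of_le' ht
  have hM0 := twoBinMass_pos (K := K) (n := n) (by omega)
  have hM1 := twoBinMass_pos (K := K) (n := n + 1) (by omega)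
  unfold twoBinTailProb
  rw [div_le_div_iff₀ hM0 hM1, twoBinTail_succ (by omega) (by omega) (by omega),
    twoBinMass_succ (by omega)]
  have hpy : (n.choose K : ℝ) ≤ n.choose t := by
    exact_mod_cast choose_le_choose_of_window (K := K) (n := n) (t := t) (by omega) (by omega)
  have h3 := mul_nonneg (twoBinTail_nonneg K n (t + 1)) (Nat.cast_nonneg (α := ℝ) (n.choose K))
  have h4 := mul_nonneg hM0.le (sub_nonneg.2 hpy)
  nlinarith

lemma twoBinTailProb_symm {K n t : ℕ} (hn : n ≤ 2 * K) (ht : t ≤ n) :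
    twoBinTailProb K n t = 1 - twoBinTailProb K n (n - t + 1) := by
  have hM := twoBinMass_pos hn
  have : twoBinTail K n (n - t + 1) + twoBinTail K n t = twoBinMass K n := by
    unfold twoBinTail twoBinMass
    rw [twoBinSum_symm, ← twoBinSum_add]
    apply twoBinSum_congr
    intro i _ _ _
    split_ifs <;> first | omega | norm_num
  unfold twoBinTailProb
  field_simp
  linarith

/-- Let `X`, `X'` be the tails of laws on two consecutive antidiagonals. The mass `X j - X (j + 1)`
at `(j, v - j)` is split: `X' (j + 1) - X (j + 1)` moves one step in the first direction and `X j -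
X' (j + 1)` one step in the second. -/
lemma antidiagonal_shift_sub (X X' : ℕ → ℝ) (G : ℕ → ℕ → ℝ) (v : ℕ) (h0 : X' 0 = X 0)
    (h1 : X (v + 1) = X' (v + 2)) :
    ∑ j ∈ Finset.range (v + 2), (X' j - X' (j + 1)) * G j (v + 1 - j)
      - ∑ j ∈ Finset.range (v + 1), (X j - X (j + 1)) * G j (v - j)
    = ∑ j ∈ Finset.range (v + 1),
        ((X' (j + 1) - X (j + 1)) * (G (j + 1) (v - j) - G j (v - j))
          + (X j - X' (j + 1)) * (G j (v - j + 1) - G j (v - j))) := by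
  have e : ∑ j ∈ Finset.range (v + 2), (X' j - X' (j + 1)) * G j (v + 1 - j)
      = ∑ j ∈ Finset.range (v + 2), (X' j - X j) * G j (v + 1 - j)
        + ∑ j ∈ Finset.range (v + 2), (X j - X' (j + 1)) * G j (v + 1 - j) := by
    rw [← Finset.sum_add_distrib]
    apply Finset.sum_congr rfl
    intro j _; ring
  rw [e, Finset.sum_range_succ', Finset.sum_range_succ _ (v + 1), h0, h1, sub_self, sub_self,
    zero_mul, zero_mul, add_zero, add_zero, ← Finset.sum_add_distrib, ← Finset.sum_sub_distrib]
  apply Finset.sum_congr rfl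
  intro j hj
  have := Finset.mem_range.1 hj
  rw [show v + 1 - (j + 1) = v - j by omega, show v + 1 - j = v - j + 1 by omega]
  ring

/-- The mean over level `n` of a function of the two counts. -/
noncomputable def twoBinMean (K n : ℕ) (F : ℕ → ℕ → ℝ) : ℝ :=
  twoBinSum K n (fun i => F i (n - i)) / twoBinMass K n

lemma twoBinMean_eq_sum_tail (K n : ℕ) (F : ℕ → ℕ → ℝ) :
    twoBinMean K n F
      = ∑ j ∈ Finset.range (n + 1), (twoBinTailProb K n j - twoBinTailProb K n (j + 1)) * F j (n - j) := by
  have h : ∀ j, twoBinTail K n j - twoBinTail K n (j + 1)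
      = twoBinSum K n (fun i => if i = j then 1 else 0) := by
    intro j
    rw [sub_eq_iff_eq_add]
    unfold twoBinTail
    rw [← twoBinSum_add]
    apply twoBinSum_congr
    intro i _ _ _
    split_ifs <;> first | omega | norm_num
  have h2 : ∀ s : Finset ℕ, ∑ j ∈ s, twoBinSum K n (fun i => if i = j then 1 else 0) * F j (n - j)
      = twoBinSum K n (fun i => ∑ j ∈ s, if i = j then F j (n - j) else 0) := by
    intro s
    induction s using Finset.induction_on with
    | empty => simp [twoBinSum]
    | insert a s ha ih =>
      simp only [Finset.sum_insert ha]
      rw [twoBinSum_add, ih, mul_comm, ← twoBinSum_mul]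
      simp
  unfold twoBinMean twoBinTailProb
  simp_rw [← sub_div, h, div_mul_eq_mul_div]
  rw [← Finset.sum_div, h2]
  congr 1
  apply twoBinSum_congr
  intro i _ hi _
  rw [Finset.sum_ite_eq, if_pos (Finset.mem_range.2 (by omega))]

/-- The mean slope in the first direction along the monotone coupling of levels `n` and `n + 1`. -/
noncomputable def twoBinFlux (K n : ℕ) (u : ℕ → ℕ → ℝ) : ℝ :=
  ∑ j ∈ Finset.range (n + 1),
    (twoBinTailProb K (n + 1) (j + 1) - twoBinTailProb K n (j + 1)) * u j (n - j)

lemma twoBinMean_succ_sub {K n : ℕ} (hn : n + 1 ≤ 2 * K) (F : ℕ → ℕ → ℝ) :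
    twoBinMean K (n + 1) F - twoBinMean K n F
      = twoBinFlux K n (fun a b => F (a + 1) b - F a b)
        + twoBinFlux K n (fun a b => F b (a + 1) - F b a) := by
  rw [twoBinMean_eq_sum_tail, twoBinMean_eq_sum_tail, antidiagonal_shift_sub,
    Finset.sum_add_distrib]
  · unfold twoBinFlux
    congr 1
    -- Exchanging the two counts turns the second-direction masses into first-direction ones.
    rw [← Finset.sum_range_reflect]
    apply Finset.sum_congr rfl
    intro j hj
    have hj := Finset.mem_range.1 hj
    rw [show n + 1 - 1 - j = n - j by omega, twoBinTailProb_symm (n := n) (by omega) (by omega),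
      twoBinTailProb_symm (n := n + 1) (by omega) (by omega),
      show n - (n - j) = j by omega, show n + 1 - (n - j + 1) = j by omega]
    ring
  · rw [twoBinTailProb_eq_one (by omega) (Or.inr rfl), twoBinTailProb_eq_one (by omega) (Or.inr rfl)]
  · rw [twoBinTailProb_eq_zero (by omega), twoBinTailProb_eq_zero (by omega)]

lemma twoBinFlux_mono {K n : ℕ} (hn : n + 2 ≤ 2 * K) {u : ℕ → ℕ → ℝ}
    (h1 : ∀ a b, a + 2 ≤ K → b ≤ K → u a b ≤ u (a + 1) b)
    (h2 : ∀ a b, a + 1 ≤ K → b + 1 ≤ K → u a b ≤ u a (b + 1)) :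
    twoBinFlux K n u ≤ twoBinFlux K (n + 1) u := by
  -- A tail probability is a difference of consecutive mean excesses, so the flux is again an
  -- antidiagonal sum, now with weights `S j - S (j + 1)`, and can be shifted a second time.
  set S : ℕ → ℝ := fun j => twoBinMeanExcess K (n + 1) j - twoBinMeanExcess K n j with hS
  set S' : ℕ → ℝ := fun j => twoBinMeanExcess K (n + 2) j - twoBinMeanExcess K (n + 1) j with hS'
  have hf : twoBinFlux K n u = ∑ j ∈ Finset.range (n + 1), (S j - S (j + 1)) * u j (n - j) := by
    apply Finset.sum_congr rfl
    intro j _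
    rw [hS]; dsimp only
    rw [twoBinMeanExcess_eq_add K (n + 1) j, twoBinMeanExcess_eq_add K n j]
    ring
  have hf' : twoBinFlux K (n + 1) u
      = ∑ j ∈ Finset.range (n + 2), (S' j - S' (j + 1)) * u j (n + 1 - j) := by
    apply Finset.sum_congr rfl
    intro j _
    rw [hS']; dsimp only
    rw [twoBinMeanExcess_eq_add K (n + 1) j, twoBinMeanExcess_eq_add K (n + 2) j]
    ring
  rw [← sub_nonneg, hf, hf', antidiagonal_shift_sub]
  · apply Finset.sum_nonneg
    intro j hj
    have hj := Finset.mem_range.1 hj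
    apply add_nonneg
    · by_cases h : j + 2 ≤ K ∧ n - j ≤ K
      · apply mul_nonneg _ (sub_nonneg.2 (h1 _ _ h.1 h.2))
        have := twoBinMeanExcess_convex hn (j + 1)
        rw [hS, hS']; dsimp only; linarith
      -- Outside the box nothing is known about `u`, but its coefficient vanishes: the mean excess
      -- is affine in the level below the window and zero above it.
      · refine le_of_eq ?_
        rw [hS, hS']; dsimp only
        by_cases h3 : j + 2 ≤ K
        · rw [twoBinMeanExcess_of_le (by omega) (by omega),
            twoBinMeanExcess_of_le (by omega) (by omega), twoBinMeanExcess_of_le (by omega) (by omega)]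
          push_cast; ring
        · rw [twoBinMeanExcess_eq_zero (by omega), twoBinMeanExcess_eq_zero (by omega),
            twoBinMeanExcess_eq_zero (by omega)]
          ring
    · by_cases h : j + 1 ≤ K ∧ n - j + 1 ≤ K
      · apply mul_nonneg _ (sub_nonneg.2 (h2 _ _ h.1 h.2))
        have := twoBinMeanExcess_transfer hn j
        rw [hS, hS']; dsimp only; linarith
      · refine le_of_eq ?_
        rw [hS, hS']; dsimp only
        by_cases h3 : j + 1 ≤ K
        · rw [twoBinMeanExcess_of_le (by omega) (by omega), twoBinMeanExcess_of_le (by omega) (by omega),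
            twoBinMeanExcess_of_le (by omega) (by omega), twoBinMeanExcess_of_le (by omega) (by omega)]
          push_cast; ring
        · rw [twoBinMeanExcess_eq_zero (by omega), twoBinMeanExcess_eq_zero (by omega),
            twoBinMeanExcess_eq_zero (by omega), twoBinMeanExcess_eq_zero (by omega)]
          ring
  · rw [hS, hS']; dsimp only
    rw [twoBinMeanExcess_zero (by omega), twoBinMeanExcess_zero (by omega),
      twoBinMeanExcess_zero (by omega)]
    push_cast; ring
  · rw [hS, hS']; dsimp only
    rw [twoBinMeanExcess_eq_zero' (by omega), twoBinMeanExcess_eq_zero' (by omega),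
      twoBinMeanExcess_eq_zero' (by omega), twoBinMeanExcess_eq_zero' (by omega)]

/-- The means over the levels of a directionally convex function of two counts are convex in the
level. -/
theorem twoBinMean_convex {K n : ℕ} (hn : n + 2 ≤ 2 * K) {F : ℕ → ℕ → ℝ}
    (h11 : ∀ a b, a + 2 ≤ K → b ≤ K → 0 ≤ F (a + 2) b - 2 * F (a + 1) b + F a b)
    (h22 : ∀ a b, a ≤ K → b + 2 ≤ K → 0 ≤ F a (b + 2) - 2 * F a (b + 1) + F a b)
    (h12 : ∀ a b, a + 1 ≤ K → b + 1 ≤ K → 0 ≤ F (a + 1) (b + 1) - F (a + 1) b - F a (b + 1) + F a b) :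
    0 ≤ twoBinMean K (n + 2) F - 2 * twoBinMean K (n + 1) F + twoBinMean K n F := by
  have e1 := twoBinMean_succ_sub (K := K) (n := n) (by omega) F
  have e2 := twoBinMean_succ_sub (K := K) (n := n + 1) (by omega) F
  have f1 := twoBinFlux_mono hn (u := fun a b => F (a + 1) b - F a b)
    (fun a b ha hb => by have := h11 a b ha hb; rw [show a + 1 + 1 = a + 2 from rfl]; linarith)
    (fun a b ha hb => by have := h12 a b ha hb; linarith)
  have f2 := twoBinFlux_mono hn (u := fun a b => F b (a + 1) - F b a)
    (fun a b ha hb => by have := h22 b a hb ha; rw [show a + 1 + 1 = a + 2 from rfl]; linarith)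
    (fun a b ha hb => by have := h12 b a hb ha; linarith)
  rw [show n + 1 + 1 = n + 2 from rfl] at e2
  linarith

/-! ### Many bins: exchangeable weights and resampling of pairs -/

/-- The configurations of loads at most `K` that vanish outside `s`. -/
def loadBox {ι : Type*} [Fintype ι] [DecidableEq ι] (K : ℕ) (s : Finset ι) : Finset (ι → ℕ) :=
  Fintype.piFinset fun i => if i ∈ s then Finset.range (K + 1) else {0}

/-- The exponential weight of a configuration. -/
noncomputable def loadWeight {ι : Type*} [Fintype ι] (x : ι → ℕ) : ℝ := ∏ i, ((x i).factorial : ℝ)⁻¹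

lemma loadWeight_pos {ι : Type*} [Fintype ι] (x : ι → ℕ) : 0 < loadWeight x :=
  Finset.prod_pos fun i _ => by positivity

section Box
variable {ι : Type*} [Fintype ι] [DecidableEq ι]

lemma mem_loadBox {K : ℕ} {s : Finset ι} {x : ι → ℕ} :
    x ∈ loadBox K s ↔ (∀ i, x i ≤ K) ∧ ∀ i, i ∉ s → x i = 0 := by
  simp only [loadBox, Fintype.mem_piFinset]
  constructor
  · intro h
    refine ⟨fun i => ?_, fun i hi => ?_⟩
    · have := h i
      split_ifs at this
      · exact Nat.lt_succ_iff.1 (Finset.mem_range.1 this)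
      · rw [Finset.mem_singleton] at this; omega
    · have := h i
      rw [if_neg hi, Finset.mem_singleton] at this
      exact this
  · intro h i
    split_ifs with hi
    · exact Finset.mem_range.2 (Nat.lt_succ_iff.2 (h.1 i))
    · exact Finset.mem_singleton.2 (h.2 i hi)

lemma sum_loadBox_insert {K : ℕ} {s : Finset ι} {b : ι} (hb : b ∉ s) (G : (ι → ℕ) → ℝ) :
    ∑ x ∈ loadBox K (insert b s), G x
      = ∑ y ∈ loadBox K s, ∑ a ∈ Finset.range (K + 1), G (Function.update y b a) := by
  rw [← Finset.sum_product']
  symm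
  refine Finset.sum_nbij' (fun p => Function.update p.1 b p.2)
    (fun x => (Function.update x b 0, x b)) ?_ ?_ ?_ ?_ ?_
  · rintro ⟨y, a⟩ h
    rw [Finset.mem_product, mem_loadBox, Finset.mem_range] at h
    dsimp only at h
    rw [mem_loadBox]
    refine ⟨fun i => ?_, fun i hi => ?_⟩
    · by_cases hib : i = b
      · subst hib; simp; omega
      · simp [hib, h.1.1 i]
    · rw [Finset.mem_insert, not_or] at hi
      simp [hi.1, h.1.2 i hi.2]
  · intro x h
    rw [mem_loadBox] at h
    rw [Finset.mem_product, mem_loadBox, Finset.mem_range]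
    refine ⟨⟨fun i => ?_, fun i hi => ?_⟩, Nat.lt_succ_iff.2 (h.1 b)⟩
    · by_cases hib : i = b
      · subst hib; simp
      · simp [hib, h.1 i]
    · by_cases hib : i = b
      · subst hib; simp
      · simp only [Function.update_of_ne hib]
        exact h.2 i (by simp [hib, hi])
  · rintro ⟨y, a⟩ h
    rw [Finset.mem_product, mem_loadBox] at h
    have := h.1.2 b hb
    dsimp only at this
    ext i
    · by_cases hib : i = b
      · subst hib; simp [this]
      · simp [hib]
    · simp
  · intro x _
    simp
  · intro _ _; rfl

lemma loadWeight_update {y : ι → ℕ} {b : ι} (hy : y b = 0) (a : ℕ) :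
    loadWeight (Function.update y b a) = (a.factorial : ℝ)⁻¹ * loadWeight y := by
  unfold loadWeight
  rw [← Finset.mul_prod_erase _ _ (Finset.mem_univ b),
    ← Finset.mul_prod_erase _ (fun i => ((y i).factorial : ℝ)⁻¹) (Finset.mem_univ b), hy]
  simp only [Function.update_self, Nat.factorial_zero, Nat.cast_one, inv_one, one_mul]
  congr 1
  apply Finset.prod_congr rfl
  intro i hi
  rw [Function.update_of_ne (Finset.ne_of_mem_erase hi)]

lemma sum_update {y : ι → ℕ} {b : ι} (hy : y b = 0) (a : ℕ) :
    ∑ i, Function.update y b a i = a + ∑ i, y i := by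
  rw [← Finset.add_sum_erase _ _ (Finset.mem_univ b),
    ← Finset.add_sum_erase _ y (Finset.mem_univ b), hy]
  simp only [Function.update_self, zero_add]
  congr 1
  apply Finset.sum_congr rfl
  intro i hi
  rw [Function.update_of_ne (Finset.ne_of_mem_erase hi)]

lemma sum_loadBox_insert_insert {K : ℕ} {s : Finset ι} {i j : ι} (hij : i ≠ j) (hi : i ∉ s)
    (hj : j ∉ s) (G : (ι → ℕ) → ℝ) :
    ∑ x ∈ loadBox K (insert j (insert i s)), loadWeight x * G x
      = ∑ y ∈ loadBox K s, loadWeight y * ∑ a ∈ Finset.range (K + 1), ∑ b ∈ Finset.range (K + 1),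
          (a.factorial : ℝ)⁻¹ * (b.factorial : ℝ)⁻¹
            * G (Function.update (Function.update y i a) j b) := by
  rw [sum_loadBox_insert (by simp [hij.symm, hj]), sum_loadBox_insert hi]
  apply Finset.sum_congr rfl
  intro y hy
  rw [mem_loadBox] at hy
  rw [Finset.mul_sum]
  apply Finset.sum_congr rfl
  intro a _
  rw [Finset.mul_sum]
  apply Finset.sum_congr rfl
  intro b _
  rw [loadWeight_update (by rw [Function.update_of_ne hij.symm]; exact hy.2 j hj),
    loadWeight_update (hy.2 i hi)]
  ring

end Box

/-- As `1 / (a! b!) = (a + b).choose a / (a + b)!`, two coordinates with exponential weights,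
conditioned on their sum, follow the two-bin law. -/
lemma sum_sum_eq_sum_twoBinSum (K : ℕ) (g : ℕ → ℕ → ℝ) :
    ∑ a ∈ Finset.range (K + 1), ∑ b ∈ Finset.range (K + 1),
        (a.factorial : ℝ)⁻¹ * (b.factorial : ℝ)⁻¹ * g a b
      = ∑ v ∈ Finset.range (2 * K + 1), (v.factorial : ℝ)⁻¹ * twoBinSum K v (fun i => g i (v - i)) := by
  unfold twoBinSum
  simp_rw [Finset.mul_sum]
  rw [Finset.sum_comm (s := Finset.range (2 * K + 1))]
  apply Finset.sum_congr rfl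
  intro a ha
  have ha := Finset.mem_range.1 ha
  have h : ∑ v ∈ Finset.Ico a (a + (K + 1)), ((v.factorial : ℝ)⁻¹ *
      if v ≤ a + K then (v.choose a : ℝ) * g a (v - a) else 0)
      = ∑ v ∈ Finset.range (2 * K + 1), ((v.factorial : ℝ)⁻¹ *
      if v ≤ a + K then (v.choose a : ℝ) * g a (v - a) else 0) := by
    apply Finset.sum_subset
    · intro v hv
      rw [Finset.mem_Ico] at hv
      exact Finset.mem_range.2 (by omega)
    · intro v _ hv
      rw [Finset.mem_Ico] at hv
      rcases lt_or_ge v a with h | h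
      · simp [Nat.choose_eq_zero_of_lt h]
      · rw [if_neg (by omega), mul_zero]
  rw [← h, Finset.sum_Ico_eq_sum_range, Nat.add_sub_cancel_left]
  apply Finset.sum_congr rfl
  intro b hb
  have hb := Finset.mem_range.1 hb
  rw [if_pos (by omega), Nat.add_sub_cancel_left]
  have h2 : ((a + b).choose a : ℝ) * (a.factorial * b.factorial) = (a + b).factorial := by
    have := Nat.add_choose_mul_factorial_mul_factorial a b
    rw [mul_assoc, ← Nat.choose_symm_add] at this
    exact_mod_cast this
  have h3 : ((a + b).factorial : ℝ) ≠ 0 := by positivity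
  have h4 : (a.factorial : ℝ) ≠ 0 := by positivity
  have h5 : (b.factorial : ℝ) ≠ 0 := by positivity
  field_simp
  rw [← h2]; ring

lemma twoBinMean_mono {K n : ℕ} {F H : ℕ → ℕ → ℝ}
    (h : ∀ a b, a ≤ K → b ≤ K → a + b = n → F a b ≤ H a b) : twoBinMean K n F ≤ twoBinMean K n H := by
  unfold twoBinMean
  apply div_le_div_of_nonneg_right
  · apply twoBinSum_mono
    intro i h1 h2 h3
    exact h _ _ h1 (by omega) (by omega)
  · exact twoBinSum_nonneg fun _ _ => zero_le_one

lemma twoBinMean_add (K n : ℕ) (F H : ℕ → ℕ → ℝ) :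
    twoBinMean K n (fun a b => F a b + H a b) = twoBinMean K n F + twoBinMean K n H := by
  unfold twoBinMean
  rw [twoBinSum_add, add_div]

lemma twoBinMean_mul (K n : ℕ) (c : ℝ) (F : ℕ → ℕ → ℝ) :
    twoBinMean K n (fun a b => c * F a b) = c * twoBinMean K n F := by
  unfold twoBinMean
  rw [twoBinSum_mul, mul_div_assoc]

lemma twoBinMean_sub (K n : ℕ) (F H : ℕ → ℕ → ℝ) :
    twoBinMean K n (fun a b => F a b - H a b) = twoBinMean K n F - twoBinMean K n H := by
  have := twoBinMean_add K n F (fun a b => (-1) * H a b)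
  rw [twoBinMean_mul] at this
  rw [sub_eq_add_neg, ← neg_one_mul, ← this]
  congr 1
  ext a b; ring

lemma twoBinMean_const {K n : ℕ} (hn : n ≤ 2 * K) (c : ℝ) : twoBinMean K n (fun _ _ => c) = c := by
  have := twoBinMean_mul K n c (fun _ _ => 1)
  simp only [mul_one] at this
  rw [this]
  unfold twoBinMean
  rw [show twoBinSum K n (fun _ => 1) = twoBinMass K n from rfl, div_self (twoBinMass_pos hn).ne',
    mul_one]

lemma twoBinSum_eq_zero {K n : ℕ} (hn : 2 * K < n) (f : ℕ → ℝ) : twoBinSum K n f = 0 := by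
  unfold twoBinSum
  apply Finset.sum_eq_zero
  intro i hi
  have := Finset.mem_range.1 hi
  rw [if_neg (by omega)]

lemma abs_twoBinMean_le {K n : ℕ} {F : ℕ → ℕ → ℝ} {B : ℝ} (hB : ∀ a b, |F a b| ≤ B) :
    |twoBinMean K n F| ≤ B := by
  rcases le_or_gt n (2 * K) with h | h
  · rw [abs_le]
    refine ⟨?_, ?_⟩
    · have := twoBinMean_mono (K := K) (n := n) (F := fun _ _ => -B) (H := F)
        (fun a b _ _ _ => (abs_le.1 (hB a b)).1)
      rwa [twoBinMean_const h] at this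
    · have := twoBinMean_mono (K := K) (n := n) (F := F) (H := fun _ _ => B)
        (fun a b _ _ _ => (abs_le.1 (hB a b)).2)
      rwa [twoBinMean_const h] at this
  · unfold twoBinMean
    rw [twoBinSum_eq_zero h]
    simpa using (abs_nonneg _).trans (hB 0 0)

lemma twoBinFlux_nonneg {K n : ℕ} (hn : n + 1 ≤ 2 * K) {u : ℕ → ℕ → ℝ}
    (h : ∀ a b, a + 1 ≤ K → b ≤ K → 0 ≤ u a b) : 0 ≤ twoBinFlux K n u := by
  apply Finset.sum_nonneg
  intro j hj
  have hj := Finset.mem_range.1 hj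
  by_cases h1 : j + 1 ≤ K ∧ n - j ≤ K
  · exact mul_nonneg (sub_nonneg.2 (twoBinTailProb_succ_ge hn _)) (h _ _ h1.1 h1.2)
  · by_cases h2 : j + 1 ≤ K
    · rw [twoBinTailProb_eq_one (by omega) (by omega), twoBinTailProb_eq_one (by omega) (by omega)]
      simp
    · rw [twoBinTailProb_eq_zero (by omega), twoBinTailProb_eq_zero (by omega)]
      simp

/-- Means of functions that are monotone in both counts are monotone in the level. -/
lemma twoBinMean_mono_level {K n : ℕ} (hn : n + 1 ≤ 2 * K) {u : ℕ → ℕ → ℝ}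
    (h1 : ∀ a b, a + 1 ≤ K → b ≤ K → u a b ≤ u (a + 1) b)
    (h2 : ∀ a b, a ≤ K → b + 1 ≤ K → u a b ≤ u a (b + 1)) :
    twoBinMean K n u ≤ twoBinMean K (n + 1) u := by
  have e := twoBinMean_succ_sub hn u
  have f1 := twoBinFlux_nonneg hn (u := fun a b => u (a + 1) b - u a b)
    (fun a b ha hb => sub_nonneg.2 (h1 a b ha hb))
  have f2 := twoBinFlux_nonneg hn (u := fun a b => u b (a + 1) - u b a)
    (fun a b ha hb => sub_nonneg.2 (h2 b a hb ha))
  linarith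

lemma sum_sum_twoBinMean (K : ℕ) (F : ℕ → ℕ → ℝ) (γ : ℕ → ℝ) :
    ∑ a ∈ Finset.range (K + 1), ∑ b ∈ Finset.range (K + 1),
        (a.factorial : ℝ)⁻¹ * (b.factorial : ℝ)⁻¹ * (twoBinMean K (a + b) F * γ (a + b))
      = ∑ a ∈ Finset.range (K + 1), ∑ b ∈ Finset.range (K + 1),
        (a.factorial : ℝ)⁻¹ * (b.factorial : ℝ)⁻¹ * (F a b * γ (a + b)) := by
  rw [sum_sum_eq_sum_twoBinSum, sum_sum_eq_sum_twoBinSum K (fun a b => F a b * γ (a + b))]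
  apply Finset.sum_congr rfl
  intro v hv
  have hv := Finset.mem_range.1 hv
  congr 1
  have e1 : twoBinSum K v (fun i => twoBinMean K (i + (v - i)) F * γ (i + (v - i)))
      = γ v * twoBinMean K v F * twoBinMass K v := by
    unfold twoBinMass
    rw [← twoBinSum_mul]
    apply twoBinSum_congr
    intro i _ h _
    rw [Nat.add_sub_of_le h]; ring
  have e2 : twoBinSum K v (fun i => F i (v - i) * γ (i + (v - i)))
      = γ v * twoBinSum K v (fun i => F i (v - i)) := by
    rw [← twoBinSum_mul]
    apply twoBinSum_congr
    intro i _ h _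
    rw [Nat.add_sub_of_le h]; ring
  rw [e1, e2, mul_assoc]
  congr 1
  unfold twoBinMean
  rw [div_mul_cancel₀ _ (twoBinMass_pos (by omega)).ne']

section Update
variable {ι : Type*} [DecidableEq ι]

lemma update_update_update_update {i j : ι} (x : ι → ℕ) (a b c d : ℕ) :
    Function.update (Function.update (Function.update (Function.update x i a) j b) i c) j d
      = Function.update (Function.update x i c) j d := by
  ext l
  by_cases h1 : l = j
  · subst h1; simp
  · by_cases h2 : l = i
    · subst h2; simp [h1]
    · simp [h1, h2]

lemma update_update_add_single {i j : ι} (x : ι → ℕ) (a b : ℕ) {p : ι} (hi : p ≠ i) (hj : p ≠ j) :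
    Function.update (Function.update (x + Pi.single p 1) i a) j b
      = Function.update (Function.update x i a) j b + Pi.single p 1 := by
  ext l
  by_cases h1 : l = j
  · subst h1; simp [hj.symm]
  · by_cases h2 : l = i
    · subst h2; simp [h1, hi.symm]
    · simp [h1, h2]

lemma update_update_add_single_left {i j : ι} (hij : i ≠ j) (x : ι → ℕ) (a b : ℕ) :
    Function.update (Function.update x i a) j b + Pi.single i 1
      = Function.update (Function.update x i (a + 1)) j b := by
  ext l
  by_cases h1 : l = j
  · subst h1; simp [hij.symm]
  · by_cases h2 : l = i
    · subst h2; simp [h1]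
    · simp [h1, h2]

lemma update_update_add_single_right {i j : ι} (x : ι → ℕ) (a b : ℕ) :
    Function.update (Function.update x i a) j b + Pi.single j 1
      = Function.update (Function.update x i a) j (b + 1) := by
  ext l
  by_cases h1 : l = j
  · subst h1; simp
  · by_cases h2 : l = i
    · subst h2; simp [h1]
    · simp [h1, h2]

lemma update_update_single {i j : ι} (x : ι → ℕ) (a b : ℕ) {p : ι} (h : p = i ∨ p = j) :
    Function.update (Function.update (x + Pi.single p 1) i a) j b
      = Function.update (Function.update x i a) j b := by
  ext l
  by_cases h1 : l = j
  · subst h1; simp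
  · by_cases h2 : l = i
    · subst h2; simp [h1]
    · have : l ≠ p := by rcases h with h | h <;> subst h <;> assumption
      simp [h1, h2, this]

/-- Resample the coordinates `i` and `j` given their sum and the other coordinates. -/
noncomputable def pairMean (K : ℕ) (i j : ι) (F : (ι → ℕ) → ℝ) (x : ι → ℕ) : ℝ :=
  twoBinMean K (x i + x j) fun a b => F (Function.update (Function.update x i a) j b)

lemma pairMean_update {K : ℕ} {i j : ι} (hij : i ≠ j) (F : (ι → ℕ) → ℝ) (x : ι → ℕ) {a b c d : ℕ}
    (h : a + b = c + d) : pairMean K i j F (Function.update (Function.update x i a) j b)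
      = pairMean K i j F (Function.update (Function.update x i c) j d) := by
  unfold pairMean
  simp only [Function.update_self, Function.update_of_ne hij, h]
  congr 1
  ext e f
  congr 1
  rw [update_update_update_update, update_update_update_update]

end Update

section Resample
variable {ι : Type*} [Fintype ι] [DecidableEq ι]

/-- Nonnegative mixed second differences inside the box. -/
def DirConvex (K : ℕ) (s : Finset ι) (F : (ι → ℕ) → ℝ) : Prop :=
  ∀ x : ι → ℕ, ∀ p q : ι, x + Pi.single p 1 + Pi.single q 1 ∈ loadBox K s →
    0 ≤ F (x + Pi.single p 1 + Pi.single q 1) - F (x + Pi.single p 1) - F (x + Pi.single q 1) + F x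

lemma mem_loadBox_of_le {K : ℕ} {s : Finset ι} {x y : ι → ℕ} (h : x ∈ loadBox K s) (hy : y ≤ x) :
    y ∈ loadBox K s := by
  rw [mem_loadBox] at h ⊢
  refine ⟨fun i => (hy i).trans (h.1 i), fun i hi => ?_⟩
  exact Nat.le_zero.1 ((hy i).trans (h.2 i hi).le)

lemma update_mem_loadBox {K : ℕ} {s : Finset ι} {x : ι → ℕ} (h : x ∈ loadBox K s) {i : ι}
    (hi : i ∈ s) {a : ℕ} (ha : a ≤ K) : Function.update x i a ∈ loadBox K s := by
  rw [mem_loadBox] at h ⊢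
  refine ⟨fun l => ?_, fun l hl => ?_⟩
  · by_cases hli : l = i
    · subst hli; simpa using ha
    · simpa [hli] using h.1 l
  · have : l ≠ i := fun h => hl (h ▸ hi)
    simpa [this] using h.2 l hl

/-- Pair resampling is a conditional expectation: it can be dropped against any `g` that sees the
two coordinates only through their sum. -/
lemma sum_pairMean {K : ℕ} {s : Finset ι} {i j : ι} (hij : i ≠ j) (hi : i ∈ s) (hj : j ∈ s)
    (F : (ι → ℕ) → ℝ) {g : (ι → ℕ) → ℝ}
    (hg : ∀ x a b c d, a + b = c + d → g (Function.update (Function.update x i a) j b)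
      = g (Function.update (Function.update x i c) j d)) :
    ∑ x ∈ loadBox K s, loadWeight x * (pairMean K i j F x * g x)
      = ∑ x ∈ loadBox K s, loadWeight x * (F x * g x) := by
  obtain ⟨s, rfl, his, hjs⟩ : ∃ s', s = insert j (insert i s') ∧ i ∉ s' ∧ j ∉ s' := by
    refine ⟨(s.erase j).erase i, ?_, by simp, by simp⟩
    rw [Finset.insert_erase (Finset.mem_erase.2 ⟨hij, hi⟩), Finset.insert_erase hj]
  rw [sum_loadBox_insert_insert hij his hjs, sum_loadBox_insert_insert hij his hjs]
  apply Finset.sum_congr rfl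
  intro y _
  congr 1
  have key := sum_sum_twoBinMean K (fun a b => F (Function.update (Function.update y i a) j b))
    (fun v => g (Function.update (Function.update y i v) j 0))
  have hγ : ∀ a b, g (Function.update (Function.update y i a) j b)
      = g (Function.update (Function.update y i (a + b)) j 0) := fun a b => hg y a b (a + b) 0 rfl
  have hT : ∀ a b, pairMean K i j F (Function.update (Function.update y i a) j b)
      = twoBinMean K (a + b) (fun a b => F (Function.update (Function.update y i a) j b)) := by
    intro a b
    unfold pairMean
    simp only [Function.update_self, Function.update_of_ne hij]
    congr 1
    ext c d
    rw [update_update_update_update]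
  refine Eq.trans ?_ (key.trans ?_) <;>
    refine Finset.sum_congr rfl fun a _ => Finset.sum_congr rfl fun b _ => ?_
  · rw [hT, hγ]
  · rw [hγ a b]

/-- If both directions lie in the pair, the mixed difference is a second difference in the level of
two-bin means of a directionally convex function. If one does, it is a level increment of the mean
of a function monotone in both counts. If none does, it is an average of mixed differences. -/
lemma DirConvex.pairMean {K : ℕ} {s : Finset ι} {F : (ι → ℕ) → ℝ} (hF : DirConvex K s F) {i j : ι}
    (hij : i ≠ j) (hi : i ∈ s) (hj : j ∈ s) : DirConvex K s (pairMean K i j F) := by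
  have hlevel : ∀ (x : ι → ℕ) (p : ι), (x + Pi.single p 1 : ι → ℕ) i + (x + Pi.single p 1 : ι → ℕ) j
      = x i + x j + if p = i ∨ p = j then 1 else 0 := by
    intro x p
    by_cases h1 : p = i
    · subst h1; simp [hij.symm]; omega
    · by_cases h2 : p = j
      · subst h2; simp [hij]; omega
      · simp [h1, h2, Ne.symm h1, Ne.symm h2]
  have hpm : ∀ (x : ι → ℕ) (p : ι), (p = i ∨ p = j) → _root_.pairMean K i j F (x + Pi.single p 1)
      = twoBinMean K (x i + x j + 1) fun a b => F (Function.update (Function.update x i a) j b) := by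
    intro x p hp
    unfold _root_.pairMean
    rw [hlevel, if_pos hp]
    congr 1
    ext a b
    rw [update_update_single x a b hp]
  have hpm' : ∀ (x : ι → ℕ) (p : ι), ¬ (p = i ∨ p = j) → _root_.pairMean K i j F (x + Pi.single p 1)
      = twoBinMean K (x i + x j)
        fun a b => F (Function.update (Function.update x i a) j b + Pi.single p 1) := by
    intro x p hp
    unfold _root_.pairMean
    rw [hlevel, if_neg hp]
    congr 1
    ext a b
    rw [update_update_add_single x a b (fun h => hp (Or.inl h)) (fun h => hp (Or.inr h))]
  have hbox : ∀ (x : ι → ℕ) (a b : ℕ), x ∈ loadBox K s → a ≤ K → b ≤ K →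
      Function.update (Function.update x i a) j b ∈ loadBox K s := fun x a b hx ha hb =>
    update_mem_loadBox (update_mem_loadBox hx hi ha) hj hb
  have hmixed : ∀ (x : ι → ℕ) (p q : ι), (p = i ∨ p = j) → ¬ (q = i ∨ q = j) →
      x + Pi.single p 1 + Pi.single q 1 ∈ loadBox K s →
      0 ≤ _root_.pairMean K i j F (x + Pi.single p 1 + Pi.single q 1)
        - _root_.pairMean K i j F (x + Pi.single p 1)
        - _root_.pairMean K i j F (x + Pi.single q 1) + _root_.pairMean K i j F x := by
    intro x p q hp hq hx
    have e1 : _root_.pairMean K i j F (x + Pi.single p 1 + Pi.single q 1)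
        = twoBinMean K (x i + x j + 1)
          fun a b => F (Function.update (Function.update x i a) j b + Pi.single q 1) := by
      rw [hpm' _ q hq, hlevel, if_pos hp]
      congr 1
      ext a b
      rw [update_update_single x a b hp]
    rw [e1, hpm x p hp, hpm' x q hq]
    have hqx : x + Pi.single q 1 ∈ loadBox K s := by
      refine mem_loadBox_of_le hx ?_
      rw [add_right_comm]
      exact le_self_add
    have hq' : ∀ a b, a ≤ K → b ≤ K →
        Function.update (Function.update x i a) j b + Pi.single q 1 ∈ loadBox K s := by
      intro a b ha hb
      rw [← update_update_add_single x a b (fun h => hq (Or.inl h)) (fun h => hq (Or.inr h))]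
      exact hbox _ _ _ hqx ha hb
    have hn : x i + x j + 1 ≤ 2 * K := by
      have h1 := (mem_loadBox.1 hx).1 i
      have h2 := (mem_loadBox.1 hx).1 j
      have h3 := hlevel (x + Pi.single p 1) q
      have h4 := hlevel x p
      rw [if_pos hp] at h4
      rw [if_neg hq] at h3
      omega
    have := twoBinMean_mono_level hn
      (u := fun a b => F (Function.update (Function.update x i a) j b + Pi.single q 1)
        - F (Function.update (Function.update x i a) j b)) ?_ ?_
    · rw [twoBinMean_sub, twoBinMean_sub] at this
      unfold _root_.pairMean
      linarith
    · intro a b ha hb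
      have := hF (Function.update (Function.update x i a) j b) i q (by
        rw [update_update_add_single_left hij]; exact hq' _ _ ha hb)
      rw [update_update_add_single_left hij] at this
      linarith
    · intro a b ha hb
      have := hF (Function.update (Function.update x i a) j b) j q (by
        rw [update_update_add_single_right]; exact hq' _ _ ha hb)
      rw [update_update_add_single_right] at this
      linarith
  intro x p q hx
  by_cases hp : p = i ∨ p = j
  · by_cases hq : q = i ∨ q = j
    · have e1 : _root_.pairMean K i j F (x + Pi.single p 1 + Pi.single q 1)
          = twoBinMean K (x i + x j + 2)
            fun a b => F (Function.update (Function.update x i a) j b) := by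
        rw [hpm _ q hq, hlevel, if_pos hp]
        congr 1
        ext a b
        rw [update_update_single x a b hp]
      rw [e1, hpm x p hp, hpm x q hq]
      have hxb : x ∈ loadBox K s := mem_loadBox_of_le hx (by rw [add_assoc]; exact le_self_add)
      have hn : x i + x j + 2 ≤ 2 * K := by
        have h1 := (mem_loadBox.1 hx).1 i
        have h2 := (mem_loadBox.1 hx).1 j
        have h3 := hlevel (x + Pi.single p 1) q
        have h4 := hlevel x p
        rw [if_pos hp] at h4
        rw [if_pos hq] at h3
        omega
      have := twoBinMean_convex hn
        (F := fun a b => F (Function.update (Function.update x i a) j b)) ?_ ?_ ?_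
      · unfold _root_.pairMean
        linarith
      · intro a b ha hb
        have := hF (Function.update (Function.update x i a) j b) i i (by
          rw [update_update_add_single_left hij, update_update_add_single_left hij]
          exact hbox _ _ _ hxb ha hb)
        rw [update_update_add_single_left hij, update_update_add_single_left hij] at this
        linarith
      · intro a b ha hb
        have := hF (Function.update (Function.update x i a) j b) j j (by
          rw [update_update_add_single_right, update_update_add_single_right]
          exact hbox _ _ _ hxb ha hb)
        rw [update_update_add_single_right, update_update_add_single_right] at this
        linarith
      · intro a b ha hb
        have := hF (Function.update (Function.update x i a) j b) i j (by
          rw [update_update_add_single_left hij, update_update_add_single_right]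
          exact hbox _ _ _ hxb ha hb)
        rw [update_update_add_single_left hij, update_update_add_single_right,
          update_update_add_single_right] at this
        linarith
    · exact hmixed x p q hp hq hx
  · by_cases hq : q = i ∨ q = j
    · have := hmixed x q p hq hp (by rwa [add_right_comm])
      rw [add_right_comm] at this
      linarith
    · have e1 : _root_.pairMean K i j F (x + Pi.single p 1 + Pi.single q 1)
          = twoBinMean K (x i + x j)
            fun a b => F (Function.update (Function.update x i a) j b + Pi.single p 1
              + Pi.single q 1) := by
        rw [hpm' _ q hq, hlevel, if_neg hp]
        congr 1
        ext a b
        rw [update_update_add_single x a b (fun h => hp (Or.inl h)) (fun h => hp (Or.inr h))]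
      rw [e1, hpm' x p hp, hpm' x q hq]
      unfold _root_.pairMean
      have := twoBinMean_mono (K := K) (n := x i + x j)
        (F := fun a b => F (Function.update (Function.update x i a) j b + Pi.single p 1)
          - F (Function.update (Function.update x i a) j b))
        (H := fun a b => F (Function.update (Function.update x i a) j b + Pi.single p 1
              + Pi.single q 1) - F (Function.update (Function.update x i a) j b + Pi.single q 1)) ?_
      · rw [twoBinMean_sub, twoBinMean_sub] at this
        linarith
      · intro a b ha hb _
        have := hF (Function.update (Function.update x i a) j b) p q (by
          have hbx := hbox _ _ _ hx ha hb
          rw [update_update_add_single _ a b (fun h => hq (Or.inl h)) (fun h => hq (Or.inr h)),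
            update_update_add_single _ a b (fun h => hp (Or.inl h)) (fun h => hp (Or.inr h))] at hbx
          exact hbx)
        linarith

end Resample

/-! ### Many bins: level means of directionally convex functions -/

section Level
variable {ι : Type*} [Fintype ι] [DecidableEq ι]

/-- Weighted sums over the configurations of total load `v`. -/
noncomputable def levelSum (K : ℕ) (s : Finset ι) (v : ℕ) (G : (ι → ℕ) → ℝ) : ℝ :=
  ∑ x ∈ loadBox K s, loadWeight x * (G x * if ∑ i, x i = v then 1 else 0)

/-- The total weight of the configurations of total load `v`. -/
noncomputable def levelMass (K : ℕ) (s : Finset ι) (v : ℕ) : ℝ := levelSum K s v fun _ => 1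

/-- The mean over the configurations of total load `v`. -/
noncomputable def levelMean (K : ℕ) (s : Finset ι) (v : ℕ) (G : (ι → ℕ) → ℝ) : ℝ :=
  levelSum K s v G / levelMass K s v

lemma levelSum_congr {K : ℕ} {s : Finset ι} {v : ℕ} {F G : (ι → ℕ) → ℝ}
    (h : ∀ x ∈ loadBox K s, ∑ i, x i = v → F x = G x) : levelSum K s v F = levelSum K s v G := by
  apply Finset.sum_congr rfl
  intro x hx
  split_ifs with h1
  · rw [h x hx h1]
  · simp

lemma levelSum_mono {K : ℕ} {s : Finset ι} {v : ℕ} {F G : (ι → ℕ) → ℝ}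
    (h : ∀ x ∈ loadBox K s, ∑ i, x i = v → F x ≤ G x) : levelSum K s v F ≤ levelSum K s v G := by
  apply Finset.sum_le_sum
  intro x hx
  apply mul_le_mul_of_nonneg_left _ (loadWeight_pos x).le
  split_ifs with h1
  · simpa using h x hx h1
  · simp

lemma levelSum_add (K : ℕ) (s : Finset ι) (v : ℕ) (F G : (ι → ℕ) → ℝ) :
    levelSum K s v (fun x => F x + G x) = levelSum K s v F + levelSum K s v G := by
  unfold levelSum
  rw [← Finset.sum_add_distrib]
  apply Finset.sum_congr rfl
  intro x _; ring

lemma levelSum_mul (K : ℕ) (s : Finset ι) (v : ℕ) (c : ℝ) (G : (ι → ℕ) → ℝ) :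
    levelSum K s v (fun x => c * G x) = c * levelSum K s v G := by
  unfold levelSum
  rw [Finset.mul_sum]
  apply Finset.sum_congr rfl
  intro x _; ring

lemma levelSum_const (K : ℕ) (s : Finset ι) (v : ℕ) (c : ℝ) :
    levelSum K s v (fun _ => c) = c * levelMass K s v := by
  unfold levelMass
  rw [← levelSum_mul]
  simp

lemma levelSum_nonneg {K : ℕ} {s : Finset ι} {v : ℕ} {G : (ι → ℕ) → ℝ}
    (h : ∀ x ∈ loadBox K s, ∑ i, x i = v → 0 ≤ G x) : 0 ≤ levelSum K s v G := by
  have := levelSum_mono (F := fun _ => 0) h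
  rwa [levelSum_const, zero_mul] at this

lemma exists_add_single_mem {K : ℕ} {s : Finset ι} {x : ι → ℕ} (hx : x ∈ loadBox K s)
    (h : ∑ i, x i < K * s.card) : ∃ p ∈ s, x + Pi.single p 1 ∈ loadBox K s := by
  have h1 : ∃ p ∈ s, x p < K := by
    by_contra hc
    push Not at hc
    have : K * s.card ≤ ∑ i, x i := by
      calc K * s.card = ∑ _i ∈ s, K := by rw [Finset.sum_const, smul_eq_mul, mul_comm]
        _ ≤ ∑ i ∈ s, x i := Finset.sum_le_sum hc
        _ ≤ ∑ i, x i := Finset.sum_le_sum_of_subset (Finset.subset_univ s)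
    omega
  obtain ⟨p, hp, hxp⟩ := h1
  refine ⟨p, hp, ?_⟩
  have e : x + Pi.single p 1 = Function.update x p (x p + 1) := by
    ext l
    by_cases hl : l = p
    · subst hl; simp
    · simp [hl]
  rw [e]
  exact update_mem_loadBox hx hp hxp

lemma sum_add_single (x : ι → ℕ) (p : ι) :
    ∑ i, (x + Pi.single p 1 : ι → ℕ) i = (∑ i, x i) + 1 := by
  simp [Finset.sum_add_distrib]

lemma exists_mem_loadBox {K : ℕ} {s : Finset ι} : ∀ v, v ≤ K * s.card →
    ∃ x ∈ loadBox K s, ∑ i, x i = v := by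
  intro v
  induction v with
  | zero => intro _; exact ⟨0, by simp [mem_loadBox], by simp⟩
  | succ v ih =>
    intro hv
    obtain ⟨x, hx, hxv⟩ := ih (by omega)
    obtain ⟨p, _, hp⟩ := exists_add_single_mem hx (by omega)
    exact ⟨_, hp, by rw [sum_add_single, hxv]⟩

lemma levelMass_pos {K : ℕ} {s : Finset ι} {v : ℕ} (hv : v ≤ K * s.card) : 0 < levelMass K s v := by
  obtain ⟨x, hx, hxv⟩ := exists_mem_loadBox v hv
  unfold levelMass levelSum
  apply Finset.sum_pos'
  · intro y _
    apply mul_nonneg (loadWeight_pos y).le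
    split_ifs <;> norm_num
  · exact ⟨x, hx, by simpa [hxv] using loadWeight_pos x⟩

lemma levelMean_const {K : ℕ} {s : Finset ι} {v : ℕ} (hv : v ≤ K * s.card) (c : ℝ) :
    levelMean K s v (fun _ => c) = c := by
  rw [levelMean, levelSum_const, mul_div_cancel_right₀ _ (levelMass_pos hv).ne']

lemma sum_eq_of_update_eq {i j : ι} (hij : i ≠ j) (x : ι → ℕ) {a b c d : ℕ} (h : a + b = c + d) :
    ∑ l, Function.update (Function.update x i a) j b l
      = ∑ l, Function.update (Function.update x i c) j d l := by
  have key : ∀ e f : ℕ, ∑ l, Function.update (Function.update x i e) j f l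
      = (e + f) + ∑ l, Function.update (Function.update x i 0) j 0 l := by
    intro e f
    have h1 := sum_update (y := Function.update (Function.update x i 0) j 0) (b := i)
      (by simp [hij]) e
    have h2 := sum_update (y := Function.update (Function.update (Function.update x i 0) j 0) i e)
      (b := j) (by simp [hij.symm]) f
    rw [update_update_update_update] at h2
    omega
  rw [key, key c d, h]

lemma pairMean_levelSum {K : ℕ} {s : Finset ι} {i j : ι} (hij : i ≠ j) (hi : i ∈ s) (hj : j ∈ s)
    (F : (ι → ℕ) → ℝ) (v : ℕ) : levelSum K s v (pairMean K i j F) = levelSum K s v F := by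
  refine sum_pairMean hij hi hj F (g := fun x => if ∑ i, x i = v then 1 else 0) ?_
  intro x a b c d h
  rw [sum_eq_of_update_eq hij x h]

/-- Pythagoras for the conditional expectation `pairMean`. -/
lemma sum_sq_sub_pairMean {K : ℕ} {s : Finset ι} {i j : ι} (hij : i ≠ j) (hi : i ∈ s) (hj : j ∈ s)
    (F : (ι → ℕ) → ℝ) :
    ∑ x ∈ loadBox K s, loadWeight x * (F x - pairMean K i j F x) ^ 2
      = ∑ x ∈ loadBox K s, loadWeight x * F x ^ 2
        - ∑ x ∈ loadBox K s, loadWeight x * pairMean K i j F x ^ 2 := by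
  have h := sum_pairMean (K := K) hij hi hj F (g := pairMean K i j F)
    (fun x a b c d h => pairMean_update hij F x h)
  have e : ∑ x ∈ loadBox K s, loadWeight x * (F x - pairMean K i j F x) ^ 2
      = ∑ x ∈ loadBox K s, loadWeight x * F x ^ 2
        - ∑ x ∈ loadBox K s, loadWeight x * pairMean K i j F x ^ 2
        + 2 * (∑ x ∈ loadBox K s, loadWeight x * (pairMean K i j F x * pairMean K i j F x)
        - ∑ x ∈ loadBox K s, loadWeight x * (F x * pairMean K i j F x)) := by
    rw [← Finset.sum_sub_distrib, ← Finset.sum_sub_distrib, Finset.mul_sum, ← Finset.sum_add_distrib]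
    apply Finset.sum_congr rfl
    intro x _; ring
  rw [e, h]; ring

/-- Among the directionally convex functions with given level sums there is one that is invariant
under all pair resamplings. -/
lemma exists_pairMean_invariant {K : ℕ} {s : Finset ι} {F : (ι → ℕ) → ℝ} (hF : DirConvex K s F) :
    ∃ G : (ι → ℕ) → ℝ, DirConvex K s G ∧ (∀ v, levelSum K s v G = levelSum K s v F) ∧
      ∀ i ∈ s, ∀ j ∈ s, i ≠ j → ∀ x ∈ loadBox K s, G x = pairMean K i j G x := by
  classical
  -- Replacing `F` by zero off the box gives a bounded function with the same level sums; the
  -- candidates can then be taken in a cube, compact in the product topology.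
  set F₀ : (ι → ℕ) → ℝ := fun x => if x ∈ loadBox K s then F x else 0 with hF₀
  set B : ℝ := ∑ x ∈ loadBox K s, |F x| with hB
  set 𝒞 : Set ((ι → ℕ) → ℝ) := {G | (∀ x, G x ∈ Set.Icc (-B) B) ∧ DirConvex K s G ∧
    ∀ v, levelSum K s v G = levelSum K s v F} with h𝒞
  have hF₀mem : F₀ ∈ 𝒞 := by
    refine ⟨fun x => ?_, ?_, fun v => ?_⟩
    · rw [Set.mem_Icc, ← abs_le, hF₀]
      dsimp only
      split_ifs with hx
      · exact Finset.single_le_sum (f := fun x => |F x|) (fun _ _ => abs_nonneg _) hx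
      · rw [abs_zero]; exact Finset.sum_nonneg fun _ _ => abs_nonneg _
    · intro x p q hx
      have h1 : x + Pi.single p 1 ∈ loadBox K s := mem_loadBox_of_le hx le_self_add
      have h2 : x + Pi.single q 1 ∈ loadBox K s :=
        mem_loadBox_of_le hx (by rw [add_right_comm]; exact le_self_add)
      have h3 : x ∈ loadBox K s := mem_loadBox_of_le h1 le_self_add
      rw [hF₀]
      simp only [hx, h1, h2, h3, if_true]
      exact hF x p q hx
    · apply levelSum_congr
      intro x hx _
      simp [hF₀, hx]
  have hcompact : IsCompact 𝒞 := by
    have h1 : IsCompact (Set.univ.pi fun _ : ι → ℕ => Set.Icc (-B) B) :=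
      isCompact_univ_pi fun _ => isCompact_Icc
    have h2 : 𝒞 = (Set.univ.pi fun _ : ι → ℕ => Set.Icc (-B) B) ∩
        ({G | DirConvex K s G} ∩ {G | ∀ v, levelSum K s v G = levelSum K s v F}) := by
      ext G; simp only [h𝒞, Set.mem_ofPred_eq, Set.mem_inter_iff, Set.mem_univ_pi]
    rw [h2]
    apply h1.inter_right
    apply IsClosed.inter
    · have : {G | DirConvex K s G} = ⋂ (x : ι → ℕ) (p : ι) (q : ι)
          (_ : x + Pi.single p 1 + Pi.single q 1 ∈ loadBox K s),
          {G : (ι → ℕ) → ℝ | 0 ≤ G (x + Pi.single p 1 + Pi.single q 1) - G (x + Pi.single p 1)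
            - G (x + Pi.single q 1) + G x} := by
        ext G; simp [DirConvex]
      rw [this]
      refine isClosed_iInter fun x => isClosed_iInter fun p => isClosed_iInter fun q =>
        isClosed_iInter fun _ => isClosed_le continuous_const ?_
      fun_prop
    · have : {G : (ι → ℕ) → ℝ | ∀ v, levelSum K s v G = levelSum K s v F}
          = ⋂ v : ℕ, {G | levelSum K s v G = levelSum K s v F} := by
        ext G; simp
      rw [this]
      refine isClosed_iInter fun v => isClosed_eq ?_ continuous_const
      unfold levelSum
      fun_prop
  -- Take a candidate of least weighted quadratic norm. Resampling maps candidates to candidates and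
  -- lowers the norm by the squared distance moved, so the minimiser is fixed on the box.
  obtain ⟨G, hG, hmin⟩ := hcompact.exists_isMinOn ⟨F₀, hF₀mem⟩
    (f := fun G => ∑ x ∈ loadBox K s, loadWeight x * G x ^ 2) (by fun_prop)
  refine ⟨G, hG.2.1, hG.2.2, fun i hi j hj hij x hx => ?_⟩
  have hT : pairMean K i j G ∈ 𝒞 := by
    refine ⟨fun x => ?_, hG.2.1.pairMean hij hi hj, fun v => ?_⟩
    · rw [Set.mem_Icc, ← abs_le]
      exact abs_twoBinMean_le fun a b => abs_le.2 (hG.1 _)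
    · rw [pairMean_levelSum hij hi hj, hG.2.2]
  have h1 := hmin hT
  have h2 := sum_sq_sub_pairMean (K := K) hij hi hj G
  have h3 : ∑ x ∈ loadBox K s, loadWeight x * (G x - pairMean K i j G x) ^ 2 ≤ 0 := by
    rw [h2]
    exact sub_nonpos.2 h1
  have h4 := (Finset.sum_eq_zero_iff_of_nonneg (fun x _ =>
    mul_nonneg (loadWeight_pos x).le (sq_nonneg _))).1
    (le_antisymm h3 (Finset.sum_nonneg fun x _ => mul_nonneg (loadWeight_pos x).le (sq_nonneg _))) x hx
  have h5 := (mul_eq_zero.1 h4).resolve_left (loadWeight_pos x).ne'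
  exact sub_eq_zero.1 (pow_eq_zero_iff two_ne_zero |>.1 h5)

/-- Moving one object from a bin where `x` exceeds `y` to a bin where it falls short keeps the pair
sum, hence the value of `G`, and decreases the distance to `y`. -/
lemma eq_of_pairMean_invariant {K : ℕ} {s : Finset ι} {G : (ι → ℕ) → ℝ}
    (hG : ∀ i ∈ s, ∀ j ∈ s, i ≠ j → ∀ x ∈ loadBox K s, G x = pairMean K i j G x) :
    ∀ d : ℕ, ∀ x ∈ loadBox K s, ∀ y ∈ loadBox K s, ∑ i, x i = ∑ i, y i →
      ∑ i, (x i - y i) = d → G x = G y := by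
  intro d
  induction d with
  | zero =>
    intro x _ y _ hxy hd
    rw [Finset.sum_eq_zero_iff] at hd
    have hle : ∀ i ∈ Finset.univ, x i ≤ y i := fun i hi => by have := hd i hi; omega
    have := (Finset.sum_eq_sum_iff_of_le hle).1 hxy
    congr 1
    ext i
    exact this i (Finset.mem_univ i)
  | succ d ih =>
    intro x hx y hy hxy hd
    obtain ⟨i, hi⟩ : ∃ i, y i < x i := by
      by_contra hc
      push Not at hc
      have : ∑ i, (x i - y i) = 0 := Finset.sum_eq_zero fun i _ => Nat.sub_eq_zero_of_le (hc i)
      omega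
    obtain ⟨j, hj⟩ : ∃ j, x j < y j := by
      by_contra hc
      push Not at hc
      have := (Finset.sum_eq_sum_iff_of_le (fun i _ => hc i)).1 hxy.symm i (Finset.mem_univ i)
      omega
    have hij : i ≠ j := by rintro rfl; omega
    have his : i ∈ s := by
      by_contra hc
      have := (mem_loadBox.1 hx).2 i hc
      omega
    have hjs : j ∈ s := by
      by_contra hc
      have := (mem_loadBox.1 hy).2 j hc
      omega
    have hyj := (mem_loadBox.1 hy).1 j
    have hxi := (mem_loadBox.1 hx).1 i
    set z := Function.update (Function.update x i (x i - 1)) j (x j + 1) with hz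
    have hzbox : z ∈ loadBox K s :=
      update_mem_loadBox (update_mem_loadBox hx his (by omega)) hjs (by omega)
    have hxz : x = Function.update (Function.update x i (x i)) j (x j) := by simp
    have hGz : G x = G z := by
      rw [hG i his j hjs hij x hx, hG i his j hjs hij z hzbox, hz]
      conv_lhs => rw [hxz]
      exact pairMean_update hij G x (by omega)
    have hsum : ∑ l, z l = ∑ l, x l := by
      conv_rhs => rw [hxz]
      exact sum_eq_of_update_eq hij x (by omega)
    rw [hGz]
    refine ih z hzbox y hy (by omega) ?_
    have h1 : ∑ l, (z l - y l) + 1 = ∑ l, (x l - y l) := by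
      rw [← Finset.add_sum_erase _ _ (Finset.mem_univ i),
        ← Finset.add_sum_erase _ (fun l => x l - y l) (Finset.mem_univ i)]
      have : ∑ l ∈ Finset.univ.erase i, (z l - y l) = ∑ l ∈ Finset.univ.erase i, (x l - y l) := by
        apply Finset.sum_congr rfl
        intro l hl
        have hli := Finset.ne_of_mem_erase hl
        by_cases hlj : l = j
        · subst hlj; simp only [hz, Function.update_self]; omega
        · simp [hz, hlj, hli]
      rw [this]
      have : z i = x i - 1 := by simp [hz, hij]
      rw [this]
      omega
    omega

/-- The level means of a directionally convex function are convex in the level. -/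
theorem levelMean_convex {K : ℕ} {s : Finset ι} {F : (ι → ℕ) → ℝ} (hF : DirConvex K s F) {v : ℕ}
    (hv : v + 2 ≤ K * s.card) :
    0 ≤ levelMean K s (v + 2) F - 2 * levelMean K s (v + 1) F + levelMean K s v F := by
  obtain ⟨G, hGc, hGs, hGi⟩ := exists_pairMean_invariant hF
  have hmean : ∀ x ∈ loadBox K s, ∀ u, ∑ i, x i = u → levelMean K s u F = G x := by
    intro x hx u hu
    have hu' : u ≤ K * s.card := by
      rw [← hu]
      calc ∑ i, x i = ∑ i ∈ s, x i := (Finset.sum_subset (Finset.subset_univ s)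
            (fun i _ hi => (mem_loadBox.1 hx).2 i hi)).symm
        _ ≤ ∑ _i ∈ s, K := Finset.sum_le_sum fun i _ => (mem_loadBox.1 hx).1 i
        _ = K * s.card := by rw [Finset.sum_const, smul_eq_mul, mul_comm]
    rw [levelMean, ← hGs, ← levelMean_const hu' (G x), levelMean]
    congr 1
    apply levelSum_congr
    intro y hy hyu
    exact eq_of_pairMean_invariant hGi _ y hy x hx (by omega) rfl
  obtain ⟨x, hx, hxv⟩ := exists_mem_loadBox (K := K) (s := s) v (by omega)
  -- As `G` is constant on levels, a single mixed difference of `G` at any admissible point is the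
  -- second difference of the level means, even if `p ≠ q`.
  obtain ⟨p, _, hp⟩ := exists_add_single_mem hx (by omega)
  obtain ⟨q, _, hq⟩ := exists_add_single_mem hp (by rw [sum_add_single]; omega)
  have hq' : x + Pi.single q 1 ∈ loadBox K s :=
    mem_loadBox_of_le hq (by rw [add_right_comm]; exact le_self_add)
  rw [hmean _ hq (v + 2) (by rw [sum_add_single, sum_add_single, hxv]), hmean x hx v hxv]
  have h1 := hmean _ hp (v + 1) (by rw [sum_add_single, hxv])
  have h2 := hmean _ hq' (v + 1) (by rw [sum_add_single, hxv])
  have := hGc x p q hq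
  linarith

end Level

/-! ### Convex sequences and correlations -/

/-- Nonnegative second differences on `{lo, ..., hi}`. -/
def SeqConvexOn (lo hi : ℕ) (g : ℕ → ℝ) : Prop :=
  ∀ l, lo ≤ l → l + 2 ≤ hi → 0 ≤ g (l + 2) - 2 * g (l + 1) + g l

lemma SeqConvexOn.slope_mono {lo hi : ℕ} {g : ℕ → ℝ} (hg : SeqConvexOn lo hi g) {a b : ℕ}
    (ha : lo ≤ a) (hab : a ≤ b) : b + 1 ≤ hi → g (a + 1) - g a ≤ g (b + 1) - g b := by
  induction b, hab using Nat.le_induction with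
  | base => intro _; exact le_rfl
  | succ b hab ih =>
    intro hb
    have h1 := ih (by omega)
    have h2 := hg b (by omega) (by omega)
    rw [show b + 1 + 1 = b + 2 from rfl]
    linarith

lemma SeqConvexOn.mul_slope_le {lo hi : ℕ} {g : ℕ → ℝ} (hg : SeqConvexOn lo hi g) {a b : ℕ}
    (ha : lo ≤ a) (hab : a ≤ b) (hb : b ≤ hi) :
    (b + 1 ≤ hi → g b - g a ≤ (b - a) * (g (b + 1) - g b)) ∧
      (a + 1 ≤ hi → (b - a) * (g (a + 1) - g a) ≤ g b - g a) := by
  constructor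
  · intro hb1
    have : ∀ d, d ≤ b - a → g b - g (b - d) ≤ d * (g (b + 1) - g b) := by
      intro d
      induction d with
      | zero => intro _; simp
      | succ d ih =>
        intro hd
        have h1 := ih (by omega)
        have h2 := hg.slope_mono (a := b - (d + 1)) (b := b) (by omega) (by omega) hb1
        rw [show b - (d + 1) + 1 = b - d by omega] at h2
        push_cast
        linarith
    have h := this (b - a) le_rfl
    rwa [show b - (b - a) = a by omega, Nat.cast_sub hab] at h
  · intro _
    have : ∀ d, d ≤ b - a → d * (g (a + 1) - g a) ≤ g (a + d) - g a := by
      intro d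
      induction d with
      | zero => intro _; simp
      | succ d ih =>
        intro hd
        have h1 := ih (by omega)
        have h2 := hg.slope_mono (a := a) (b := a + d) (by omega) (by omega) (by omega)
        rw [← add_assoc]
        push_cast
        linarith
    have h := this (b - a) le_rfl
    rwa [show a + (b - a) = b by omega, Nat.cast_sub hab] at h

lemma SeqConvexOn.chord {lo hi : ℕ} {g : ℕ → ℝ} (hg : SeqConvexOn lo hi g) {a b c : ℕ}
    (ha : lo ≤ a) (hab : a ≤ b) (hbc : b ≤ c) (hc : c ≤ hi) :
    ((c : ℝ) - a) * g b ≤ (c - b) * g a + (b - a) * g c := by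
  rcases hbc.eq_or_lt with rfl | h
  · linarith
  have h1 := (hg.mul_slope_le ha hab (by omega)).1 (by omega)
  have h2 := (hg.mul_slope_le (a := b) (b := c) (by omega) hbc hc).2 (by omega)
  have hab' : (a : ℝ) ≤ b := by exact_mod_cast hab
  have hbc' : (b : ℝ) ≤ c := by exact_mod_cast hbc
  have h3 := mul_le_mul_of_nonneg_left h1 (sub_nonneg.2 hbc')
  have h4 := mul_le_mul_of_nonneg_left h2 (sub_nonneg.2 hab')
  nlinarith

lemma SeqConvexOn.exists_line_of_lt {lo hi : ℕ} {g : ℕ → ℝ} (hg : SeqConvexOn lo hi g) {p q : ℕ}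
    (hp : lo ≤ p) (hpq : p < q) (hq : q ≤ hi) :
    ∃ β : ℝ, g q = g p + β * (q - p) ∧ ∀ l, lo ≤ l → l ≤ hi →
      (p ≤ l → l ≤ q → g l ≤ g p + β * (l - p)) ∧ (l ≤ p ∨ q ≤ l → g p + β * (l - p) ≤ g l) := by
  have hpq' : (0 : ℝ) < q - p := by
    have : (p : ℝ) < q := by exact_mod_cast hpq
    linarith
  obtain ⟨β, hβ⟩ : ∃ β : ℝ, g q = g p + β * (q - p) := ⟨(g q - g p) / (q - p), by field_simp; ring⟩
  refine ⟨β, hβ, fun l hl hl' => ⟨fun h1 h2 => ?_, fun h => ?_⟩⟩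
  · have := hg.chord hp h1 h2 hq
    rw [hβ] at this
    have h3 : ((q : ℝ) - p) * g l ≤ (q - p) * (g p + β * (l - p)) := by linarith
    exact le_of_mul_le_mul_left h3 hpq'
  · rcases h with h | h
    · have := hg.chord hl h hpq.le hq
      rw [hβ] at this
      have h3 : ((q : ℝ) - p) * (g p + β * (l - p)) ≤ (q - p) * g l := by linarith
      exact le_of_mul_le_mul_left h3 hpq'
    · have := hg.chord hp hpq.le h hl'
      rw [hβ] at this
      have h3 : ((q : ℝ) - p) * (g p + β * (l - p)) ≤ (q - p) * g l := by linarith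
      exact le_of_mul_le_mul_left h3 hpq'

/-- For `p < q` this is the chord. For `p = q` it is a supporting line, drawn through a neighbour of
`p` inside the interval if there is one. -/
lemma SeqConvexOn.exists_line {lo hi : ℕ} {g : ℕ → ℝ} (hg : SeqConvexOn lo hi g) {p q : ℕ}
    (hp : lo ≤ p) (hpq : p ≤ q) (hq : q ≤ hi) :
    ∃ α β : ℝ, ∀ l, lo ≤ l → l ≤ hi →
      (p ≤ l → l ≤ q → g l ≤ α + β * l) ∧ (l < p ∨ q < l → α + β * l ≤ g l) := by
  rcases hpq.lt_or_eq with h | rfl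
  · obtain ⟨β, _, hβ⟩ := hg.exists_line_of_lt hp h hq
    refine ⟨g p - β * p, β, fun l hl hl' => ⟨fun h1 h2 => ?_, fun h => ?_⟩⟩
    · have := (hβ l hl hl').1 h1 h2; linarith
    · have := (hβ l hl hl').2 (by omega); linarith
  · rcases hq.lt_or_eq with h | rfl
    · obtain ⟨β, _, hβ⟩ := hg.exists_line_of_lt hp (Nat.lt_succ_self p) h
      refine ⟨g p - β * p, β, fun l hl hl' => ⟨fun h1 h2 => ?_, fun h => ?_⟩⟩
      · obtain rfl : l = p := by omega
        linarith
      · have := (hβ l hl hl').2 (by omega); linarith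
    · rcases hp.lt_or_eq with h | rfl
      · obtain ⟨β, hβ1, hβ⟩ := hg.exists_line_of_lt (p := p - 1) (q := p) (by omega) (by omega) le_rfl
        refine ⟨g (p - 1) - β * (p - 1 : ℕ), β, fun l hl hl' => ⟨fun h1 h2 => ?_, fun h => ?_⟩⟩
        · obtain rfl : l = p := by omega
          linarith
        · have := (hβ l hl hl').2 (by omega); linarith
      · refine ⟨g lo, 0, fun l hl hl' => ⟨fun h1 h2 => ?_, fun h => ?_⟩⟩
        · obtain rfl : l = lo := by omega
          simp
        · omega

lemma SeqConvexOn.neg_of_between {lo hi : ℕ} {g : ℕ → ℝ} (hg : SeqConvexOn lo hi g) {a b c : ℕ}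
    {m : ℝ} (ha : lo ≤ a) (hab : a ≤ b) (hbc : b ≤ c) (hc : c ≤ hi) (h1 : g a < m) (h2 : g c < m) :
    g b < m := by
  rcases hab.eq_or_lt with rfl | h3
  · exact h1
  have := hg.chord ha hab hbc hc
  have hab' : (a : ℝ) < b := by exact_mod_cast h3
  have hbc' : (b : ℝ) ≤ c := by exact_mod_cast hbc
  have h4 : ((c : ℝ) - a) * g b < (c - a) * m := by nlinarith
  exact lt_of_mul_lt_mul_left h4 (by linarith)

/-- If a convex sequence is uncorrelated with the identity, it is nonnegatively correlated with
every convex sequence. -/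
lemma SeqConvexOn.cov_nonneg {lo hi : ℕ} {μ τ g : ℕ → ℝ} {m : ℝ} (hμ : ∀ l, 0 ≤ μ l)
    (hτ : SeqConvexOn lo hi τ) (hg : SeqConvexOn lo hi g)
    (h0 : ∑ l ∈ Finset.Icc lo hi, μ l * (g l - m) = 0)
    (h1 : ∑ l ∈ Finset.Icc lo hi, μ l * (l * (g l - m)) = 0) :
    0 ≤ ∑ l ∈ Finset.Icc lo hi, μ l * (τ l * (g l - m)) := by
  by_cases hneg : ∃ l ∈ Finset.Icc lo hi, g l < m
  · set S := (Finset.Icc lo hi).filter (fun l => g l < m) with hS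
    have hSne : S.Nonempty := by
      obtain ⟨l, hl, hl'⟩ := hneg
      exact ⟨l, Finset.mem_filter.2 ⟨hl, hl'⟩⟩
    obtain ⟨hpI, hpm⟩ := Finset.mem_filter.1 (S.min'_mem hSne)
    obtain ⟨hqI, hqm⟩ := Finset.mem_filter.1 (S.max'_mem hSne)
    have hmin := fun l hl => S.min'_le l hl
    have hmax := fun l hl => S.le_max' l hl
    have hpq := S.min'_le_max' hSne
    set p := S.min' hSne
    set q := S.max' hSne
    rw [Finset.mem_Icc] at hpI hqI
    -- The set where `g < m` is the interval from `p` to `q`. Subtracting from `τ` its line through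
    -- the endpoints costs nothing, by `h0` and `h1`, and leaves a difference with the same sign as
    -- `g - m` everywhere.
    obtain ⟨α, β, hl⟩ := hτ.exists_line hpI.1 hpq hqI.2
    have e : ∑ l ∈ Finset.Icc lo hi, μ l * (τ l * (g l - m))
        = ∑ l ∈ Finset.Icc lo hi, μ l * ((τ l - (α + β * l)) * (g l - m)) := by
      have : ∑ l ∈ Finset.Icc lo hi, μ l * ((τ l - (α + β * l)) * (g l - m))
          = ∑ l ∈ Finset.Icc lo hi, μ l * (τ l * (g l - m))
            - α * ∑ l ∈ Finset.Icc lo hi, μ l * (g l - m)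
            - β * ∑ l ∈ Finset.Icc lo hi, μ l * (l * (g l - m)) := by
        rw [Finset.mul_sum, Finset.mul_sum, ← Finset.sum_sub_distrib, ← Finset.sum_sub_distrib]
        apply Finset.sum_congr rfl
        intro l _; ring
      rw [this, h0, h1]; ring
    rw [e]
    apply Finset.sum_nonneg
    intro l hlI
    apply mul_nonneg (hμ l)
    have hlI' := Finset.mem_Icc.1 hlI
    obtain ⟨h2, h3⟩ := hl l hlI'.1 hlI'.2
    by_cases h4 : p ≤ l ∧ l ≤ q
    · have := hg.neg_of_between hpI.1 h4.1 h4.2 hqI.2 hpm hqm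
      have := h2 h4.1 h4.2
      apply mul_nonneg_of_nonpos_of_nonpos <;> linarith
    · have h5 := h3 (by omega)
      have h6 : m ≤ g l := by
        by_contra hc
        push Not at hc
        have hlS : l ∈ S := Finset.mem_filter.2 ⟨hlI, hc⟩
        exact h4 ⟨hmin l hlS, hmax l hlS⟩
      apply mul_nonneg <;> linarith
  · push Not at hneg
    have hz := (Finset.sum_eq_zero_iff_of_nonneg (fun l hl =>
      mul_nonneg (hμ l) (sub_nonneg.2 (hneg l hl)))).1 h0
    refine le_of_eq (Finset.sum_eq_zero fun l hl => ?_).symm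
    rw [mul_left_comm, hz l hl, mul_zero]

/-- A convex sequence uncorrelated with the identity is at least its mean just above the support. -/
lemma SeqConvexOn.mean_le_right {lo hi : ℕ} {μ g : ℕ → ℝ} {m : ℝ} (hlt : lo < hi)
    (hμ : ∀ l, lo ≤ l → l ≤ hi → 0 < μ l) (hg : SeqConvexOn lo (hi + 1) g)
    (h0 : ∑ l ∈ Finset.Icc lo hi, μ l * (g l - m) = 0)
    (h1 : ∑ l ∈ Finset.Icc lo hi, μ l * (l * (g l - m)) = 0) : m ≤ g (hi + 1) := by
  by_contra hc
  push Not at hc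
  have hex : ∃ l, lo ≤ l ∧ g l < m := ⟨hi + 1, by omega, hc⟩
  classical
  set p := Nat.find hex with hp
  obtain ⟨hlop, hpm⟩ := Nat.find_spec hex
  have hphi : p ≤ hi + 1 := Nat.find_min' hex ⟨by omega, hc⟩
  -- If `g (hi + 1) < m`, then `g - m` changes sign just before `p`, and so does `2 * (p - l) - 1`,
  -- which is odd and therefore never zero.
  have hterm : ∀ l ∈ Finset.Icc lo hi, 0 ≤ μ l * ((2 * (p - l) - 1) * (g l - m)) := by
    intro l hl
    have hl := Finset.mem_Icc.1 hl
    apply mul_nonneg (hμ l hl.1 hl.2).le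
    rcases lt_or_ge l p with h | h
    · have h2 : m ≤ g l := by
        by_contra hcc
        push Not at hcc
        exact absurd (Nat.find_min' hex ⟨hl.1, hcc⟩) (not_le.2 h)
      have h3 : ((l + 1 : ℕ) : ℝ) ≤ p := by exact_mod_cast h
      push_cast at h3
      apply mul_nonneg <;> linarith
    · have := hg.neg_of_between hlop h (by omega) le_rfl hpm hc
      have h3 : (p : ℝ) ≤ l := by exact_mod_cast h
      apply mul_nonneg_of_nonpos_of_nonpos <;> linarith
  have hsum : ∑ l ∈ Finset.Icc lo hi, μ l * ((2 * (p - l) - 1) * (g l - m)) = 0 := by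
    have : ∑ l ∈ Finset.Icc lo hi, μ l * ((2 * (p - l) - 1) * (g l - m))
        = (2 * p - 1) * ∑ l ∈ Finset.Icc lo hi, μ l * (g l - m)
          - 2 * ∑ l ∈ Finset.Icc lo hi, μ l * (l * (g l - m)) := by
      rw [Finset.mul_sum, Finset.mul_sum, ← Finset.sum_sub_distrib]
      apply Finset.sum_congr rfl
      intro l _; ring
    rw [this, h0, h1]; ring
  have hz := (Finset.sum_eq_zero_iff_of_nonneg hterm).1 hsum
  have hgm : ∀ l, lo ≤ l → l ≤ hi → g l = m := by
    intro l hl hl'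
    have h2 := (mul_eq_zero.1 (hz l (Finset.mem_Icc.2 ⟨hl, hl'⟩))).resolve_left (hμ l hl hl').ne'
    have h3 : (2 * ((p : ℝ) - l) - 1) ≠ 0 := by
      intro h
      have h4 : (2 * (p : ℤ) - 2 * l - 1 : ℤ) = 0 := by
        have : ((2 * (p : ℤ) - 2 * l - 1 : ℤ) : ℝ) = 0 := by push_cast; linarith
        exact_mod_cast this
      omega
    have := (mul_eq_zero.1 h2).resolve_left h3
    linarith
  -- Now `g` equals `m` at the last two points of the support, and convexity forbids a smaller value
  -- at the next point.
  obtain ⟨h', rfl⟩ := Nat.exists_eq_add_of_le' (show 1 ≤ hi by omega)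
  have h2 := hg h' (by omega) le_rfl
  rw [hgm h' (by omega) (by omega), hgm (h' + 1) (by omega) le_rfl] at h2
  rw [show h' + 1 + 1 = h' + 2 from rfl] at hc
  linarith

/-! ### Geometric tilts and convex sums -/

section Swap
variable {ι : Type*} [DecidableEq ι]

lemma sum_comp_swap {s : Finset ι} {b c : ι} (hb : b ∈ s) (hc : c ∈ s) (f : ι → ℝ) :
    ∑ i ∈ s, f (Equiv.swap b c i) = ∑ i ∈ s, f i := by
  refine Finset.sum_equiv (Equiv.swap b c) ?_ (fun _ _ => rfl)
  intro i
  by_cases h1 : i = b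
  · subst h1; simp [hb, hc]
  · by_cases h2 : i = c
    · subst h2; simp [hb, hc]
    · rw [Equiv.swap_apply_of_ne_of_ne h1 h2]

lemma prod_pow_add_single {s : Finset ι} {p : ι} (hp : p ∈ s) (r : ι → ℝ) (x : ι → ℕ) :
    ∏ i ∈ s, r i ^ (x + Pi.single p 1 : ι → ℕ) i = r p * ∏ i ∈ s, r i ^ x i := by
  simp only [Pi.add_apply, pow_add, Finset.prod_mul_distrib]
  rw [mul_comm]
  congr 1
  rw [Finset.prod_eq_single p]
  · simp
  · intro c _ hc; simp [hc]
  · intro h; exact absurd hp h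

end Swap

section Tilt
variable {ι : Type*} [Fintype ι] [DecidableEq ι]

lemma levelSum_eq_zero {K : ℕ} {s : Finset ι} {v : ℕ} (hv : K * s.card < v) (G : (ι → ℕ) → ℝ) :
    levelSum K s v G = 0 := by
  apply Finset.sum_eq_zero
  intro x hx
  have : ∑ i, x i ≤ K * s.card := by
    calc ∑ i, x i = ∑ i ∈ s, x i := (Finset.sum_subset (Finset.subset_univ s)
            (fun i _ hi => (mem_loadBox.1 hx).2 i hi)).symm
        _ ≤ ∑ _i ∈ s, K := Finset.sum_le_sum fun i _ => (mem_loadBox.1 hx).1 i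
        _ = K * s.card := by rw [Finset.sum_const, smul_eq_mul, mul_comm]
  rw [if_neg (by omega)]
  simp

lemma levelSum_insert {K : ℕ} {s : Finset ι} {b : ι} (hb : b ∉ s) (v : ℕ) (G : (ι → ℕ) → ℝ) :
    levelSum K (insert b s) v G = ∑ l ∈ Finset.Icc (v - K * s.card) (min K v),
      (l.factorial : ℝ)⁻¹ * levelSum K s (v - l) (fun y => G (Function.update y b l)) := by
  have h1 : levelSum K (insert b s) v G = ∑ l ∈ Finset.range (K + 1), if l ≤ v then
      (l.factorial : ℝ)⁻¹ * levelSum K s (v - l) (fun y => G (Function.update y b l)) else 0 := by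
    unfold levelSum
    rw [sum_loadBox_insert hb, Finset.sum_comm]
    apply Finset.sum_congr rfl
    intro l _
    by_cases hl : l ≤ v
    · rw [if_pos hl, Finset.mul_sum]
      apply Finset.sum_congr rfl
      intro y hy
      have hyb := (mem_loadBox.1 hy).2 b hb
      rw [loadWeight_update hyb, sum_update hyb]
      by_cases h : ∑ i, y i = v - l
      · rw [if_pos h, if_pos (by omega)]; ring
      · rw [if_neg h, if_neg (by omega)]; ring
    · rw [if_neg hl]
      apply Finset.sum_eq_zero
      intro y hy
      have hyb := (mem_loadBox.1 hy).2 b hb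
      rw [sum_update hyb, if_neg (by omega)]; ring
  rw [h1]
  symm
  apply Finset.sum_subset_zero_on_sdiff
  · intro l hl
    rw [Finset.mem_Icc] at hl
    exact Finset.mem_range.2 (by omega)
  · intro l hl
    rw [Finset.mem_sdiff, Finset.mem_range, Finset.mem_Icc] at hl
    split_ifs with h
    · rw [levelSum_eq_zero (by omega), mul_zero]
    · rfl
  · intro l hl
    rw [Finset.mem_Icc] at hl
    rw [if_pos (by omega)]

lemma levelSum_comp_swap {K : ℕ} {s : Finset ι} {b c : ι} (hb : b ∈ s) (hc : c ∈ s) (v : ℕ)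
    (G : (ι → ℕ) → ℝ) :
    levelSum K s v (fun x => G (x ∘ Equiv.swap b c)) = levelSum K s v G := by
  have hmem : ∀ i, Equiv.swap b c i ∈ s ↔ i ∈ s := by
    intro i
    by_cases h1 : i = b
    · subst h1; simp [hb, hc]
    · by_cases h2 : i = c
      · subst h2; simp [hb, hc]
      · rw [Equiv.swap_apply_of_ne_of_ne h1 h2]
  have hbox : ∀ x ∈ loadBox K s, x ∘ Equiv.swap b c ∈ loadBox K s := by
    intro x hx
    rw [mem_loadBox] at hx ⊢
    exact ⟨fun i => hx.1 _, fun i hi => hx.2 _ (by rwa [hmem])⟩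
  have hinv : ∀ x : ι → ℕ, (x ∘ Equiv.swap b c) ∘ Equiv.swap b c = x := by
    intro x; ext i; simp
  refine Finset.sum_nbij' (fun x => x ∘ Equiv.swap b c) (fun x => x ∘ Equiv.swap b c) hbox hbox
    (fun x _ => hinv x) (fun x _ => hinv x) ?_
  intro x _
  have e1 : loadWeight (x ∘ Equiv.swap b c) = loadWeight x :=
    Equiv.prod_comp (Equiv.swap b c) (fun i => ((x i).factorial : ℝ)⁻¹)
  have e2 : ∑ i, (x ∘ Equiv.swap b c) i = ∑ i, x i := Equiv.sum_comp (Equiv.swap b c) x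
  rw [e1, e2]

lemma sum_eq_sum_of_mem_loadBox {K : ℕ} {s : Finset ι} {x : ι → ℕ} (hx : x ∈ loadBox K s) :
    ∑ i ∈ s, x i = ∑ i, x i :=
  Finset.sum_subset (Finset.subset_univ s) fun i _ hi => (mem_loadBox.1 hx).2 i hi

lemma levelSum_sum {α : Type*} (K : ℕ) (s : Finset ι) (v : ℕ) (t : Finset α)
    (G : α → (ι → ℕ) → ℝ) :
    levelSum K s v (fun x => ∑ c ∈ t, G c x) = ∑ c ∈ t, levelSum K s v (G c) := by
  unfold levelSum
  rw [Finset.sum_comm]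
  apply Finset.sum_congr rfl
  intro x _
  rw [Finset.sum_mul, Finset.mul_sum]

lemma levelSum_sub_levelMean {K : ℕ} {s : Finset ι} {v : ℕ} (hv : v ≤ K * s.card)
    (G : (ι → ℕ) → ℝ) : levelSum K s v (fun x => G x - levelMean K s v G) = 0 := by
  have : levelSum K s v (fun x => G x - levelMean K s v G)
      = levelSum K s v (fun x => G x + -levelMean K s v G) := levelSum_congr fun x _ _ => by ring
  rw [this, levelSum_add, levelSum_const, levelMean]
  have := (levelMass_pos hv).ne'
  field_simp
  ring

/-- By exchangeability each load is uncorrelated with symmetric sums. -/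
lemma levelSum_apply_mul_sub {K : ℕ} {s : Finset ι} {v : ℕ} (hv : v ≤ K * s.card) {b : ι}
    (hb : b ∈ s) (f : ℕ → ℝ) :
    levelSum K s v (fun x => (x b : ℝ) * ((∑ i ∈ s, f (x i))
      - levelMean K s v (fun x => ∑ i ∈ s, f (x i)))) = 0 := by
  set m := levelMean K s v (fun x => ∑ i ∈ s, f (x i)) with hm
  have heq : ∀ c ∈ s, levelSum K s v (fun x => (x c : ℝ) * ((∑ i ∈ s, f (x i)) - m))
      = levelSum K s v (fun x => (x b : ℝ) * ((∑ i ∈ s, f (x i)) - m)) := by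
    intro c hc
    rw [← levelSum_comp_swap hb hc]
    apply levelSum_congr
    intro x _ _
    simp only [Function.comp_apply, Equiv.swap_apply_right]
    rw [sum_comp_swap hb hc (fun i => f (x i))]
  have h1 : ∑ c ∈ s, levelSum K s v (fun x => (x c : ℝ) * ((∑ i ∈ s, f (x i)) - m)) = 0 := by
    rw [← levelSum_sum]
    have : levelSum K s v (fun x => ∑ c ∈ s, (x c : ℝ) * ((∑ i ∈ s, f (x i)) - m))
        = levelSum K s v (fun x => v * ((∑ i ∈ s, f (x i)) - m)) := by
      apply levelSum_congr
      intro x hx hxv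
      rw [← Finset.sum_mul]
      congr 1
      rw [← hxv, ← sum_eq_sum_of_mem_loadBox hx]
      push_cast; rfl
    rw [this, levelSum_mul, hm, levelSum_sub_levelMean hv, mul_zero]
  rw [Finset.sum_congr rfl heq, Finset.sum_const, nsmul_eq_mul] at h1
  refine (mul_eq_zero.1 h1).resolve_left ?_
  exact_mod_cast (Finset.card_pos.2 ⟨b, hb⟩).ne'

lemma mem_of_add_single_mem {K : ℕ} {s : Finset ι} {x : ι → ℕ} {p : ι}
    (h : x + Pi.single p 1 ∈ loadBox K s) : p ∈ s := by
  by_contra hc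
  have := (mem_loadBox.1 h).2 p hc
  simp at this

lemma dirConvex_sum {K : ℕ} {s : Finset ι} {f : ℕ → ℝ} (hf : SeqConvexOn 0 K f) :
    DirConvex K s (fun x => ∑ i ∈ s, f (x i)) := by
  intro x p q hx
  rw [← Finset.sum_sub_distrib, ← Finset.sum_sub_distrib, ← Finset.sum_add_distrib]
  apply Finset.sum_nonneg
  intro i _
  have hi := (mem_loadBox.1 hx).1 i
  by_cases hp : i = p
  · by_cases hq : i = q
    · subst hp; subst hq
      simp only [Pi.add_apply, Pi.single_eq_same] at hi ⊢
      have := hf (x i) (Nat.zero_le _) (by omega)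
      rw [show x i + 1 + 1 = x i + 2 from rfl]
      linarith
    · subst hp
      simp [hq]
  · simp [hp]

lemma dirConvex_prod_pow {K : ℕ} {s : Finset ι} {r : ι → ℝ} (hr : ∀ i ∈ s, 1 ≤ r i) :
    DirConvex K s (fun x => ∏ i ∈ s, r i ^ x i) := by
  intro x p q hx
  have hq : q ∈ s := mem_of_add_single_mem hx
  have hp : p ∈ s := mem_of_add_single_mem (mem_loadBox_of_le hx le_self_add)
  dsimp only
  rw [prod_pow_add_single hq, prod_pow_add_single hp, prod_pow_add_single hq]
  have : 0 ≤ ∏ i ∈ s, r i ^ x i := Finset.prod_nonneg fun i hi =>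
    pow_nonneg (zero_le_one.trans (hr i hi)) _
  have h1 := mul_nonneg (mul_nonneg (sub_nonneg.2 (hr p hp)) (sub_nonneg.2 (hr q hq))) this
  linarith

/-- The total left for the bins in `s` decreases as the load `l` of a removed bin grows, and
reversal preserves convexity; the lower endpoint is the least `l` for which the rest still fits. -/
lemma seqConvexOn_levelMean_sub {K : ℕ} {s : Finset ι} {F : (ι → ℕ) → ℝ} (hF : DirConvex K s F)
    (v hi : ℕ) (hhi : hi ≤ v) :
    SeqConvexOn (v - K * s.card) hi (fun l => levelMean K s (v - l) F) := by
  intro l hl hl'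
  have := levelMean_convex hF (v := v - (l + 2)) (by omega)
  rw [show v - (l + 2) + 2 = v - l by omega, show v - (l + 2) + 1 = v - (l + 1) by omega] at this
  linarith

end Tilt

section Update
variable {ι : Type*} [DecidableEq ι]

lemma sum_insert_update {s : Finset ι} {b : ι} (hb : b ∉ s) (f : ℕ → ℝ) (y : ι → ℕ) (l : ℕ) :
    ∑ i ∈ insert b s, f (Function.update y b l i) = f l + ∑ i ∈ s, f (y i) := by
  rw [Finset.sum_insert hb, Function.update_self]
  congr 1
  apply Finset.sum_congr rfl
  intro i hi
  rw [Function.update_of_ne (ne_of_mem_of_not_mem hi hb)]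

lemma prod_insert_update {s : Finset ι} {b : ι} (hb : b ∉ s) (ρ : ι → ℕ → ℝ) (y : ι → ℕ) (l : ℕ) :
    ∏ i ∈ insert b s, ρ i (Function.update y b l i) = ρ b l * ∏ i ∈ s, ρ i (y i) := by
  rw [Finset.prod_insert hb, Function.update_self]
  congr 1
  apply Finset.prod_congr rfl
  intro i hi
  rw [Function.update_of_ne (ne_of_mem_of_not_mem hi hb)]

end Update

section Tilt
variable {ι : Type*} [Fintype ι] [DecidableEq ι]

/-- The law of a fixed load under the exchangeable weights, and the two orthogonality relations. -/
lemma levelSum_insert_orthogonal {K : ℕ} {s : Finset ι} {b : ι} (hb : b ∉ s) {v : ℕ}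
    (hv : v ≤ K * (insert b s).card) (f : ℕ → ℝ) :
    (∑ l ∈ Finset.Icc (v - K * s.card) (min K v), ((l.factorial : ℝ)⁻¹ * levelMass K s (v - l))
        * (f l + levelMean K s (v - l) (fun y => ∑ i ∈ s, f (y i))
          - levelMean K (insert b s) v (fun x => ∑ i ∈ insert b s, f (x i))) = 0) ∧
    ∑ l ∈ Finset.Icc (v - K * s.card) (min K v), ((l.factorial : ℝ)⁻¹ * levelMass K s (v - l))
        * (l * (f l + levelMean K s (v - l) (fun y => ∑ i ∈ s, f (y i))
          - levelMean K (insert b s) v (fun x => ∑ i ∈ insert b s, f (x i)))) = 0 := by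
  set m := levelMean K (insert b s) v (fun x => ∑ i ∈ insert b s, f (x i)) with hm
  have key : ∀ c : ℕ → ℝ, levelSum K (insert b s) v
        (fun x => c (x b) * ((∑ i ∈ insert b s, f (x i)) - m))
      = ∑ l ∈ Finset.Icc (v - K * s.card) (min K v), ((l.factorial : ℝ)⁻¹ * levelMass K s (v - l))
        * (c l * (f l + levelMean K s (v - l) (fun y => ∑ i ∈ s, f (y i)) - m)) := by
    intro c
    rw [levelSum_insert hb]
    apply Finset.sum_congr rfl
    intro l hl
    rw [Finset.mem_Icc] at hl
    have hpos := (levelMass_pos (K := K) (s := s) (v := v - l) (by omega)).ne'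
    simp only [sum_insert_update hb, Function.update_self]
    have e : levelSum K s (v - l) (fun y => c l * (f l + ∑ i ∈ s, f (y i) - m))
        = c l * (levelSum K s (v - l) (fun y => ∑ i ∈ s, f (y i))
          + (f l - m) * levelMass K s (v - l)) := by
      rw [levelSum_mul, ← levelSum_const, ← levelSum_add]
      congr 1
      apply levelSum_congr
      intro y _ _; ring
    rw [e, levelMean]
    field_simp
    ring
  constructor
  · have h := key (fun _ => 1)
    simp only [one_mul] at h
    rw [← h, hm, levelSum_sub_levelMean hv]
  · have h := key (fun l => (l : ℝ))
    rw [← h, hm, levelSum_apply_mul_sub hv (Finset.mem_insert_self b s)]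

lemma seqConvexOn_add {lo hi : ℕ} {f g : ℕ → ℝ} (hf : SeqConvexOn lo hi f)
    (hg : SeqConvexOn lo hi g) : SeqConvexOn lo hi (fun l => f l + g l) := by
  intro l hl hl'
  have := hf l hl hl'
  have := hg l hl hl'
  linarith

lemma SeqConvexOn.mono {lo hi lo' hi' : ℕ} {f : ℕ → ℝ} (hf : SeqConvexOn lo hi f) (h1 : lo ≤ lo')
    (h2 : hi' ≤ hi) : SeqConvexOn lo' hi' f := fun l hl hl' => hf l (by omega) (by omega)

/-- Tilting the loads geometrically increases the mean of convex sums. -/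
theorem levelSum_pow_mul_sub_nonneg {K : ℕ} {f : ℕ → ℝ} (hf : SeqConvexOn 0 K f) {θ : ι → ℝ}
    (hθ : ∀ i, 0 < θ i) (s : Finset ι) : ∀ v, v ≤ K * s.card →
    0 ≤ levelSum K s v (fun x => (∏ i ∈ s, θ i ^ x i) * ((∑ i ∈ s, f (x i))
      - levelMean K s v (fun x => ∑ i ∈ s, f (x i)))) := by
  induction s using Finset.strongInduction with
  | H s ih =>
  intro v hv
  rcases s.eq_empty_or_nonempty with rfl | hs
  · simp only [Finset.sum_empty]
    rw [levelMean_const hv]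
    simp [levelSum_const]
  -- Relative to the smallest parameter all other tilts are at least 1, which makes `R` below
  -- directionally convex.
  obtain ⟨b, hbs, hbmin⟩ := s.exists_min_image θ hs
  obtain ⟨t, hbt, rfl⟩ : ∃ t, b ∉ t ∧ s = insert b t :=
    ⟨s.erase b, Finset.notMem_erase b s, (Finset.insert_erase hbs).symm⟩
  have hcard := Finset.card_insert_of_notMem hbt
  have hv' : v ≤ K * t.card + K := by rw [hcard] at hv; linarith
  set m := levelMean K (insert b t) v (fun x => ∑ i ∈ insert b t, f (x i)) with hm
  set R : (ι → ℕ) → ℝ := fun y => ∏ i ∈ t, (θ i / θ b) ^ y i with hR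
  obtain ⟨h0, h1⟩ := levelSum_insert_orthogonal hbt hv f
  rw [← hm] at h0 h1
  have hRc : DirConvex K t R := dirConvex_prod_pow fun i hi => by
    rw [one_le_div (hθ b)]
    exact hbmin i (Finset.mem_insert_of_mem hi)
  -- Condition on the load `l` of bin `b`: the means of the remaining tilt and of the convex sum are
  -- both convex in `l`, and the latter is uncorrelated with `l`.
  have hcov := SeqConvexOn.cov_nonneg (lo := v - K * t.card) (hi := min K v)
    (μ := fun l => (l.factorial : ℝ)⁻¹ * levelMass K t (v - l))
    (τ := fun l => levelMean K t (v - l) R)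
    (g := fun l => f l + levelMean K t (v - l) (fun y => ∑ i ∈ t, f (y i))) (m := m)
    (fun l => mul_nonneg (by positivity) (levelSum_nonneg fun _ _ _ => zero_le_one))
    (seqConvexOn_levelMean_sub hRc v _ (min_le_right _ _))
    (seqConvexOn_add (hf.mono (Nat.zero_le _) (min_le_left _ _))
      (seqConvexOn_levelMean_sub (dirConvex_sum hf) v _ (min_le_right _ _))) h0 h1
  have hprod : ∀ l ≤ v, ∀ y ∈ loadBox K t, ∑ i, y i = v - l →
      θ b ^ l * ∏ i ∈ t, θ i ^ y i = θ b ^ v * R y := by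
    intro l hl y hy hyv
    have : ∏ i ∈ t, θ i ^ y i = θ b ^ (v - l) * R y := by
      rw [hR]
      dsimp only
      rw [← hyv, ← sum_eq_sum_of_mem_loadBox hy, ← Finset.prod_pow_eq_pow_sum,
        ← Finset.prod_mul_distrib]
      apply Finset.prod_congr rfl
      intro i _
      rw [← mul_pow, mul_div_cancel₀ _ (hθ b).ne']
    rw [this, ← mul_assoc, ← pow_add, Nat.add_sub_of_le hl]
  refine (mul_nonneg (pow_nonneg (hθ b).le v) hcov).trans ?_
  rw [levelSum_insert hbt, Finset.mul_sum]
  apply Finset.sum_le_sum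
  intro l hl
  rw [Finset.mem_Icc] at hl
  have hmass := levelMass_pos (K := K) (s := t) (v := v - l) (by omega)
  have hih := ih t (Finset.ssubset_insert hbt) (v - l) (by omega)
  -- Covariance within the conditioned law, handled by the induction hypothesis, plus covariance of
  -- the conditional means, handled by `hcov`.
  have e : levelSum K t (v - l) (fun y => (∏ i ∈ insert b t, θ i ^ Function.update y b l i)
        * ((∑ i ∈ insert b t, f (Function.update y b l i)) - m))
      = θ b ^ l * levelSum K t (v - l) (fun y => (∏ i ∈ t, θ i ^ y i) * ((∑ i ∈ t, f (y i))
          - levelMean K t (v - l) (fun y => ∑ i ∈ t, f (y i))))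
        + θ b ^ v * (f l + levelMean K t (v - l) (fun y => ∑ i ∈ t, f (y i)) - m)
          * levelSum K t (v - l) R := by
    rw [← levelSum_mul, ← levelSum_mul, ← levelSum_add]
    apply levelSum_congr
    intro y hy hyv
    rw [sum_insert_update hbt, prod_insert_update hbt (fun i a => θ i ^ a)]
    have := hprod l (by omega) y hy hyv
    linear_combination
      (f l + levelMean K t (v - l) (fun y => ∑ i ∈ t, f (y i)) - m) * this
  rw [e]
  have h2 : levelSum K t (v - l) R = levelMass K t (v - l) * levelMean K t (v - l) R := by
    rw [levelMean]; field_simp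
  rw [h2]
  have h3 : 0 ≤ (l.factorial : ℝ)⁻¹ * (θ b ^ l * levelSum K t (v - l)
      (fun y => (∏ i ∈ t, θ i ^ y i) * ((∑ i ∈ t, f (y i))
          - levelMean K t (v - l) (fun y => ∑ i ∈ t, f (y i))))) :=
    mul_nonneg (by positivity) (mul_nonneg (pow_nonneg (hθ b).le l) hih)
  linarith

/-- Filling a bin completely raises the mean of convex sums. -/
theorem levelMean_le_add_levelMean {K : ℕ} {f : ℕ → ℝ} (hf : SeqConvexOn 0 (K + 1) f)
    {s : Finset ι} {b : ι} (hb : b ∉ s) {v : ℕ} (hv : v ≤ K * (insert b s).card)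
    (hvK : K + 1 ≤ v) (hvs : v ≤ K + 1 + K * s.card) :
    levelMean K (insert b s) v (fun x => ∑ i ∈ insert b s, f (x i))
      ≤ f (K + 1) + levelMean K s (v - (K + 1)) (fun y => ∑ i ∈ s, f (y i)) := by
  have hcard := Finset.card_insert_of_notMem hb
  have hv' : v ≤ K * s.card + K := by rw [hcard] at hv; linarith
  obtain ⟨h0, h1⟩ := levelSum_insert_orthogonal hb hv f
  have hfK := hf.mono (le_refl 0) (Nat.le_succ K)
  rw [min_eq_left (by omega : K ≤ v)] at h0 h1
  rcases lt_or_ge (v - K * s.card) K with hlt | hge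
  -- The conditional mean given load `l` of bin `b`, continued as a formula to the excluded load `l
  -- = K + 1`, is a convex sequence; there it is the right-hand side.
  · refine SeqConvexOn.mean_le_right (lo := v - K * s.card) (hi := K)
      (μ := fun l => (l.factorial : ℝ)⁻¹ * levelMass K s (v - l))
      (g := fun l => f l + levelMean K s (v - l) (fun y => ∑ i ∈ s, f (y i))) hlt ?_ ?_ h0 h1
    · intro l hl hl'
      exact mul_pos (by positivity) (levelMass_pos (by omega))
    · exact seqConvexOn_add (hf.mono (Nat.zero_le _) le_rfl)
        (seqConvexOn_levelMean_sub (dirConvex_sum hfK) v _ hvK)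
  -- Degenerate case: only the configuration with every load `K` exists, and the line of slope `f (K
  -- + 1) - f K` through the value at `K` bounds `f` from below.
  · have hveq : v = K * s.card + K := by
      rcases Nat.eq_zero_or_pos K with rfl | hK
      · simp at hv'; omega
      · omega
    have hfull : levelMean K (insert b s) v (fun x => ∑ i ∈ insert b s, f (x i))
        = levelMean K (insert b s) v (fun _ => (s.card + 1) * f K) := by
      unfold levelMean
      congr 1
      apply levelSum_congr
      intro x hx hxv
      have hle : ∀ i ∈ insert b s, x i ≤ K := fun i _ => (mem_loadBox.1 hx).1 i
      have hsum : ∑ i ∈ insert b s, x i = ∑ _i ∈ insert b s, K := by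
        rw [sum_eq_sum_of_mem_loadBox hx, hxv, Finset.sum_const, smul_eq_mul, hcard, hveq]
        ring
      have h2 := (Finset.sum_eq_sum_iff_of_le hle).1 hsum
      rw [Finset.sum_congr rfl (fun i hi => by rw [h2 i hi]), Finset.sum_const, hcard, nsmul_eq_mul]
      push_cast; ring
    rw [hfull, levelMean_const hv]
    have hlin : ∀ l, l ≤ K → f K - (K - l) * (f (K + 1) - f K) ≤ f l := by
      intro l hl
      have := (hf.mul_slope_le (Nat.zero_le l) hl (Nat.le_succ K)).1 le_rfl
      linarith
    have hv2 : v - (K + 1) ≤ K * s.card := by omega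
    have hlow : s.card * f K - (f (K + 1) - f K)
        ≤ levelMean K s (v - (K + 1)) (fun y => ∑ i ∈ s, f (y i)) := by
      rw [← levelMean_const hv2 (s.card * f K - (f (K + 1) - f K))]
      unfold levelMean
      apply div_le_div_of_nonneg_right _ (levelMass_pos hv2).le
      apply levelSum_mono
      intro y hy hyv
      have h3 : ∑ i ∈ s, (f K - (K - y i) * (f (K + 1) - f K)) ≤ ∑ i ∈ s, f (y i) :=
        Finset.sum_le_sum fun i _ => hlin _ ((mem_loadBox.1 hy).1 i)
      rw [Finset.sum_sub_distrib, ← Finset.sum_mul, Finset.sum_sub_distrib, Finset.sum_const,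
        Finset.sum_const, nsmul_eq_mul, nsmul_eq_mul] at h3
      have h4 : ∑ i ∈ s, (y i : ℝ) = s.card * K - 1 := by
        have h5 : ∑ i ∈ s, y i + 1 = s.card * K := by
          rw [sum_eq_sum_of_mem_loadBox hy, hyv, mul_comm]; omega
        have : ((∑ i ∈ s, y i + 1 : ℕ) : ℝ) = (s.card * K : ℕ) := by rw [h5]
        push_cast at this
        linarith
      rw [h4] at h3
      linarith
    linarith

end Tilt

/-! ### Overflow weights: recursion and total positivity -/

/-- The weight of a load `l` in an available bin that collects the overflow of `r` full bins of
capacity `C`. -/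
noncomputable def overflowWeight (C : ℕ) : ℕ → ℕ → ℝ
  | 0, l => (l.factorial : ℝ)⁻¹
  | r + 1, l => ∑ o ∈ Finset.range (l + 1), overflowWeight C r (C + o) * ((l - o).factorial : ℝ)⁻¹

lemma overflowWeight_pos (C r l : ℕ) : 0 < overflowWeight C r l := by
  induction r generalizing l with
  | zero => unfold overflowWeight; positivity
  | succ r ih =>
    unfold overflowWeight
    exact Finset.sum_pos (fun o _ => mul_pos (ih _) (by positivity)) ⟨0, by simp⟩

/-- The weight of one object less, zero if there is none. -/
noncomputable def overflowWeightPred (C r : ℕ) : ℕ → ℝ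
  | 0 => 0
  | l + 1 => overflowWeight C r l

lemma mul_inv_factorial (d : ℕ) : ((d + 1 : ℕ) : ℝ) * ((d + 1).factorial : ℝ)⁻¹
    = (d.factorial : ℝ)⁻¹ := by
  rw [Nat.factorial_succ]
  push_cast
  have : (d.factorial : ℝ) ≠ 0 := by positivity
  have : (d : ℝ) + 1 ≠ 0 := by positivity
  field_simp

/-- Remove the last object: either it stays in the bin, or it fills up a bin of the cluster. -/
lemma overflowWeight_last_object (K r l : ℕ) :
    ((r * (K + 1) + l : ℕ) : ℝ) * overflowWeight (K + 1) r l
      = (r + 1) * overflowWeightPred (K + 1) r l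
        + ∑ i ∈ Finset.range r, ((i : ℝ) + 1) * overflowWeight (K + 1) i K
            * overflowWeight (K + 1) (r - 1 - i) l := by
  induction r generalizing l with
  | zero =>
    cases l with
    | zero => simp [overflowWeightPred]
    | succ l =>
      simp only [overflowWeightPred, overflowWeight, zero_mul, zero_add, Finset.range_zero,
        Finset.sum_empty, add_zero, CharP.cast_eq_zero, one_mul]
      exact mul_inv_factorial l
  | succ r ih =>
    set W := overflowWeight (K + 1) with hW
    have hdef : ∀ q l, W (q + 1) l
        = ∑ o ∈ Finset.range (l + 1), W q (K + 1 + o) * ((l - o).factorial : ℝ)⁻¹ := fun _ _ => rfl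
    -- The objects of the cluster are split into those that passed through the preceding bins,
    -- overflow `o` included, and the `l - o` hashed directly to the last bin.
    have e1 : (((r + 1) * (K + 1) + l : ℕ) : ℝ) * W (r + 1) l
        = ∑ o ∈ Finset.range (l + 1), (((r * (K + 1) + (K + 1 + o) : ℕ) : ℝ) * W r (K + 1 + o))
            * ((l - o).factorial : ℝ)⁻¹
          + ∑ o ∈ Finset.range (l + 1), W r (K + 1 + o)
            * (((l - o : ℕ) : ℝ) * ((l - o).factorial : ℝ)⁻¹) := by
      rw [hdef, Finset.mul_sum, ← Finset.sum_add_distrib]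
      apply Finset.sum_congr rfl
      intro o ho
      have ho := Finset.mem_range.1 ho
      have : (((r + 1) * (K + 1) + l : ℕ) : ℝ)
          = ((r * (K + 1) + (K + 1 + o) : ℕ) : ℝ) + ((l - o : ℕ) : ℝ) := by
        rw [← Nat.cast_add]
        congr 1
        rw [show l = o + (l - o) by omega]
        simp only [Nat.add_sub_cancel_left]
        ring
      rw [this]; ring
    have e2 : ∑ o ∈ Finset.range (l + 1), W r (K + 1 + o)
            * (((l - o : ℕ) : ℝ) * ((l - o).factorial : ℝ)⁻¹)
        = overflowWeightPred (K + 1) (r + 1) l := by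
      cases l with
      | zero => simp [overflowWeightPred]
      | succ l =>
        rw [Finset.sum_range_succ]
        simp only [Nat.sub_self, CharP.cast_eq_zero, zero_mul, mul_zero, add_zero]
        show _ = W (r + 1) l
        rw [hdef]
        apply Finset.sum_congr rfl
        intro o ho
        have ho := Finset.mem_range.1 ho
        rw [show l + 1 - o = (l - o) + 1 by omega, mul_inv_factorial]
    -- The term `o = 0` is the new event: the last object filled the bin just before the available
    -- one.
    have e3 : ∑ o ∈ Finset.range (l + 1), overflowWeightPred (K + 1) r (K + 1 + o)
          * ((l - o).factorial : ℝ)⁻¹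
        = W r K * W 0 l + overflowWeightPred (K + 1) (r + 1) l := by
      rw [Finset.sum_range_succ', add_comm]
      congr 1
      cases l with
      | zero => simp [overflowWeightPred]
      | succ l =>
        show _ = W (r + 1) l
        rw [hdef]
        apply Finset.sum_congr rfl
        intro o ho
        rw [show l + 1 - (o + 1) = l - o by omega]
        rfl
    have e4 : ∑ o ∈ Finset.range (l + 1), (((r * (K + 1) + (K + 1 + o) : ℕ) : ℝ) * W r (K + 1 + o))
            * ((l - o).factorial : ℝ)⁻¹
        = (r + 1) * (W r K * W 0 l + overflowWeightPred (K + 1) (r + 1) l)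
          + ∑ i ∈ Finset.range r, ((i : ℝ) + 1) * W i K * W (r - i) l := by
      rw [← e3, Finset.mul_sum]
      have : ∑ i ∈ Finset.range r, ((i : ℝ) + 1) * W i K * W (r - i) l
          = ∑ o ∈ Finset.range (l + 1), ∑ i ∈ Finset.range r, ((i : ℝ) + 1) * W i K
            * W (r - 1 - i) (K + 1 + o) * ((l - o).factorial : ℝ)⁻¹ := by
        rw [Finset.sum_comm]
        apply Finset.sum_congr rfl
        intro i hi
        have hi := Finset.mem_range.1 hi
        rw [show r - i = (r - 1 - i) + 1 by omega, hdef, Finset.mul_sum]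
        apply Finset.sum_congr rfl
        intro o _; ring
      rw [this, ← Finset.sum_add_distrib]
      apply Finset.sum_congr rfl
      intro o _
      rw [ih, ← Finset.sum_mul]
      ring
    rw [e1, e2, e4, Finset.sum_range_succ, show r + 1 - 1 - r = 0 by omega]
    simp only [Nat.add_sub_cancel]
    push_cast
    ring

/-- Log-concavity of `1 / d!`, in the form `(a + c)! (a + b)! ≤ a! (a + b + c)!`. -/
lemma inv_factorial_sub_tp2 {l m o p : ℕ} (hlm : l ≤ m) (hop : o ≤ p) :
    (if p ≤ l then ((l - p).factorial : ℝ)⁻¹ else 0) * (if o ≤ m then ((m - o).factorial : ℝ)⁻¹ else 0)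
      ≤ (if o ≤ l then ((l - o).factorial : ℝ)⁻¹ else 0)
        * (if p ≤ m then ((m - p).factorial : ℝ)⁻¹ else 0) := by
  by_cases hpl : p ≤ l
  · rw [if_pos hpl, if_pos (by omega), if_pos (by omega), if_pos (by omega)]
    obtain ⟨a, rfl⟩ := Nat.exists_eq_add_of_le hpl
    obtain ⟨b, rfl⟩ := Nat.exists_eq_add_of_le hlm
    obtain ⟨c, rfl⟩ := Nat.exists_eq_add_of_le hop
    rw [show o + c + a - (o + c) = a by omega, show o + c + a + b - o = a + b + c by omega,
      show o + c + a - o = a + c by omega, show o + c + a + b - (o + c) = a + b by omega,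
      ← mul_inv, ← mul_inv]
    apply inv_anti₀ (by positivity)
    have h1 : (a + c).factorial * (a + b).factorial ≤ a.factorial * (a + b + c).factorial := by
      induction c with
      | zero => simp
      | succ c ih =>
        rw [← add_assoc, ← add_assoc, Nat.factorial_succ, Nat.factorial_succ]
        calc (a + c + 1) * (a + c).factorial * (a + b).factorial
            = (a + c + 1) * ((a + c).factorial * (a + b).factorial) := by ring
          _ ≤ (a + b + c + 1) * (a.factorial * (a + b + c).factorial) :=
              Nat.mul_le_mul (by omega) (ih (by omega) (by omega) (by omega))
          _ = _ := by ring
    exact_mod_cast h1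
  · rw [if_neg hpl, zero_mul]
    apply mul_nonneg <;> split_ifs <;> positivity

/-- The basic composition formula for total positivity of order two. -/
lemma sum_kernel_tp2 {N : ℕ} {u v k₁ k₂ : ℕ → ℝ}
    (huv : ∀ o p, o ≤ p → p < N → 0 ≤ u o * v p - u p * v o)
    (hk : ∀ o p, o ≤ p → p < N → 0 ≤ k₁ o * k₂ p - k₁ p * k₂ o) :
    (∑ o ∈ Finset.range N, u o * k₂ o) * ∑ o ∈ Finset.range N, v o * k₁ o
      ≤ (∑ o ∈ Finset.range N, u o * k₁ o) * ∑ o ∈ Finset.range N, v o * k₂ o := by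
  have h1 : (∑ o ∈ Finset.range N, u o * k₁ o) * ∑ o ∈ Finset.range N, v o * k₂ o
      - (∑ o ∈ Finset.range N, u o * k₂ o) * ∑ o ∈ Finset.range N, v o * k₁ o
      = ∑ o ∈ Finset.range N, ∑ p ∈ Finset.range N, (u o * v p - u p * v o) * (k₁ o * k₂ p) := by
    rw [Finset.sum_mul_sum, mul_comm (∑ o ∈ Finset.range N, u o * k₂ o), Finset.sum_mul_sum,
      ← Finset.sum_sub_distrib]
    apply Finset.sum_congr rfl
    intro o _
    rw [← Finset.sum_sub_distrib]
    apply Finset.sum_congr rfl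
    intro p _; ring
  have h2 : ∑ o ∈ Finset.range N, ∑ p ∈ Finset.range N, (u o * v p - u p * v o) * (k₁ o * k₂ p)
      = ∑ o ∈ Finset.range N, ∑ p ∈ Finset.range N, (u p * v o - u o * v p) * (k₁ p * k₂ o) :=
    Finset.sum_comm
  -- Symmetrising the double sum in `o` and `p` pairs the two minors, which always have the same
  -- sign.
  have h3 : 0 ≤ ∑ o ∈ Finset.range N, ∑ p ∈ Finset.range N,
      (u o * v p - u p * v o) * (k₁ o * k₂ p - k₁ p * k₂ o) := by
    apply Finset.sum_nonneg
    intro o ho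
    apply Finset.sum_nonneg
    intro p hp
    rw [Finset.mem_range] at ho hp
    rcases le_total o p with h | h
    · exact mul_nonneg (huv o p h hp) (hk o p h hp)
    · have := mul_nonneg (huv p o h ho) (hk p o h ho)
      linarith
  have h4 : ∑ o ∈ Finset.range N, ∑ p ∈ Finset.range N,
      (u o * v p - u p * v o) * (k₁ o * k₂ p - k₁ p * k₂ o)
      = ∑ o ∈ Finset.range N, ∑ p ∈ Finset.range N, (u o * v p - u p * v o) * (k₁ o * k₂ p)
        + ∑ o ∈ Finset.range N, ∑ p ∈ Finset.range N, (u p * v o - u o * v p) * (k₁ p * k₂ o) := by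
    rw [← Finset.sum_add_distrib]
    apply Finset.sum_congr rfl
    intro o _
    rw [← Finset.sum_add_distrib]
    apply Finset.sum_congr rfl
    intro p _; ring
  linarith

lemma overflowWeight_succ_eq (C r : ℕ) {l N : ℕ} (hN : l < N) : overflowWeight C (r + 1) l
    = ∑ o ∈ Finset.range N, overflowWeight C r (C + o)
        * if o ≤ l then ((l - o).factorial : ℝ)⁻¹ else 0 := by
  have hdef : overflowWeight C (r + 1) l = ∑ o ∈ Finset.range (l + 1),
    overflowWeight C r (C + o) * ((l - o).factorial : ℝ)⁻¹ := rfl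
  have : ∑ o ∈ Finset.range (l + 1), overflowWeight C r (C + o) * ((l - o).factorial : ℝ)⁻¹
      = ∑ o ∈ Finset.range (l + 1), overflowWeight C r (C + o)
        * if o ≤ l then ((l - o).factorial : ℝ)⁻¹ else 0 := by
    apply Finset.sum_congr rfl
    intro o ho
    rw [if_pos (by have := Finset.mem_range.1 ho; omega)]
  rw [hdef, this]
  apply Finset.sum_subset
  · intro o ho
    rw [Finset.mem_range] at *
    omega
  · intro o _ ho
    rw [Finset.mem_range] at ho
    rw [if_neg (by omega), mul_zero]

/-- The weights increase in the likelihood ratio order with the size of the cluster. -/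
lemma overflowWeight_ratio_mono (C : ℕ) {r r' : ℕ} (hr : r ≤ r') {l m : ℕ} (hlm : l ≤ m) :
    overflowWeight C r m * overflowWeight C r' l ≤ overflowWeight C r l * overflowWeight C r' m := by
  induction r generalizing r' l m with
  | zero =>
    rcases r' with _ | r'
    · rw [mul_comm]
    rw [overflowWeight_succ_eq C r' (N := m + 1) (by omega),
      overflowWeight_succ_eq C r' (N := m + 1) (by omega)]
    -- A bin without overflow is the same kernel applied to a point mass at `o = 0`, and such a mass
    -- is below every weight in the likelihood ratio order.
    have key := sum_kernel_tp2 (N := m + 1) (u := fun o => if o = 0 then 1 else 0)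
      (v := fun o => overflowWeight C r' (C + o))
      (k₁ := fun o => if o ≤ l then ((l - o).factorial : ℝ)⁻¹ else 0)
      (k₂ := fun o => if o ≤ m then ((m - o).factorial : ℝ)⁻¹ else 0) ?_ ?_
    · have e : ∀ n, ∑ o ∈ Finset.range (m + 1), (if o = 0 then (1 : ℝ) else 0)
          * (if o ≤ n then ((n - o).factorial : ℝ)⁻¹ else 0) = overflowWeight C 0 n := by
        intro n
        rw [Finset.sum_eq_single 0]
        · simp [overflowWeight]
        · intro o _ ho; simp [ho]
        · intro h; simp at h
      rwa [e, e] at key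
    · intro o p hop _
      have := (overflowWeight_pos C r' (C + p)).le
      by_cases h1 : o = 0
      · by_cases h2 : p = 0
        · subst h1; subst h2; simp
        · simpa [h1, h2] using this
      · have h2 : p ≠ 0 := by omega
        simp [h1, h2]
    · intro o p hop _
      exact sub_nonneg.2 (inv_factorial_sub_tp2 hlm hop)
  | succ r ih =>
    obtain ⟨q, rfl⟩ := Nat.exists_eq_add_of_le' (show 1 ≤ r' by omega)
    rw [overflowWeight_succ_eq C q (N := m + 1) (by omega),
      overflowWeight_succ_eq C q (N := m + 1) (by omega),
      overflowWeight_succ_eq C r (N := m + 1) (by omega),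
      overflowWeight_succ_eq C r (N := m + 1) (by omega)]
    refine sum_kernel_tp2 ?_ ?_
    · intro o p hop _
      exact sub_nonneg.2 (ih (by omega) (by omega))
    · intro o p hop _
      exact sub_nonneg.2 (inv_factorial_sub_tp2 hlm hop)

/-! ### Overflow weights as moment sequences -/

open Polynomial in
/-- The linear functional on polynomials with moments `ρ`. -/
noncomputable def momentFunctional (ρ : ℕ → ℝ) : ℝ[X] →ₗ[ℝ] ℝ :=
  Polynomial.lsum fun l => ρ l • LinearMap.id

/-- `ρ` is in the closed cone generated by the moment sequences of the points of `[1, ∞)`. -/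
def IsMomentSeq (ρ : ℕ → ℝ) : Prop :=
  ∀ p : Polynomial ℝ, (∀ θ : ℝ, 1 ≤ θ → 0 ≤ p.eval θ) → 0 ≤ momentFunctional ρ p

lemma momentFunctional_monomial (ρ : ℕ → ℝ) (l : ℕ) (a : ℝ) :
    momentFunctional ρ (Polynomial.monomial l a) = ρ l * a := by
  simp [momentFunctional, Polynomial.lsum_apply, Polynomial.sum_monomial_index]

open Polynomial in
/-- The antiderivative of a polynomial that vanishes at the origin. -/
noncomputable def polyAntideriv : ℝ[X] →ₗ[ℝ] ℝ[X] :=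
  Polynomial.lsum fun n => ((n : ℝ) + 1)⁻¹ • Polynomial.monomial (n + 1)

lemma polyAntideriv_monomial (n : ℕ) (a : ℝ) : polyAntideriv (Polynomial.monomial n a)
    = Polynomial.monomial (n + 1) (((n : ℝ) + 1)⁻¹ * a) := by
  simp [polyAntideriv, Polynomial.lsum_apply, Polynomial.sum_monomial_index,
    Polynomial.smul_monomial]

lemma derivative_polyAntideriv (p : Polynomial ℝ) :
    Polynomial.derivative (polyAntideriv p) = p := by
  induction p using Polynomial.induction_on' with
  | add p q hp hq => rw [map_add, map_add, hp, hq]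
  | monomial n a =>
    rw [polyAntideriv_monomial, Polynomial.derivative_monomial]
    congr 1
    push_cast
    have : (n : ℝ) + 1 ≠ 0 := by positivity
    field_simp

lemma eval_zero_polyAntideriv (p : Polynomial ℝ) : (polyAntideriv p).eval 0 = 0 := by
  induction p using Polynomial.induction_on' with
  | add p q hp hq => rw [map_add, Polynomial.eval_add, hp, hq, add_zero]
  | monomial n a => rw [polyAntideriv_monomial, Polynomial.eval_monomial]; simp

lemma eval_polyAntideriv_nonneg {p : Polynomial ℝ} (hp : ∀ x : ℝ, 0 ≤ x → 0 ≤ p.eval x) {x : ℝ}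
    (hx : 0 ≤ x) : 0 ≤ (polyAntideriv p).eval x := by
  have hmono : MonotoneOn (fun x => (polyAntideriv p).eval x) (Set.Ici 0) := by
    apply monotoneOn_of_deriv_nonneg (convex_Ici 0)
    · exact (polyAntideriv p).continuous.continuousOn
    · exact (polyAntideriv p).differentiable.differentiableOn
    · intro y hy
      rw [interior_Ici] at hy
      rw [Polynomial.deriv, derivative_polyAntideriv]
      exact hp y (le_of_lt hy)
  have := hmono (Set.mem_Ici.2 le_rfl) (Set.mem_Ici.2 hx) hx
  simpa [eval_zero_polyAntideriv] using this

lemma polyAntideriv_iterate_monomial (c n : ℕ) (a : ℝ) :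
    (polyAntideriv^[c]) (Polynomial.monomial n a)
      = Polynomial.monomial (c + n) (n.factorial * ((c + n).factorial : ℝ)⁻¹ * a) := by
  induction c with
  | zero =>
    have : (n.factorial : ℝ) ≠ 0 := by positivity
    simp [this]
  | succ c ih =>
    rw [Function.iterate_succ_apply', ih, polyAntideriv_monomial, show c + 1 + n = c + n + 1 by ring]
    congr 1
    rw [Nat.factorial_succ]
    push_cast
    have : ((c + n).factorial : ℝ) ≠ 0 := by positivity
    have : (c : ℝ) + n + 1 ≠ 0 := by positivity
    field_simp

lemma polyAntideriv_iterate_add (c : ℕ) (p q : Polynomial ℝ) :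
    (polyAntideriv^[c]) (p + q) = (polyAntideriv^[c]) p + (polyAntideriv^[c]) q := by
  induction c with
  | zero => rfl
  | succ c ih => simp only [Function.iterate_succ_apply', ih, map_add]

lemma polyAntideriv_iterate_sum {α : Type*} (c : ℕ) (s : Finset α) (p : α → Polynomial ℝ) :
    (polyAntideriv^[c]) (∑ a ∈ s, p a) = ∑ a ∈ s, (polyAntideriv^[c]) (p a) := by
  classical
  induction s using Finset.induction_on with
  | empty =>
    simp only [Finset.sum_empty]
    induction c with
    | zero => rfl
    | succ c ih => rw [Function.iterate_succ_apply', ih, map_zero]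
  | insert a s ha ih => rw [Finset.sum_insert ha, Finset.sum_insert ha, polyAntideriv_iterate_add, ih]

lemma eval_polyAntideriv_iterate_nonneg (c : ℕ) {p : Polynomial ℝ}
    (hp : ∀ x : ℝ, 0 ≤ x → 0 ≤ p.eval x) : ∀ x : ℝ, 0 ≤ x → 0 ≤ ((polyAntideriv^[c]) p).eval x := by
  induction c with
  | zero => exact hp
  | succ c ih =>
    intro x hx
    rw [Function.iterate_succ_apply']
    exact eval_polyAntideriv_nonneg ih hx

/-- The binomial theorem for `(X + 1) ^ l` produces the sum over the overflow `o`, and `C`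
antiderivatives from 0 turn `X ^ o` into `o! / (C + o)! * X ^ (C + o)`, which matches the factorials
in the recursion. -/
lemma momentFunctional_overflow_succ (C r : ℕ) (p : Polynomial ℝ) :
    momentFunctional (fun l => l.factorial * overflowWeight C (r + 1) l) p
      = momentFunctional (fun l => l.factorial * overflowWeight C r l)
          ((polyAntideriv^[C]) (p.comp (Polynomial.X + 1))) := by
  induction p using Polynomial.induction_on' with
  | add p q hp hq => rw [map_add, hp, hq, Polynomial.add_comp, polyAntideriv_iterate_add, map_add]
  | monomial l a =>
    have e : (Polynomial.monomial l a).comp (Polynomial.X + 1)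
        = ∑ o ∈ Finset.range (l + 1), Polynomial.monomial o ((l.choose o : ℝ) * a) := by
      rw [Polynomial.monomial_comp, add_pow, Finset.mul_sum]
      apply Finset.sum_congr rfl
      intro o _
      rw [one_pow, mul_one, ← Polynomial.C_mul_X_pow_eq_monomial, Polynomial.C_mul,
        Polynomial.C_eq_natCast]
      ring
    rw [e, polyAntideriv_iterate_sum, map_sum, momentFunctional_monomial]
    simp_rw [polyAntideriv_iterate_monomial, momentFunctional_monomial]
    rw [show overflowWeight C (r + 1) l
      = ∑ o ∈ Finset.range (l + 1), overflowWeight C r (C + o) * ((l - o).factorial : ℝ)⁻¹ from rfl,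
      Finset.mul_sum, Finset.sum_mul]
    apply Finset.sum_congr rfl
    intro o ho
    have ho := Nat.lt_succ_iff.1 (Finset.mem_range.1 ho)
    have h1 : ((l.choose o : ℕ) : ℝ) * o.factorial * (l - o).factorial = l.factorial := by
      exact_mod_cast Nat.choose_mul_factorial_mul_factorial ho
    have h2 : ((l - o).factorial : ℝ) ≠ 0 := by positivity
    have h3 : ((C + o).factorial : ℝ) ≠ 0 := by positivity
    rw [← h1]
    field_simp

/-- Without overflow the functional is evaluation at 1. If `p ≥ 0` on `[1, ∞)`, then `p (X + 1)` and
its iterated antiderivatives from 0 are nonnegative on `[0, ∞)`, in particular on `[1, ∞)`. -/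
lemma isMomentSeq_overflowWeight (C r : ℕ) :
    IsMomentSeq (fun l => l.factorial * overflowWeight C r l) := by
  induction r with
  | zero =>
    intro p hp
    have : momentFunctional (fun l => (l.factorial : ℝ) * overflowWeight C 0 l) p = p.eval 1 := by
      clear hp
      induction p using Polynomial.induction_on' with
      | add p q hp hq => rw [map_add, hp, hq, Polynomial.eval_add]
      | monomial l a =>
        rw [momentFunctional_monomial, Polynomial.eval_monomial]
        have : (l.factorial : ℝ) ≠ 0 := by positivity
        simp [overflowWeight, this]
    rw [this]
    exact hp 1 le_rfl
  | succ r ih =>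
    intro p hp
    rw [momentFunctional_overflow_succ]
    apply ih
    intro θ hθ
    apply eval_polyAntideriv_iterate_nonneg C _ θ (by linarith)
    intro x hx
    rw [Polynomial.eval_comp]
    apply hp
    simpa using hx

section Multilinear
variable {ι : Type*} [Fintype ι] [DecidableEq ι]

/-- The sum is linear in the weight sequence of each bin, so geometric sequences can be exchanged
for moment sequences one bin at a time: with the other bins fixed it is a polynomial in the
parameter of bin `b`, nonnegative on `[1, ∞)`. -/
lemma levelSum_prod_moment_nonneg_aux {K : ℕ} {s : Finset ι} {v : ℕ} {H : (ι → ℕ) → ℝ}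
    (hH : ∀ θ : ι → ℝ, (∀ i, 1 ≤ θ i) → 0 ≤ levelSum K s v (fun x => (∏ i ∈ s, θ i ^ x i) * H x))
    {ρ : ι → ℕ → ℝ} (hρ : ∀ i, IsMomentSeq (ρ i)) (t : Finset ι) : t ⊆ s →
    ∀ θ : ι → ℝ, (∀ i, 1 ≤ θ i) →
      0 ≤ levelSum K s v (fun x => (∏ i ∈ s, if i ∈ t then ρ i (x i) else θ i ^ x i) * H x) := by
  induction t using Finset.induction_on with
  | empty => intro _ θ hθ; simpa using hH θ hθ
  | insert b t hb ih =>
    intro hts θ hθ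
    have hbs : b ∈ s := hts (Finset.mem_insert_self b t)
    have hts' : t ⊆ s := (Finset.subset_insert b t).trans hts
    set c : ℕ → ℝ := fun l => levelSum K s v (fun x =>
      (∏ i ∈ s.erase b, if i ∈ t then ρ i (x i) else θ i ^ x i) * H x * if x b = l then 1 else 0)
      with hc
    have key : ∀ σ : ℕ → ℝ, levelSum K s v (fun x => σ (x b)
        * ((∏ i ∈ s.erase b, if i ∈ t then ρ i (x i) else θ i ^ x i) * H x))
        = ∑ l ∈ Finset.range (K + 1), σ l * c l := by
      intro σ
      rw [hc]
      dsimp only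
      simp_rw [← levelSum_mul]
      rw [← levelSum_sum]
      apply levelSum_congr
      intro x hx _
      rw [Finset.sum_eq_single (x b)]
      · simp
      · intro l _ hl; simp [hl.symm]
      · intro h
        exact absurd (Finset.mem_range.2 (Nat.lt_succ_iff.2 ((mem_loadBox.1 hx).1 b))) h
    set p : Polynomial ℝ := ∑ l ∈ Finset.range (K + 1), Polynomial.monomial l (c l) with hp
    have hmom := hρ b p ?_
    · rw [hp, map_sum] at hmom
      simp_rw [momentFunctional_monomial] at hmom
      rw [← key] at hmom
      refine hmom.trans (le_of_eq (levelSum_congr fun x _ _ => ?_))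
      rw [← Finset.mul_prod_erase s _ hbs, if_pos (Finset.mem_insert_self b t), mul_assoc]
      congr 2
      apply Finset.prod_congr rfl
      intro i hi
      have hib := Finset.ne_of_mem_erase hi
      simp [hib]
    · intro η hη
      have h1 := ih hts' (Function.update θ b η) (by
        intro i
        by_cases h : i = b
        · subst h; simpa using hη
        · simpa [h] using hθ i)
      have h2 : p.eval η = ∑ l ∈ Finset.range (K + 1), η ^ l * c l := by
        rw [hp, Polynomial.eval_finsetSum]
        apply Finset.sum_congr rfl
        intro l _
        rw [Polynomial.eval_monomial, mul_comm]
      rw [h2, ← key]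
      refine h1.trans (le_of_eq (levelSum_congr fun x _ _ => ?_))
      rw [← Finset.mul_prod_erase s _ hbs, if_neg hb, Function.update_self, mul_assoc]
      congr 2
      apply Finset.prod_congr rfl
      intro i hi
      rw [Function.update_of_ne (Finset.ne_of_mem_erase hi)]

/-- Reweighting the loads by moment sequences increases the mean of convex sums. -/
theorem levelSum_prod_moment_nonneg {K : ℕ} {f : ℕ → ℝ} (hf : SeqConvexOn 0 K f) {s : Finset ι}
    {v : ℕ} (hv : v ≤ K * s.card) {ρ : ι → ℕ → ℝ} (hρ : ∀ i, IsMomentSeq (ρ i)) :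
    0 ≤ levelSum K s v (fun x => (∏ i ∈ s, ρ i (x i)) * ((∑ i ∈ s, f (x i))
      - levelMean K s v (fun x => ∑ i ∈ s, f (x i)))) := by
  have := levelSum_prod_moment_nonneg_aux (K := K) (s := s) (v := v)
    (H := fun x => (∑ i ∈ s, f (x i)) - levelMean K s v (fun x => ∑ i ∈ s, f (x i)))
    (fun θ hθ => levelSum_pow_mul_sub_nonneg hf (fun i => zero_lt_one.trans_le (hθ i)) s v hv)
    hρ s (Finset.Subset.refl s) (fun _ => 1) (fun _ => le_rfl)
  refine this.trans (le_of_eq (levelSum_congr fun x _ _ => ?_))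
  congr 1
  apply Finset.prod_congr rfl
  intro i hi
  rw [if_pos hi]

end Multilinear

/-! ### Clusters of full bins on the ring -/

section Cluster
variable {k : ℕ} {C : ℕ}

open scoped Classical in
/-- The clockwise distance from bin `i` to the first available bin. -/
noncomputable def clockwiseDist (C : ℕ) (x : Loads k) (i : ZMod k) : ℕ :=
  if h : ∃ d : ℕ, x (i + (d : ZMod k)) < C then Nat.find h else 0

lemma clockwiseTarget_eq (x : Loads k) (i : ZMod k) :
    clockwiseTarget C x i = i + (clockwiseDist C x i : ZMod k) := by
  unfold clockwiseTarget clockwiseDist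
  split_ifs <;> simp

lemma clockwiseDist_eq {x : Loads k} {i : ZMod k} {d : ℕ} (h1 : x (i + (d : ZMod k)) < C)
    (h2 : ∀ e : ℕ, e < d → C ≤ x (i + (e : ZMod k))) : clockwiseDist C x i = d := by
  classical
  have h : ∃ d : ℕ, x (i + (d : ZMod k)) < C := ⟨d, h1⟩
  unfold clockwiseDist
  rw [dif_pos h, Nat.find_eq_iff]
  exact ⟨h1, fun e he => not_lt.2 (h2 e he)⟩

variable [NeZero k]

lemma exists_available {x : Loads k} (hA : ∃ b, x b < C) (i : ZMod k) :
    ∃ d : ℕ, x (i + (d : ZMod k)) < C := by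
  obtain ⟨b, hb⟩ := hA
  refine ⟨(b - i).val, ?_⟩
  rwa [ZMod.natCast_zmod_val, add_sub_cancel]

lemma clockwiseDist_spec {x : Loads k} (hA : ∃ b, x b < C) (i : ZMod k) :
    x (clockwiseTarget C x i) < C ∧
      ∀ e : ℕ, e < clockwiseDist C x i → C ≤ x (i + (e : ZMod k)) := by
  classical
  have h := exists_available hA i
  rw [clockwiseTarget_eq]
  unfold clockwiseDist
  rw [dif_pos h]
  exact ⟨Nat.find_spec h, fun e he => not_lt.1 (Nat.find_min h he)⟩

lemma clockwiseDist_add {x : Loads k} (hA : ∃ b, x b < C) (i : ZMod k) {e : ℕ}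
    (he : e ≤ clockwiseDist C x i) :
    clockwiseDist C x (i + (e : ZMod k)) = clockwiseDist C x i - e := by
  obtain ⟨h1, h2⟩ := clockwiseDist_spec hA i
  rw [clockwiseTarget_eq] at h1
  apply clockwiseDist_eq
  · rwa [add_assoc, ← Nat.cast_add, Nat.add_sub_of_le he]
  · intro e' he'
    rw [add_assoc, ← Nat.cast_add]
    exact h2 _ (by omega)

lemma clockwiseTarget_add {x : Loads k} (hA : ∃ b, x b < C) (i : ZMod k) {e : ℕ}
    (he : e ≤ clockwiseDist C x i) :
    clockwiseTarget C x (i + (e : ZMod k)) = clockwiseTarget C x i := by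
  rw [clockwiseTarget_eq, clockwiseTarget_eq, clockwiseDist_add hA i he, add_assoc, ← Nat.cast_add,
    Nat.add_sub_of_le he]

lemma clockwiseDist_eq_zero_iff {x : Loads k} (hA : ∃ b, x b < C) (i : ZMod k) :
    clockwiseDist C x i = 0 ↔ x i < C := by
  constructor
  · intro h
    have := (clockwiseDist_spec hA i).1
    rwa [clockwiseTarget_eq, h, Nat.cast_zero, add_zero] at this
  · intro h
    exact clockwiseDist_eq (by simpa using h) (fun e he => absurd he (Nat.not_lt_zero e))

lemma clockwiseTarget_of_lt {x : Loads k} {i : ZMod k} (h : x i < C) :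
    clockwiseTarget C x i = i := by
  rw [clockwiseTarget_eq, (clockwiseDist_eq_zero_iff ⟨i, h⟩ i).2 h, Nat.cast_zero, add_zero]

/-- The bins whose objects end up in bin `b`. -/
noncomputable def cluster (C : ℕ) (x : Loads k) (b : ZMod k) : Finset (ZMod k) :=
  Finset.univ.filter fun i => clockwiseTarget C x i = b

lemma mem_cluster {x : Loads k} {b i : ZMod k} :
    i ∈ cluster C x b ↔ clockwiseTarget C x i = b := by simp [cluster]

lemma self_mem_cluster {x : Loads k} {b : ZMod k} (h : x b < C) : b ∈ cluster C x b :=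
  mem_cluster.2 (clockwiseTarget_of_lt h)

lemma cluster_card_pos {x : Loads k} {b : ZMod k} (h : x b < C) : 0 < (cluster C x b).card :=
  Finset.card_pos.2 ⟨b, self_mem_cluster h⟩

lemma eq_sub_of_mem_cluster {x : Loads k} {b i : ZMod k} (h : i ∈ cluster C x b) :
    i = b - (clockwiseDist C x i : ZMod k) := by
  rw [mem_cluster, clockwiseTarget_eq] at h
  rw [← h, add_sub_cancel_right]

lemma finset_eq_range_of_downClosed {s : Finset ℕ} (h : ∀ n ∈ s, ∀ m < n, m ∈ s) :
    s = Finset.range s.card := by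
  apply Finset.eq_of_subset_of_card_le
  · intro n hn
    rw [Finset.mem_range]
    have : Finset.range (n + 1) ⊆ s := by
      intro m hm
      rcases (Nat.lt_succ_iff.1 (Finset.mem_range.1 hm)).lt_or_eq with h1 | rfl
      · exact h n hn m h1
      · exact hn
    have := Finset.card_le_card this
    rw [Finset.card_range] at this
    omega
  · rw [Finset.card_range]

/-- A cluster is a run of consecutive bins ending at `b`: with a bin it contains every bin on the
clockwise walk from it to `b`. -/
lemma image_clockwiseDist_cluster {x : Loads k} (hA : ∃ b, x b < C) (b : ZMod k) :
    (cluster C x b).image (clockwiseDist C x) = Finset.range (cluster C x b).card ∧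
      Set.InjOn (clockwiseDist C x) (cluster C x b) := by
  have hinj : Set.InjOn (clockwiseDist C x) (cluster C x b) := by
    intro i hi j hj hij
    rw [eq_sub_of_mem_cluster hi, eq_sub_of_mem_cluster hj, hij]
  refine ⟨?_, hinj⟩
  rw [← Finset.card_image_of_injOn hinj]
  apply finset_eq_range_of_downClosed
  intro n hn m hm
  obtain ⟨i, hi, rfl⟩ := Finset.mem_image.1 hn
  refine Finset.mem_image.2 ⟨i + ((clockwiseDist C x i - m : ℕ) : ZMod k), ?_, ?_⟩
  · rw [mem_cluster, clockwiseTarget_add hA i (Nat.sub_le _ _)]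
    exact mem_cluster.1 hi
  · rw [clockwiseDist_add hA i (Nat.sub_le _ _)]
    omega

lemma sum_cluster_clockwiseDist {x : Loads k} (hA : ∃ b, x b < C) (b : ZMod k) (φ : ℕ → ℝ) :
    ∑ i ∈ cluster C x b, φ (clockwiseDist C x i) = ∑ d ∈ Finset.range (cluster C x b).card, φ d := by
  obtain ⟨h1, h2⟩ := image_clockwiseDist_cluster hA b
  rw [← h1, Finset.sum_image h2]

lemma clockwiseDist_lt_card {x : Loads k} (hA : ∃ b, x b < C) {b i : ZMod k}
    (hi : i ∈ cluster C x b) : clockwiseDist C x i < (cluster C x b).card := by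
  rw [← Finset.mem_range, ← (image_clockwiseDist_cluster hA b).1]
  exact Finset.mem_image_of_mem _ hi

lemma clockwiseDist_congr {x y : Loads k} (hA : ∃ b, x b < C) (h : ∀ i, x i < C ↔ y i < C)
    (i : ZMod k) : clockwiseDist C x i = clockwiseDist C y i := by
  symm
  obtain ⟨h1, h2⟩ := clockwiseDist_spec hA i
  rw [clockwiseTarget_eq] at h1
  refine clockwiseDist_eq ((h _).1 h1) fun e he => ?_
  have := h2 e he
  by_contra hc
  exact absurd ((h _).2 (not_le.1 hc)) (not_lt.2 this)

lemma cluster_congr {x y : Loads k} (hA : ∃ b, x b < C) (h : ∀ i, x i < C ↔ y i < C)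
    (b : ZMod k) : cluster C x b = cluster C y b := by
  ext i
  rw [mem_cluster, mem_cluster, clockwiseTarget_eq, clockwiseTarget_eq, clockwiseDist_congr hA h]

lemma card_filter_cluster {x : Loads k} (hA : ∃ b, x b < C) (b : ZMod k) (p : ℕ → Prop)
    [DecidablePred p] :
    ((cluster C x b).filter (fun i => p (clockwiseDist C x i))).card
      = ((Finset.range (cluster C x b).card).filter p).card := by
  obtain ⟨h1, h2⟩ := image_clockwiseDist_cluster hA b
  rw [← h1, Finset.filter_image, Finset.card_image_of_injOn]
  exact h2.mono (by intro i hi; exact (Finset.mem_filter.1 hi).1)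

section Release
variable {x y : Loads k} {j : ZMod k}

/-- The targets after an object has been removed from the full bin `j`. -/
lemma clockwiseTarget_release (hA : ∃ b, x b < C)
    (hy : ∀ i, y i < C ↔ x i < C ∨ i = j) (i : ZMod k) :
    clockwiseTarget C y i = if clockwiseTarget C x i = clockwiseTarget C x j ∧
      clockwiseDist C x j ≤ clockwiseDist C x i then j else clockwiseTarget C x i := by
  obtain ⟨h1, h2⟩ := clockwiseDist_spec hA i
  split_ifs with h
  · obtain ⟨h3, h4⟩ := h
    have e : i + ((clockwiseDist C x i - clockwiseDist C x j : ℕ) : ZMod k) = j := by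
      have h5 : i + (clockwiseDist C x i : ZMod k) = j + (clockwiseDist C x j : ZMod k) := by
        rw [← clockwiseTarget_eq, ← clockwiseTarget_eq, h3]
      rw [Nat.cast_sub h4, ← add_sub_assoc, h5, add_sub_cancel_right]
    have : clockwiseDist C y i = clockwiseDist C x i - clockwiseDist C x j := by
      refine clockwiseDist_eq ?_ fun e' he' => ?_
      · rw [e, hy]; exact Or.inr rfl
      · by_contra hc
        rw [not_le, hy] at hc
        rcases hc with hc | hc
        · exact absurd hc (not_lt.2 (h2 e' (by omega)))
        · have := clockwiseDist_add hA i (e := e') (by omega)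
          rw [hc] at this
          omega
    rw [clockwiseTarget_eq, this, e]
  · have : clockwiseDist C y i = clockwiseDist C x i := by
      refine clockwiseDist_eq ?_ fun e' he' => ?_
      · rw [← clockwiseTarget_eq, hy]; exact Or.inl h1
      · by_contra hc
        rw [not_le, hy] at hc
        rcases hc with hc | hc
        · exact absurd hc (not_lt.2 (h2 e' he'))
        · have h5 := clockwiseDist_add hA i he'.le
          have h6 := clockwiseTarget_add hA i he'.le
          rw [hc] at h5 h6
          exact h ⟨h6.symm, by omega⟩
    rw [clockwiseTarget_eq, this, ← clockwiseTarget_eq]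

lemma clockwiseTarget_ne_of_full (hA : ∃ b, x b < C) (hj : C ≤ x j) (i : ZMod k) :
    clockwiseTarget C x i ≠ j := by
  intro h
  have := (clockwiseDist_spec hA i).1
  rw [h] at this
  omega

/-- Making the full bin `j` available cuts its cluster in two: the bins at least as far away as `j`
now end at `j`, the nearer ones still at the old target. -/
lemma cluster_release_card (hA : ∃ b, x b < C) (hj : C ≤ x j)
    (hy : ∀ i, y i < C ↔ x i < C ∨ i = j) :
    (cluster C y j).card = (cluster C x (clockwiseTarget C x j)).card - clockwiseDist C x j ∧
    (cluster C y (clockwiseTarget C x j)).card = clockwiseDist C x j ∧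
    ∀ b, b ≠ j → b ≠ clockwiseTarget C x j → cluster C y b = cluster C x b := by
  have hlt := clockwiseDist_lt_card hA (mem_cluster (i := j).2 rfl)
  set b₀ := clockwiseTarget C x j with hb₀
  have hne : b₀ ≠ j := clockwiseTarget_ne_of_full hA hj j
  have hT := clockwiseTarget_release hA hy
  refine ⟨?_, ?_, ?_⟩
  · have : cluster C y j = (cluster C x b₀).filter
        (fun i => clockwiseDist C x j ≤ clockwiseDist C x i) := by
      ext i
      rw [mem_cluster, Finset.mem_filter, mem_cluster, hT]
      split_ifs with h
      · simpa using h
      · exact ⟨fun h' => absurd h' (clockwiseTarget_ne_of_full hA hj i), fun h' => absurd h' h⟩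
    rw [this, card_filter_cluster hA b₀ (fun d => clockwiseDist C x j ≤ d)]
    have : (Finset.range (cluster C x b₀).card).filter (fun d => clockwiseDist C x j ≤ d)
        = Finset.Ico (clockwiseDist C x j) (cluster C x b₀).card := by
      ext d; simp; omega
    rw [this, Nat.card_Ico]
  · have : cluster C y b₀ = (cluster C x b₀).filter
        (fun i => clockwiseDist C x i < clockwiseDist C x j) := by
      ext i
      rw [mem_cluster, Finset.mem_filter, mem_cluster, hT]
      split_ifs with h
      · exact ⟨fun h' => absurd h'.symm hne, fun h' => absurd h'.2 (not_lt.2 h.2)⟩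
      · exact ⟨fun h' => ⟨h', by by_contra hc; exact h ⟨h', not_lt.1 hc⟩⟩, fun h' => h'.1⟩
    rw [this, card_filter_cluster hA b₀ (fun d => d < clockwiseDist C x j)]
    have : (Finset.range (cluster C x b₀).card).filter (fun d => d < clockwiseDist C x j)
        = Finset.range (clockwiseDist C x j) := by
      ext d; simp; omega
    rw [this, Finset.card_range]
  · intro b hb hb'
    ext i
    rw [mem_cluster, mem_cluster, hT]
    split_ifs with h
    · exact ⟨fun h' => absurd h'.symm hb, fun h' => absurd (h'.symm.trans h.1) hb'⟩
    · rfl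

end Release

lemma sum_univ_eq_sum_cluster {x : Loads k} (hA : ∃ b, x b < C) (g : ZMod k → ℝ) :
    ∑ j, g j = ∑ b ∈ availableBins C x, ∑ j ∈ cluster C x b, g j := by
  symm
  refine Finset.sum_fiberwise_of_maps_to (s := Finset.univ) (t := availableBins C x)
    (g := clockwiseTarget C x) ?_ g
  intro i _
  exact Finset.mem_filter.2 ⟨Finset.mem_univ _, (clockwiseDist_spec hA i).1⟩

lemma mem_availableBins {x : Loads k} {i : ZMod k} : i ∈ availableBins C x ↔ x i < C := by
  simp [availableBins]

end Cluster

/-! ### Removal of the last object and placement laws -/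

/-- Take one object out of bin `j`. -/
def unplace {k : ℕ} (x : Loads k) (j : ZMod k) : Loads k := Function.update x j (x j - 1)

lemma place_unplace {k : ℕ} {x : Loads k} {j : ZMod k} (h : x j ≠ 0) : place (unplace x j) j = x := by
  unfold place unplace
  rw [Function.update_self, Function.update_idem, Nat.sub_add_cancel (Nat.one_le_iff_ne_zero.2 h),
    Function.update_eq_self]

lemma unplace_place {k : ℕ} (x : Loads k) (j : ZMod k) : unplace (place x j) j = x := by
  unfold place unplace
  rw [Function.update_self, Function.update_idem, Nat.add_sub_cancel, Function.update_eq_self]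

lemma place_apply_self {k : ℕ} (x : Loads k) (j : ZMod k) : place x j j = x j + 1 := by simp [place]

lemma place_eq_iff {k : ℕ} {x y : Loads k} {j : ZMod k} : place y j = x ↔ x j ≠ 0 ∧ y = unplace x j := by
  constructor
  · rintro rfl
    exact ⟨by rw [place_apply_self]; omega, (unplace_place y j).symm⟩
  · rintro ⟨h, rfl⟩
    exact place_unplace h

section Laws
variable {k : ℕ} [NeZero k]

lemma sum_unplace {x : Loads k} {j : ZMod k} (h : x j ≠ 0) : ∑ i, unplace x j i + 1 = ∑ i, x i := by
  have h1 := Finset.add_sum_erase Finset.univ x (Finset.mem_univ j)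
  have h2 := Finset.add_sum_erase Finset.univ (unplace x j) (Finset.mem_univ j)
  have h3 : ∑ i ∈ Finset.univ.erase j, unplace x j i = ∑ i ∈ Finset.univ.erase j, x i := by
    apply Finset.sum_congr rfl
    intro i hi
    rw [unplace, Function.update_of_ne (Finset.ne_of_mem_erase hi)]
  have h4 : unplace x j j = x j - 1 := by simp [unplace]
  omega

/-- The weight of a configuration under CH-BL. -/
noncomputable def chblWeight (C : ℕ) (x : Loads k) : ℝ :=
  ∏ b ∈ availableBins C x, overflowWeight C ((cluster C x b).card - 1) (x b)

lemma chblWeight_unplace_available {C : ℕ} {x : Loads k} {b : ZMod k} (hb : x b < C)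
    (h0 : x b ≠ 0) :
    ((cluster C (unplace x b) b).card : ℝ) * chblWeight C (unplace x b)
      = (cluster C x b).card * overflowWeightPred C ((cluster C x b).card - 1) (x b)
        * ∏ c ∈ (availableBins C x).erase b, overflowWeight C ((cluster C x c).card - 1) (x c) := by
  have hav : ∀ i, x i < C ↔ unplace x b i < C := by
    intro i
    by_cases h : i = b
    · subst h; simp [unplace]; omega
    · simp [unplace, h]
  have hcl := fun c => cluster_congr ⟨b, hb⟩ hav c
  have hA : availableBins C (unplace x b) = availableBins C x := by
    ext i; rw [mem_availableBins, mem_availableBins, hav]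
  unfold chblWeight
  rw [hA, ← Finset.mul_prod_erase _ _ (mem_availableBins.2 hb), mul_assoc]
  simp_rw [← hcl]
  congr 2
  · obtain ⟨l, hl⟩ := Nat.exists_eq_succ_of_ne_zero h0
    simp [unplace, hl, overflowWeightPred]
  · apply Finset.prod_congr rfl
    intro c hc
    rw [unplace, Function.update_of_ne (Finset.ne_of_mem_erase hc)]

lemma chblWeight_unplace_full {K : ℕ} {x : Loads k} (hA : ∃ b, x b < K + 1) {j : ZMod k}
    (hj : x j = K + 1) :
    ((cluster (K + 1) (unplace x j) j).card : ℝ) * chblWeight (K + 1) (unplace x j)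
      = ((cluster (K + 1) x (clockwiseTarget (K + 1) x j)).card - clockwiseDist (K + 1) x j : ℕ)
        * overflowWeight (K + 1) ((cluster (K + 1) x (clockwiseTarget (K + 1) x j)).card
            - clockwiseDist (K + 1) x j - 1) K
        * overflowWeight (K + 1) (clockwiseDist (K + 1) x j - 1) (x (clockwiseTarget (K + 1) x j))
        * ∏ c ∈ (availableBins (K + 1) x).erase (clockwiseTarget (K + 1) x j),
            overflowWeight (K + 1) ((cluster (K + 1) x c).card - 1) (x c) := by
  have hav : ∀ i, unplace x j i < K + 1 ↔ x i < K + 1 ∨ i = j := by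
    intro i
    by_cases h : i = j
    · subst h; simp [unplace, hj]
    · simp [unplace, h]
  obtain ⟨h1, h2, h3⟩ := cluster_release_card hA hj.ge hav
  have htgt := (clockwiseDist_spec hA j).1
  set b := clockwiseTarget (K + 1) x j with hb
  have hbj : b ≠ j := clockwiseTarget_ne_of_full hA hj.ge j
  have hAv : availableBins (K + 1) (unplace x j) = insert j (availableBins (K + 1) x) := by
    ext i
    rw [mem_availableBins, Finset.mem_insert, mem_availableBins, hav]
    tauto
  have hjA : j ∉ availableBins (K + 1) x := by rw [mem_availableBins]; omega
  unfold chblWeight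
  rw [hAv, Finset.prod_insert hjA, ← Finset.mul_prod_erase _ _ (mem_availableBins.2 htgt), h1, h2,
    show unplace x j j = K by simp [unplace, hj], show unplace x j b = x b by simp [unplace, hbj]]
  have : ∏ c ∈ (availableBins (K + 1) x).erase b,
        overflowWeight (K + 1) ((cluster (K + 1) (unplace x j) c).card - 1) (unplace x j c)
      = ∏ c ∈ (availableBins (K + 1) x).erase b,
        overflowWeight (K + 1) ((cluster (K + 1) x c).card - 1) (x c) := by
    apply Finset.prod_congr rfl
    intro c hc
    have hcj : c ≠ j := fun h => hjA (h ▸ Finset.mem_of_mem_erase hc)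
    rw [h3 c hcj (Finset.ne_of_mem_erase hc), unplace, Function.update_of_ne hcj]
  rw [this]
  ring

/-- The recursion satisfied by the CH-BL weights. Grouping the possible last positions by cluster
reduces it to `overflowWeight_last_object` in each cluster; a cluster of `r` full bins and the
available bin `b` holds `r * (K + 1) + x b` objects. -/
lemma sum_chblWeight_unplace {K : ℕ} {x : Loads k} (hA : ∃ b, x b < K + 1)
    (hx : ∀ i, x i ≤ K + 1) :
    ∑ j, (if x j = 0 then 0 else
        ((cluster (K + 1) (unplace x j) j).card : ℝ) * chblWeight (K + 1) (unplace x j))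
      = ((∑ i, x i : ℕ) : ℝ) * chblWeight (K + 1) x := by
  have hsum : ((∑ i, x i : ℕ) : ℝ) = ∑ b ∈ availableBins (K + 1) x,
      ((((cluster (K + 1) x b).card - 1) * (K + 1) + x b : ℕ) : ℝ) := by
    push_cast
    rw [sum_univ_eq_sum_cluster hA]
    apply Finset.sum_congr rfl
    intro b hb
    rw [mem_availableBins] at hb
    have hmem := self_mem_cluster hb
    rw [← Finset.add_sum_erase _ _ hmem]
    have : ∑ j ∈ (cluster (K + 1) x b).erase b, (x j : ℝ)
        = ∑ _j ∈ (cluster (K + 1) x b).erase b, ((K + 1 : ℕ) : ℝ) := by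
      apply Finset.sum_congr rfl
      intro j hj
      have h1 := Finset.mem_of_mem_erase hj
      have h2 := Finset.ne_of_mem_erase hj
      have : ¬ x j < K + 1 := by
        intro h
        rw [mem_cluster, clockwiseTarget_of_lt h] at h1
        exact h2 h1
      rw [le_antisymm (hx j) (not_lt.1 this)]
    rw [this, Finset.sum_const, Finset.card_erase_of_mem hmem, nsmul_eq_mul]
    push_cast; ring
  rw [sum_univ_eq_sum_cluster hA, hsum, Finset.sum_mul]
  apply Finset.sum_congr rfl
  intro b hb
  have hb' := mem_availableBins.1 hb
  set P := ∏ c ∈ (availableBins (K + 1) x).erase b,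
    overflowWeight (K + 1) ((cluster (K + 1) x c).card - 1) (x c) with hP
  obtain ⟨r, hr⟩ := Nat.exists_eq_succ_of_ne_zero (cluster_card_pos hb').ne'
  have hW : chblWeight (K + 1) x = overflowWeight (K + 1) r (x b) * P := by
    unfold chblWeight
    rw [← Finset.mul_prod_erase _ _ hb, hr]
    rfl
  -- Within a cluster the term depends only on the distance `d` to the available bin; `d = 0` means
  -- that the last object lies in that bin itself.
  obtain ⟨φ, hφ⟩ : ∃ φ : ℕ → ℝ, φ = fun d => if d = 0 then
      ((r : ℝ) + 1) * overflowWeightPred (K + 1) r (x b) * P else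
      ((r + 1 - d : ℕ) : ℝ) * overflowWeight (K + 1) (r + 1 - d - 1) K
        * overflowWeight (K + 1) (d - 1) (x b) * P := ⟨_, rfl⟩
  have hterm : ∀ j ∈ cluster (K + 1) x b, (if x j = 0 then 0 else
        ((cluster (K + 1) (unplace x j) j).card : ℝ) * chblWeight (K + 1) (unplace x j))
      = φ (clockwiseDist (K + 1) x j) := by
    intro j hj
    rw [hφ]
    dsimp only
    by_cases hjb : x j < K + 1
    · have : j = b := by rw [mem_cluster, clockwiseTarget_of_lt hjb] at hj; exact hj
      subst this
      rw [if_pos ((clockwiseDist_eq_zero_iff hA j).2 hjb)]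
      by_cases h0 : x j = 0
      · rw [if_pos h0, h0]; simp [overflowWeightPred]
      · rw [if_neg h0, chblWeight_unplace_available hjb h0, hr]
        push_cast; rfl
    · have hfull : x j = K + 1 := le_antisymm (hx j) (not_lt.1 hjb)
      rw [if_neg (by omega), if_neg (by rwa [clockwiseDist_eq_zero_iff hA]),
        chblWeight_unplace_full hA hfull, mem_cluster.1 hj, hr]
  rw [Finset.sum_congr rfl hterm, sum_cluster_clockwiseDist hA b, hr, Finset.sum_range_succ', hW]
  simp only [hφ, Nat.succ_eq_add_one, Nat.add_sub_cancel, if_true]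
  have hlast := overflowWeight_last_object K r (x b)
  rw [← mul_assoc, hlast, add_comm]
  conv_rhs => rw [add_mul, Finset.sum_mul]
  congr 1
  rw [← Finset.sum_range_reflect]
  apply Finset.sum_congr rfl
  intro i hi
  have hi := Finset.mem_range.1 hi
  rw [if_neg (by omega), show r + 1 - (r - 1 - i + 1) = i + 1 by omega, Nat.add_sub_cancel]
  push_cast; ring

/-- The laws obtained by placing objects one after the other into bins chosen by `Q`. -/
structure IsPlacementLaw (L : ℕ → PMF (Loads k)) (Q : Loads k → PMF (ZMod k)) : Prop where
  zero : L 0 = PMF.pure 0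
  succ : ∀ n, L (n + 1) = (L n).bind fun x => (Q x).bind fun j => PMF.pure (place x j)

/-- The only possible state before a last placement into `j` is `unplace x j`, and there is none if
bin `j` is empty. -/
lemma IsPlacementLaw.succ_apply {L : ℕ → PMF (Loads k)} {Q : Loads k → PMF (ZMod k)}
    (h : IsPlacementLaw L Q) (n : ℕ) (x : Loads k) :
    (L (n + 1) x).toReal
      = ∑ j, if x j = 0 then 0 else (L n (unplace x j)).toReal * (Q (unplace x j) j).toReal := by
  classical
  have e : L (n + 1) x
      = ∑ j, if x j = 0 then 0 else L n (unplace x j) * Q (unplace x j) j := by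
    rw [h.succ, PMF.bind_apply]
    simp_rw [PMF.bind_apply, PMF.pure_apply, tsum_fintype, Finset.mul_sum]
    rw [Summable.tsum_finsetSum fun _ _ => ENNReal.summable]
    apply Finset.sum_congr rfl
    intro j _
    by_cases h0 : x j = 0
    · rw [if_pos h0, ENNReal.tsum_eq_zero]
      intro y
      rw [if_neg, mul_zero, mul_zero]
      intro hxy
      exact (place_eq_iff.1 hxy.symm).1 h0
    · rw [if_neg h0, tsum_eq_single (unplace x j)]
      · rw [place_unplace h0, if_pos rfl, mul_one]
      · intro y hy
        rw [if_neg, mul_zero, mul_zero]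
        intro hxy
        exact hy (place_eq_iff.1 hxy.symm).2
  rw [e, ENNReal.toReal_sum]
  · apply Finset.sum_congr rfl
    intro j _
    split_ifs
    · simp
    · rw [ENNReal.toReal_mul]
  · intro j _
    split_ifs
    · simp
    · exact ENNReal.mul_ne_top (PMF.apply_ne_top _ _) (PMF.apply_ne_top _ _)

lemma IsPlacementLaw.zero_apply {L : ℕ → PMF (Loads k)} {Q : Loads k → PMF (ZMod k)}
    (h : IsPlacementLaw L Q) (x : Loads k) : (L 0 x).toReal = if x = 0 then 1 else 0 := by
  classical
  rw [h.zero, PMF.pure_apply]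
  split_ifs <;> simp

/-- The bins chosen by CH-BL. -/
noncomputable def chblChoice (C : ℕ) (x : Loads k) : PMF (ZMod k) :=
  (PMF.uniformOfFintype (ZMod k)).bind fun i => PMF.pure (clockwiseTarget C x i)

/-- The bins chosen by RJ-CH. -/
noncomputable def rjchChoice (C : ℕ) (x : Loads k) : PMF (ZMod k) :=
  (PMF.uniformOfFintype (ZMod k)).bind fun i => randomJumpTarget C x i

lemma isPlacementLaw_chbl (C : ℕ) : IsPlacementLaw (chblLaw k C) (chblChoice C) where
  zero := rfl
  succ n := by
    show (chblLaw k C n).bind (chblStep C) = _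
    congr 1
    funext x
    simp [chblStep, chblChoice, PMF.bind_bind, PMF.pure_bind]

lemma isPlacementLaw_rjch (C : ℕ) : IsPlacementLaw (rjchLaw k C) (rjchChoice C) where
  zero := rfl
  succ n := by
    show (rjchLaw k C n).bind (rjchStep C) = _
    congr 1
    funext x
    simp [rjchStep, rjchChoice, PMF.bind_bind]

lemma chblChoice_apply (C : ℕ) (x : Loads k) (j : ZMod k) :
    (chblChoice C x j).toReal = (cluster C x j).card / k := by
  classical
  unfold chblChoice
  rw [PMF.bind_apply, tsum_fintype]
  simp_rw [PMF.uniformOfFintype_apply, ZMod.card]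
  have hsum : ∑ i, PMF.pure (clockwiseTarget C x i) j = ((cluster C x j).card : ENNReal) := by
    rw [cluster, Finset.card_filter, Nat.cast_sum]
    apply Finset.sum_congr rfl
    intro i _
    rw [PMF.pure_apply]
    by_cases h : j = clockwiseTarget C x i
    · rw [if_pos h, if_pos h.symm, Nat.cast_one]
    · rw [if_neg h, if_neg (Ne.symm h), Nat.cast_zero]
  rw [← Finset.mul_sum, hsum, ENNReal.toReal_mul, ENNReal.toReal_inv, ENNReal.toReal_natCast,
    ENNReal.toReal_natCast, div_eq_inv_mul]

/-- With `A` available bins, an available one is hit directly with probability `1 / k` or after a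
jump with probability `(k - A) / k * (1 / A)`, in total `1 / A`. -/
lemma rjchChoice_apply {C : ℕ} {x : Loads k} (hA : ∃ b, x b < C) (j : ZMod k) :
    (rjchChoice C x j).toReal = if x j < C then ((availableBins C x).card : ℝ)⁻¹ else 0 := by
  classical
  have hne : (availableBins C x).Nonempty := by
    obtain ⟨b, hb⟩ := hA
    exact ⟨b, mem_availableBins.2 hb⟩
  have hval : ∀ i, (randomJumpTarget C x i j).toReal = if x i < C then (if i = j then 1 else 0) else
      if x j < C then ((availableBins C x).card : ℝ)⁻¹ else 0 := by
    intro i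
    unfold randomJumpTarget
    by_cases hi : x i < C
    · rw [if_pos hi, if_pos hi, PMF.pure_apply]
      by_cases hij : i = j
      · simp [hij]
      · simp [hij, Ne.symm hij]
    · rw [if_neg hi, if_neg hi, dif_pos hne, PMF.uniformOfFinset_apply]
      by_cases hj : j ∈ availableBins C x
      · rw [if_pos hj, if_pos (mem_availableBins.1 hj)]; simp
      · rw [if_neg hj, if_neg (fun h => hj (mem_availableBins.2 h))]; simp
  unfold rjchChoice
  rw [PMF.bind_apply, tsum_fintype, ENNReal.toReal_sum (fun i _ =>
    ENNReal.mul_ne_top (PMF.apply_ne_top _ _) (PMF.apply_ne_top _ _))]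
  simp_rw [ENNReal.toReal_mul, hval, PMF.uniformOfFintype_apply, ZMod.card, ENNReal.toReal_inv,
    ENNReal.toReal_natCast]
  rw [← Finset.mul_sum, Finset.sum_ite]
  have hk : (k : ℝ) ≠ 0 := by exact_mod_cast NeZero.ne k
  have hcard : ((Finset.univ.filter fun i => ¬ x i < C).card : ℝ) = k - (availableBins C x).card := by
    have := Finset.card_filter_add_card_filter_not (s := (Finset.univ : Finset (ZMod k))) (fun i => x i < C)
    rw [Finset.card_univ, ZMod.card] at this
    rw [eq_sub_iff_add_eq, add_comm]
    exact_mod_cast this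
  rw [Finset.sum_const, nsmul_eq_mul, hcard]
  have hpos : ((availableBins C x).card : ℝ) ≠ 0 := by
    exact_mod_cast (Finset.card_pos.2 hne).ne'
  rw [Finset.sum_ite_eq' (Finset.univ.filter fun i => x i < C)]
  by_cases hj : x j < C
  · simp only [Finset.mem_filter, Finset.mem_univ, hj, and_self, if_true]
    field_simp
    ring
  · simp [hj]

end Laws

lemma unplace_le {k : ℕ} {x : Loads k} {C : ℕ} (hx : ∀ i, x i ≤ C) (j : ZMod k) (i : ZMod k) :
    unplace x j i ≤ C := by
  by_cases h : i = j
  · subst h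
    have := hx i
    simp only [unplace, Function.update_self]; omega
  · rw [unplace, Function.update_of_ne h]; exact hx i

section PlacementLaws
variable {k : ℕ} [NeZero k]

lemma exists_lt_of_sum_lt {C : ℕ} {x : Loads k} (h : ∑ i, x i < k * C) : ∃ b, x b < C := by
  by_contra! hc
  have := Finset.card_nsmul_le_sum Finset.univ x C fun i _ => hc i
  rw [Finset.card_univ, ZMod.card, smul_eq_mul] at this
  exact absurd h (not_lt.2 this)

/-- The rule `Q` never chooses a full bin while another one is available. -/
def AvoidsFull (C : ℕ) (Q : Loads k → PMF (ZMod k)) : Prop :=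
  ∀ y : Loads k, (∃ b, y b < C) → ∀ j, C ≤ y j → (Q y j).toReal = 0

lemma avoidsFull_rjch (C : ℕ) : AvoidsFull C (rjchChoice (k := k) C) := by
  intro y hA j hj
  rw [rjchChoice_apply hA, if_neg (not_lt.2 hj)]

lemma avoidsFull_chbl (C : ℕ) : AvoidsFull C (chblChoice (k := k) C) := by
  intro y hA j hj
  rw [chblChoice_apply]
  have : cluster C y j = ∅ := by
    rw [Finset.eq_empty_iff_forall_notMem]
    intro i hi
    rw [mem_cluster] at hi
    have := (clockwiseDist_spec hA i).1
    rw [hi] at this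
    omega
  rw [this]; simp

variable {C : ℕ} {L : ℕ → PMF (Loads k)} {Q : Loads k → PMF (ZMod k)}

lemma IsPlacementLaw.support (h : IsPlacementLaw L Q) (hQ : AvoidsFull C Q) {n : ℕ}
    (hn : n ≤ k * C) {x : Loads k} (hx : (L n x).toReal ≠ 0) : (∀ i, x i ≤ C) ∧ ∑ i, x i = n := by
  induction n generalizing x with
  | zero =>
    rw [h.zero_apply] at hx
    have : x = 0 := by by_contra h0; exact hx (if_neg h0)
    subst this
    simp
  | succ n ih =>
    rw [h.succ_apply] at hx
    obtain ⟨j, -, hj⟩ := Finset.exists_ne_zero_of_sum_ne_zero hx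
    have h0 : x j ≠ 0 := fun h0 => hj (if_pos h0)
    rw [if_neg h0] at hj
    obtain ⟨h1, h2⟩ := ih (by omega) (left_ne_zero_of_mul hj)
    have h3 : unplace x j j < C := by
      by_contra h3
      exact right_ne_zero_of_mul hj (hQ _ (exists_lt_of_sum_lt (by omega)) j (not_lt.1 h3))
    have h4 := sum_unplace h0
    refine ⟨fun i => ?_, by omega⟩
    by_cases hi : i = j
    · subst hi
      simp only [unplace, Function.update_self] at h3
      omega
    · have := h1 i
      rwa [unplace, Function.update_of_ne hi] at this

lemma IsPlacementLaw.integral_eq (h : IsPlacementLaw L Q) (hQ : AvoidsFull C Q) {n : ℕ}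
    (hn : n ≤ k * C) (g : Loads k → ℝ) :
    ∫ x, g x ∂(L n).toMeasure = ∑ x ∈ loadBox C Finset.univ, (L n x).toReal * g x := by
  have hsupp : ∀ x ∉ loadBox C Finset.univ, L n x = 0 := by
    intro x hx
    by_contra h0
    apply hx
    rw [mem_loadBox]
    refine ⟨(h.support hQ hn (x := x) ?_).1, fun i hi => absurd (Finset.mem_univ i) hi⟩
    exact ENNReal.toReal_ne_zero.2 ⟨h0, PMF.apply_ne_top _ _⟩
  have hint : Integrable g (L n).toMeasure := by
    have hae : ∀ᵐ x ∂(L n).toMeasure, x ∈ loadBox C (Finset.univ : Finset (ZMod k)) := by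
      rw [ae_iff, PMF.toMeasure_apply_eq_zero_iff _ (MeasurableSet.of_discrete)]
      rw [Set.disjoint_left]
      intro x hx hx'
      exact hx (hsupp x hx')
    have hbd : ∃ B, ∀ x ∈ loadBox C (Finset.univ : Finset (ZMod k)), ‖g x‖ ≤ B :=
      ⟨∑ x ∈ loadBox C Finset.univ, ‖g x‖, fun x hx =>
        Finset.single_le_sum (f := fun x => ‖g x‖) (fun _ _ => norm_nonneg _) hx⟩
    obtain ⟨B, hB⟩ := hbd
    exact Integrable.of_bound (Measurable.of_discrete).aestronglyMeasurable B
      (hae.mono fun x hx => hB x hx)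
  rw [PMF.integral_eq_tsum _ _ hint, tsum_eq_sum (s := loadBox C Finset.univ)]
  · rfl
  · intro x hx
    rw [hsupp x hx]; simp

lemma IsPlacementLaw.sum_succ (h : IsPlacementLaw L Q) (hQ : AvoidsFull C Q) {n : ℕ}
    (hn : n < k * C) (g : Loads k → ℝ) :
    ∑ x ∈ loadBox C Finset.univ, (L (n + 1) x).toReal * g x
      = ∑ x ∈ loadBox C Finset.univ, (L n x).toReal * ∑ j, (Q x j).toReal * g (place x j) := by
  simp_rw [h.succ_apply, Finset.sum_mul, Finset.mul_sum]
  rw [Finset.sum_comm, Finset.sum_comm (s := loadBox C Finset.univ)]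
  apply Finset.sum_congr rfl
  intro j _
  symm
  have hmem : ∀ x : Loads k, x ∈ loadBox C Finset.univ ↔ ∀ i, x i ≤ C := fun x => by
    rw [mem_loadBox]; simp
  apply Finset.sum_bij_ne_zero (fun y _ _ => place y j)
  · intro y hy hne
    rw [hmem] at hy ⊢
    have h1 := h.support hQ hn.le (left_ne_zero_of_mul hne)
    have h2 : y j < C := by
      by_contra h3
      exact left_ne_zero_of_mul (right_ne_zero_of_mul hne)
        (hQ _ (exists_lt_of_sum_lt (by omega)) j (not_lt.1 h3))
    intro i
    by_cases hi : i = j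
    · subst hi; rw [place_apply_self]; omega
    · rw [place, Function.update_of_ne hi]; exact hy i
  · intro y _ _ z _ _ hyz
    have := congrArg (fun w => unplace w j) hyz
    simpa only [unplace_place] using this
  · intro x hx hne
    have h0 : x j ≠ 0 := by
      intro h0; apply hne; rw [if_pos h0, zero_mul]
    refine ⟨unplace x j, ?_, ?_, place_unplace h0⟩
    · rw [hmem] at hx ⊢
      exact unplace_le hx j
    · rw [if_neg h0, mul_assoc] at hne
      rwa [place_unplace h0]
  · intro y _ _
    have h0 : place y j j ≠ 0 := by rw [place_apply_self]; omega
    rw [if_neg h0, unplace_place, mul_assoc]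

end PlacementLaws

/-! ### Product formulas for the two laws -/

section Formulas
variable {k : ℕ} [NeZero k]

/-- An available bin is chosen with probability (size of its cluster) `/ k`, so the law obeys the
recursion of `sum_chblWeight_unplace`. The bound on `n` guarantees an available bin. -/
lemma chblLaw_apply (K : ℕ) {n : ℕ} (hn : n < k * (K + 1)) {x : Loads k} (hx : ∀ i, x i ≤ K + 1)
    (hs : ∑ i, x i = n) :
    (chblLaw k (K + 1) n x).toReal = n.factorial / (k : ℝ) ^ n * chblWeight (K + 1) x := by
  induction n generalizing x with
  | zero =>
    have h0 : x = 0 := by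
      funext i
      exact (Finset.sum_eq_zero_iff.1 hs) i (Finset.mem_univ i)
    rw [(isPlacementLaw_chbl (K + 1)).zero_apply, if_pos h0]
    subst h0
    have : chblWeight (K + 1) (0 : Loads k) = 1 := by
      apply Finset.prod_eq_one
      intro b _
      have : cluster (K + 1) (0 : Loads k) b = {b} := by
        ext i
        rw [mem_cluster, clockwiseTarget_of_lt (by simp), Finset.mem_singleton]
      rw [this]
      simp [overflowWeight]
    simp [this]
  | succ n ih =>
    rw [(isPlacementLaw_chbl (K + 1)).succ_apply]
    have hA : ∃ b, x b < K + 1 := exists_lt_of_sum_lt (by omega)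
    have hsum := sum_chblWeight_unplace hA hx
    rw [hs] at hsum
    have hk : (k : ℝ) ≠ 0 := by exact_mod_cast NeZero.ne k
    calc _ = ∑ j, n.factorial / (k : ℝ) ^ (n + 1) * (if x j = 0 then 0 else
        ((cluster (K + 1) (unplace x j) j).card : ℝ) * chblWeight (K + 1) (unplace x j)) := by
          apply Finset.sum_congr rfl
          intro j _
          by_cases h0 : x j = 0
          · rw [if_pos h0, if_pos h0, mul_zero]
          · have := sum_unplace h0
            rw [if_neg h0, if_neg h0, ih (by omega) (unplace_le hx j) (by omega), chblChoice_apply, pow_succ]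
            field_simp
      _ = _ := by
          rw [← Finset.mul_sum, hsum, Nat.factorial_succ]
          push_cast
          field_simp

/-- The weight of a configuration under RJ-CH, apart from a factor depending on the number of
available bins only. -/
noncomputable def rjchWeight (C : ℕ) (x : Loads k) : ℝ :=
  ∏ b ∈ availableBins C x, ((x b).factorial : ℝ)⁻¹

/-- The factor of `rjchWeight` in the law of RJ-CH. -/
noncomputable def rjchCoeff (k K : ℕ) : ℕ → ℕ → ℝ
  | 0, _ => 1
  | n + 1, A => rjchCoeff k K n A / A * (n + 1 - (k - A) * (K + 1))
      + (k - A) * (rjchCoeff k K n (A + 1) / (A + 1)) * (K.factorial : ℝ)⁻¹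

lemma card_fullBins (C : ℕ) (x : Loads k) :
    ((Finset.univ.filter fun i => ¬ x i < C).card : ℝ) = k - (availableBins C x).card := by
  have := Finset.card_filter_add_card_filter_not (s := (Finset.univ : Finset (ZMod k)))
    (fun i => x i < C)
  rw [Finset.card_univ, ZMod.card] at this
  rw [eq_sub_iff_add_eq, add_comm]
  exact_mod_cast this

/-- Undoing a placement into an available bin multiplies the weight by its load; undoing one into a
full bin gives the factor `1 / K!` and one more available bin. The sum over last positions thus
depends on the number of available bins only, which is the recursion of `rjchCoeff`. -/
lemma rjchLaw_apply (K : ℕ) {n : ℕ} {x : Loads k} (hx : ∀ i, x i ≤ K + 1) (hs : ∑ i, x i = n) :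
    (rjchLaw k (K + 1) n x).toReal
      = rjchCoeff k K n (availableBins (K + 1) x).card * rjchWeight (K + 1) x := by
  induction n generalizing x with
  | zero =>
    have h0 : x = 0 := by
      funext i
      exact (Finset.sum_eq_zero_iff.1 hs) i (Finset.mem_univ i)
    rw [(isPlacementLaw_rjch (K + 1)).zero_apply, if_pos h0]
    subst h0
    simp [rjchWeight, rjchCoeff]
  | succ n ih =>
    rw [(isPlacementLaw_rjch (K + 1)).succ_apply]
    set A := (availableBins (K + 1) x).card with hAdef
    have hterm : ∀ j, (if x j = 0 then 0 else (rjchLaw k (K + 1) n (unplace x j)).toReal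
          * (rjchChoice (K + 1) (unplace x j) j).toReal)
        = if x j < K + 1 then rjchCoeff k K n A / A * rjchWeight (K + 1) x * x j else
          rjchCoeff k K n (A + 1) / (A + 1) * (K.factorial : ℝ)⁻¹ * rjchWeight (K + 1) x := by
      intro j
      by_cases h0 : x j = 0
      · rw [if_pos h0, if_pos (by omega), h0]; simp
      have hlt : unplace x j j < K + 1 := by
        have := hx j
        simp only [unplace, Function.update_self]; omega
      have hsum := sum_unplace h0
      rw [if_neg h0, ih (unplace_le hx j) (by omega), rjchChoice_apply ⟨j, hlt⟩, if_pos hlt]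
      by_cases hj : x j < K + 1
      · have hAv : availableBins (K + 1) (unplace x j) = availableBins (K + 1) x := by
          ext i
          rw [mem_availableBins, mem_availableBins]
          by_cases h : i = j
          · subst h; tauto
          · rw [unplace, Function.update_of_ne h]
        rw [if_pos hj, hAv, ← hAdef]
        have : rjchWeight (K + 1) (unplace x j) = rjchWeight (K + 1) x * x j := by
          unfold rjchWeight
          rw [hAv, ← Finset.mul_prod_erase _ _ (mem_availableBins.2 hj),
            ← Finset.mul_prod_erase _ _ (mem_availableBins.2 hj)]
          have h2 : ∏ c ∈ (availableBins (K + 1) x).erase j, ((unplace x j c).factorial : ℝ)⁻¹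
              = ∏ c ∈ (availableBins (K + 1) x).erase j, ((x c).factorial : ℝ)⁻¹ := by
            apply Finset.prod_congr rfl
            intro c hc
            rw [unplace, Function.update_of_ne (Finset.ne_of_mem_erase hc)]
          rw [h2]
          obtain ⟨l, hl⟩ := Nat.exists_eq_succ_of_ne_zero h0
          have h3 : unplace x j j = l := by simp [unplace, hl]
          rw [h3, hl, Nat.factorial_succ]
          have : (l.factorial : ℝ) ≠ 0 := by positivity
          push_cast
          field_simp
        rw [this]
        ring
      · have hjK : x j = K + 1 := le_antisymm (hx j) (not_lt.1 hj)
        have hjA : j ∉ availableBins (K + 1) x := by rw [mem_availableBins]; exact hj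
        have hAv : availableBins (K + 1) (unplace x j) = insert j (availableBins (K + 1) x) := by
          ext i
          rw [Finset.mem_insert, mem_availableBins, mem_availableBins]
          by_cases h : i = j
          · subst h; tauto
          · rw [unplace, Function.update_of_ne h]; tauto
        have h3 : unplace x j j = K := by simp [unplace, hjK]
        have : rjchWeight (K + 1) (unplace x j) = (K.factorial : ℝ)⁻¹ * rjchWeight (K + 1) x := by
          unfold rjchWeight
          rw [hAv, Finset.prod_insert hjA, h3]
          congr 1
          apply Finset.prod_congr rfl
          intro c hc
          rw [unplace, Function.update_of_ne (fun h : c = j => hjA (h ▸ hc))]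
        rw [if_neg hj, hAv, Finset.card_insert_of_notMem hjA, this]
        push_cast
        ring
    rw [Finset.sum_congr rfl fun j _ => hterm j, Finset.sum_ite, Finset.sum_const, nsmul_eq_mul,
      card_fullBins, ← Finset.mul_sum, ← hAdef]
    have havail : ∑ j ∈ Finset.univ.filter (fun j => x j < K + 1), (x j : ℝ)
        = n + 1 - (k - A) * (K + 1) := by
      have h1 := Finset.sum_filter_add_sum_filter_not Finset.univ (fun j => x j < K + 1)
        (fun j => (x j : ℝ))
      have h2 : ∑ j ∈ Finset.univ.filter (fun j => ¬ x j < K + 1), (x j : ℝ)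
          = ∑ j ∈ Finset.univ.filter (fun j => ¬ x j < K + 1), ((K : ℝ) + 1) := by
        apply Finset.sum_congr rfl
        intro j hj
        rw [le_antisymm (hx j) (not_lt.1 (Finset.mem_filter.1 hj).2)]
        push_cast; ring
      rw [h2, Finset.sum_const, nsmul_eq_mul, card_fullBins] at h1
      have h3 : ∑ j, (x j : ℝ) = n + 1 := by exact_mod_cast hs
      rw [h3] at h1
      rw [hAdef]
      linarith
    rw [havail, rjchCoeff]
    ring

end Formulas

/-! ### Symmetric means and the Chebyshev inequality -/

lemma prod_comp_swap {ι : Type*} [DecidableEq ι] {s : Finset ι} {b c : ι} (hb : b ∈ s) (hc : c ∈ s) (hbc : b ≠ c)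
    (ρ : ι → ℕ → ℝ) (x : ι → ℕ) :
    ∏ i ∈ s, ρ i ((x ∘ Equiv.swap b c) i)
      = ρ b (x c) * ρ c (x b) * ∏ i ∈ (s.erase b).erase c, ρ i (x i) := by
  rw [← Finset.mul_prod_erase _ _ hb, ← Finset.mul_prod_erase _ _
    (Finset.mem_erase.2 ⟨hbc.symm, hc⟩), ← mul_assoc]
  simp only [Function.comp_apply, Equiv.swap_apply_left, Equiv.swap_apply_right]
  congr 1
  apply Finset.prod_congr rfl
  intro i hi
  rw [Equiv.swap_apply_of_ne_of_ne (Finset.ne_of_mem_erase (Finset.mem_of_mem_erase hi))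
    (Finset.ne_of_mem_erase hi)]

section Symmetric
variable {ι : Type*} [Fintype ι] [DecidableEq ι] {κ : Type*} [Fintype κ] [DecidableEq κ]

lemma levelSum_empty (K v : ℕ) (G : (ι → ℕ) → ℝ) :
    levelSum K (∅ : Finset ι) v G = if v = 0 then G 0 else 0 := by
  have : loadBox K (∅ : Finset ι) = {0} := by
    ext x
    rw [mem_loadBox, Finset.mem_singleton]
    constructor
    · intro h; funext i; exact h.2 i (Finset.notMem_empty i)
    · rintro rfl; simp
  rw [levelSum, this, Finset.sum_singleton]
  simp [loadWeight, eq_comm]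

lemma levelSum_insert_sum {K : ℕ} {s : Finset ι} {b : ι} (hb : b ∉ s) (v : ℕ) (c : ℝ)
    (f : ℕ → ℝ) :
    levelSum K (insert b s) v (fun x => c + ∑ i ∈ insert b s, f (x i))
      = ∑ l ∈ Finset.Icc (v - K * s.card) (min K v),
        (l.factorial : ℝ)⁻¹ * levelSum K s (v - l) (fun y => (c + f l) + ∑ i ∈ s, f (y i)) := by
  rw [levelSum_insert hb]
  apply Finset.sum_congr rfl
  intro l _
  simp only [sum_insert_update hb, add_assoc]

/-- Level sums of symmetric sums depend on the number of bins only. -/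
lemma levelSum_sum_eq_of_card_eq (K : ℕ) (f : ℕ → ℝ) (s : Finset ι) (t : Finset κ)
    (h : s.card = t.card) (v : ℕ) (c : ℝ) :
    levelSum K s v (fun x => c + ∑ i ∈ s, f (x i))
      = levelSum K t v (fun x => c + ∑ i ∈ t, f (x i)) := by
  induction s using Finset.induction_on generalizing t v c with
  | empty =>
    have : t = ∅ := Finset.card_eq_zero.1 (by rw [← h, Finset.card_empty])
    subst this
    simp [levelSum_empty]
  | insert b s hb ih =>
    have hne : t.Nonempty := Finset.card_pos.1 (by
      rw [← h, Finset.card_insert_of_notMem hb]; omega)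
    obtain ⟨d, hd⟩ := hne
    obtain ⟨t, hdt, rfl⟩ : ∃ t', d ∉ t' ∧ insert d t' = t :=
      ⟨t.erase d, Finset.notMem_erase d t, Finset.insert_erase hd⟩
    have hc : s.card = t.card := by
      rw [Finset.card_insert_of_notMem hb, Finset.card_insert_of_notMem hdt] at h
      omega
    rw [levelSum_insert_sum hb, levelSum_insert_sum hdt, hc]
    exact Finset.sum_congr rfl fun l _ => by rw [ih t hc]

/-- The mean of `∑ i, f (x i)` over `A` exchangeable bins of capacity `K` holding `v` objects. -/
noncomputable def symMean (K A v : ℕ) (f : ℕ → ℝ) : ℝ :=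
  levelMean K (Finset.univ : Finset (Fin A)) v fun x => ∑ i, f (x i)

lemma levelMean_eq_symMean (K : ℕ) (s : Finset ι) (v : ℕ) (f : ℕ → ℝ) :
    levelMean K s v (fun x => ∑ i ∈ s, f (x i)) = symMean K s.card v f := by
  have h : s.card = (Finset.univ : Finset (Fin s.card)).card := by simp
  have h1 := levelSum_sum_eq_of_card_eq K f s _ h v 0
  have h2 := levelSum_sum_eq_of_card_eq K (fun _ => 0) s _ h v 1
  simp only [zero_add, Finset.sum_const_zero, add_zero] at h1 h2
  rw [symMean, levelMean, levelMean, levelMass, levelMass, h1, h2]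

lemma symMean_succ_le {K : ℕ} {f : ℕ → ℝ} (hf : SeqConvexOn 0 (K + 1) f) {A v : ℕ}
    (hv : v ≤ K * (A + 1)) (hvK : K + 1 ≤ v) :
    symMean K (A + 1) v f ≤ f (K + 1) + symMean K A (v - (K + 1)) f := by
  set s : Finset (Fin (A + 1)) := Finset.univ.erase 0 with hs
  have hb : (0 : Fin (A + 1)) ∉ s := Finset.notMem_erase _ _
  have hins : insert 0 s = Finset.univ := Finset.insert_erase (Finset.mem_univ _)
  have hcard : s.card = A := by
    rw [hs, Finset.card_erase_of_mem (Finset.mem_univ _)]; simp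
  have := levelMean_le_add_levelMean hf hb (v := v) (by rw [hins]; simpa using hv) hvK
    (by rw [hcard]; rw [mul_add] at hv; omega)
  rwa [levelMean_eq_symMean, levelMean_eq_symMean, hcard, hins, Finset.card_univ,
    Fintype.card_fin] at this

lemma symMean_bounds (K A v : ℕ) {f : ℕ → ℝ} (h0 : ∀ l, 0 ≤ f l) (h1 : ∀ l, f l ≤ 1) :
    0 ≤ symMean K A v f ∧ symMean K A v f ≤ A := by
  have hmass : 0 ≤ levelMass K (Finset.univ : Finset (Fin A)) v :=
    levelSum_nonneg fun _ _ _ => zero_le_one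
  constructor
  · exact div_nonneg (levelSum_nonneg fun x _ _ => Finset.sum_nonneg fun i _ => h0 _) hmass
  · refine div_le_of_le_mul₀ hmass (Nat.cast_nonneg A) ?_
    rw [← levelSum_const]
    apply levelSum_mono
    intro x _ _
    calc ∑ i, f (x i) ≤ ∑ _i : Fin A, (1 : ℝ) := Finset.sum_le_sum fun i _ => h1 _
      _ = A := by simp

/-- The bins with larger overflow are more likely to be one object short of full. -/
lemma levelSum_overflow_le {C K : ℕ} {s : Finset ι} {b c : ι} (hb : b ∈ s) (hc : c ∈ s)
    {r : ι → ℕ} (hr : r b ≤ r c) (v : ℕ) :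
    levelSum K s v (fun x => (∏ i ∈ s, ((x i).factorial * overflowWeight C (r i) (x i)))
        * if x b = K then 1 else 0)
      ≤ levelSum K s v (fun x => (∏ i ∈ s, ((x i).factorial * overflowWeight C (r i) (x i)))
        * if x c = K then 1 else 0) := by
  by_cases hbc : b = c
  · rw [hbc]
  -- Exchange the loads of `b` and `c` on the left. As `x c = K` is the largest possible load,
  -- likelihood ratio monotonicity compares the two factors.
  rw [← levelSum_comp_swap hb hc]
  apply levelSum_mono
  intro x hx _
  simp only [Function.comp_apply, Equiv.swap_apply_left]
  split_ifs with hxc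
  swap
  · simp
  rw [mul_one, mul_one]
  have e := prod_comp_swap hb hc hbc (fun i l => (l.factorial : ℝ) * overflowWeight C (r i) l) x
  simp only [Function.comp_apply] at e
  rw [e, ← Finset.mul_prod_erase s _ hb, ← Finset.mul_prod_erase _ _
    (Finset.mem_erase.2 ⟨Ne.symm hbc, hc⟩), ← mul_assoc (_ * _) (_ * _) (∏ _ ∈ _, _)]
  apply mul_le_mul_of_nonneg_right
  · have h1 := overflowWeight_ratio_mono C hr (l := x b) (m := x c)
      (by rw [hxc]; exact (mem_loadBox.1 hx).1 b)
    have h2 := mul_le_mul_of_nonneg_left h1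
      (by positivity : (0 : ℝ) ≤ (x c).factorial * (x b).factorial)
    linarith
  · exact Finset.prod_nonneg fun i _ => mul_nonneg (Nat.cast_nonneg _) (overflowWeight_pos _ _ _).le

lemma seqConvexOn_indicator (K : ℕ) : SeqConvexOn 0 K (fun l => if l = K then 1 else 0) := by
  intro l _ hl
  dsimp only
  rw [if_neg (by omega : ¬ l + 1 = K), if_neg (by omega : ¬ l = K)]
  split_ifs <;> norm_num

/-- The CH-BL density is a product of moment sequences, so it does not lower the mean of a convex
sum. -/
lemma levelSum_overflow_symMean {C K : ℕ} {f : ℕ → ℝ} (hf : SeqConvexOn 0 K f) (s : Finset ι)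
    (r : ι → ℕ) (v : ℕ) :
    symMean K s.card v f
        * levelSum K s v (fun x => ∏ i ∈ s, ((x i).factorial * overflowWeight C (r i) (x i)))
      ≤ levelSum K s v (fun x => (∏ i ∈ s, ((x i).factorial * overflowWeight C (r i) (x i)))
        * ∑ i ∈ s, f (x i)) := by
  rcases lt_or_ge (K * s.card) v with hv | hv
  · rw [levelSum_eq_zero hv, levelSum_eq_zero hv, mul_zero]
  have h := levelSum_prod_moment_nonneg hf hv (fun i => isMomentSeq_overflowWeight C (r i))
  rw [levelMean_eq_symMean] at h
  have e : levelSum K s v (fun x => (∏ i ∈ s, ((x i).factorial * overflowWeight C (r i) (x i)))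
        * ((∑ i ∈ s, f (x i)) - symMean K s.card v f))
      = levelSum K s v (fun x => (∏ i ∈ s, ((x i).factorial * overflowWeight C (r i) (x i)))
        * ∑ i ∈ s, f (x i)) + -symMean K s.card v f
        * levelSum K s v (fun x => ∏ i ∈ s, ((x i).factorial * overflowWeight C (r i) (x i))) := by
    rw [← levelSum_mul, ← levelSum_add]
    apply levelSum_congr
    intro x _ _
    ring
  rw [e] at h
  linarith

/-- Conditionally on the set of full bins, CH-BL fills a further bin at least as often as RJ-CH. -/
lemma levelSum_overflow_chebyshev {C K : ℕ} {s : Finset ι} (hs : s.Nonempty) (r : ι → ℕ) (v : ℕ) :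
    (∑ i ∈ s, ((r i : ℝ) + 1)) * (symMean K s.card v (fun l => if l = K then 1 else 0) / s.card)
        * levelSum K s v (fun x => ∏ i ∈ s, ((x i).factorial * overflowWeight C (r i) (x i)))
      ≤ levelSum K s v (fun x => (∏ i ∈ s, ((x i).factorial * overflowWeight C (r i) (x i)))
        * ∑ i ∈ s, if x i = K then (r i : ℝ) + 1 else 0) := by
  set D : (ι → ℕ) → ℝ := fun x => ∏ i ∈ s, ((x i).factorial * overflowWeight C (r i) (x i)) with hD
  set N : ι → ℝ := fun b => levelSum K s v (fun x => D x * if x b = K then 1 else 0) with hN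
  -- Both the cluster size and the weight of the event that the bin holds `K` objects increase with
  -- the overflow count, as Chebyshev's sum inequality requires.
  have hmono : MonovaryOn N (fun i => (r i : ℝ) + 1) s := by
    intro b hb c hc hbc
    have : (r b : ℝ) < r c := by simpa using hbc
    exact levelSum_overflow_le hb hc (by exact_mod_cast this.le) v
  have h1 := hmono.sum_mul_sum_le_card_mul_sum
  have h2 := levelSum_overflow_symMean (C := C) (seqConvexOn_indicator K) s r v
  have e1 : ∑ i ∈ s, N i = levelSum K s v (fun x => D x * ∑ i ∈ s, if x i = K then 1 else 0) := by
    rw [← levelSum_sum]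
    exact levelSum_congr fun x _ _ => by rw [Finset.mul_sum]
  have e2 : ∑ i ∈ s, N i * ((r i : ℝ) + 1)
      = levelSum K s v (fun x => D x * ∑ i ∈ s, if x i = K then (r i : ℝ) + 1 else 0) := by
    simp_rw [mul_comm (N _), hN, ← levelSum_mul]
    rw [← levelSum_sum]
    apply levelSum_congr
    intro x _ _
    rw [Finset.mul_sum]
    apply Finset.sum_congr rfl
    intro i _
    split_ifs <;> ring
  have hcard : (0 : ℝ) < s.card := by exact_mod_cast Finset.card_pos.2 hs
  rw [e2, e1] at h1
  have h3 := mul_le_mul_of_nonneg_right h2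
    (Finset.sum_nonneg fun i _ => by positivity : 0 ≤ ∑ i ∈ s, ((r i : ℝ) + 1))
  refine le_of_mul_le_mul_left ?_ hcard
  calc _ = symMean K s.card v (fun l => if l = K then 1 else 0) * levelSum K s v D
        * ∑ i ∈ s, ((r i : ℝ) + 1) := by field_simp
    _ ≤ _ := h3.trans h1

end Symmetric

/-! ### Conditioning on the set of full bins -/

section Fill
variable {ι : Type*} [Fintype ι] [DecidableEq ι]

/-- The configuration with load `c` on `S` and loads `y` elsewhere. -/
def fillOn (S : Finset ι) (c : ℕ) (y : ι → ℕ) : ι → ℕ := fun i => if i ∈ S then c else y i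

lemma sum_fillOn {K : ℕ} {S : Finset ι} {y : ι → ℕ} (hy : y ∈ loadBox K Sᶜ) (c : ℕ) :
    ∑ i, fillOn S c y i = S.card * c + ∑ i, y i := by
  rw [← Finset.sum_add_sum_compl S, ← sum_eq_sum_of_mem_loadBox hy]
  congr 1
  · rw [Finset.sum_congr rfl fun i hi => show fillOn S c y i = c from if_pos hi, Finset.sum_const,
      smul_eq_mul]
  · exact Finset.sum_congr rfl fun i hi => if_neg (Finset.mem_compl.1 hi)

lemma fillOn_eq_iff {K : ℕ} {S : Finset ι} {y : ι → ℕ} (hy : y ∈ loadBox K Sᶜ) (i : ι) :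
    fillOn S (K + 1) y i = K + 1 ↔ i ∈ S := by
  have := (mem_loadBox.1 hy).1 i
  unfold fillOn
  split_ifs with h
  · simp [h]
  · simp only [h, iff_false]; omega

lemma fillOn_lt_iff {K : ℕ} {S : Finset ι} {y : ι → ℕ} (hy : y ∈ loadBox K Sᶜ) (i : ι) :
    fillOn S (K + 1) y i < K + 1 ↔ i ∈ Sᶜ := by
  have := (mem_loadBox.1 hy).1 i
  unfold fillOn
  split_ifs with h
  · simp [h]
  · simp only [Finset.mem_compl, h, not_false_iff, iff_true]; omega

/-- Decomposition of configurations by the set of full bins. -/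
lemma sum_loadBox_univ_eq (K n : ℕ) (H : (ι → ℕ) → ℝ) :
    (∑ x ∈ loadBox (K + 1) Finset.univ, if ∑ i, x i = n then H x else 0)
      = ∑ S : Finset ι, if S.card * (K + 1) ≤ n then ∑ y ∈ loadBox K Sᶜ,
          if ∑ i, y i = n - S.card * (K + 1) then H (fillOn S (K + 1) y) else 0 else 0 := by
  rw [← Finset.sum_fiberwise (loadBox (K + 1) Finset.univ)
    (fun x => Finset.univ.filter fun i => x i = K + 1)]
  apply Finset.sum_congr rfl
  intro S _
  have key : ∑ x ∈ loadBox (K + 1) Finset.univ with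
        (Finset.univ.filter fun i => x i = K + 1) = S, (if ∑ i, x i = n then H x else 0)
      = ∑ y ∈ loadBox K Sᶜ, if S.card * (K + 1) + ∑ i, y i = n
        then H (fillOn S (K + 1) y) else 0 := by
    symm
    refine Finset.sum_nbij' (fun y => fillOn S (K + 1) y) (fun x i => if i ∈ S then 0 else x i)
      ?_ ?_ ?_ ?_ ?_
    · intro y hy
      rw [Finset.mem_filter]
      refine ⟨?_, ?_⟩
      · rw [mem_loadBox]
        refine ⟨fun i => ?_, fun i hi => absurd (Finset.mem_univ i) hi⟩
        have := (mem_loadBox.1 hy).1 i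
        unfold fillOn
        split_ifs <;> omega
      · ext i
        rw [Finset.mem_filter, fillOn_eq_iff hy]
        simp
    · intro x hx
      rw [Finset.mem_filter] at hx
      obtain ⟨hx1, hx2⟩ := hx
      rw [mem_loadBox]
      refine ⟨fun i => ?_, fun i hi => ?_⟩
      · split_ifs with h
        · omega
        · rw [← hx2, Finset.mem_filter] at h
          have := (mem_loadBox.1 hx1).1 i
          have : x i ≠ K + 1 := fun h' => h ⟨Finset.mem_univ i, h'⟩
          omega
      · rw [Finset.mem_compl, not_not] at hi
        exact if_pos hi
    · intro y hy
      funext i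
      split_ifs with h
      · exact ((mem_loadBox.1 hy).2 i (by simpa using h)).symm
      · exact if_neg h
    · intro x hx
      rw [Finset.mem_filter] at hx
      funext i
      unfold fillOn
      split_ifs with h
      · rw [← hx.2, Finset.mem_filter] at h
        exact h.2.symm
      · exact if_neg h
    · intro y hy
      rw [sum_fillOn hy]
  rw [key]
  split_ifs with hn
  · apply Finset.sum_congr rfl
    intro y _
    congr 1
    rw [eq_iff_iff]
    omega
  · apply Finset.sum_eq_zero
    intro y _
    rw [if_neg (by omega)]

end Fill

section Decomposition
variable {k : ℕ} [NeZero k]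

/-- The number of full bins. -/
def fullCount (C : ℕ) (x : Loads k) : ℕ := (Finset.univ.filter fun i => x i = C).card

/-- The number of full bins whose objects overflow into bin `b` when `S` is the set of full bins. -/
noncomputable def overflowCount (C : ℕ) (S : Finset (ZMod k)) (b : ZMod k) : ℕ :=
  (cluster C (fillOn S C 0) b).card - 1

/-- The density of the loads of the available bins under CH-BL with respect to `loadWeight`. -/
noncomputable def chblDensity (C : ℕ) (S : Finset (ZMod k)) (y : Loads k) : ℝ :=
  ∏ b ∈ Sᶜ, ((y b).factorial * overflowWeight C (overflowCount C S b) (y b))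

variable {K n : ℕ} {S : Finset (ZMod k)} {y : Loads k}

lemma fullCount_fillOn (hy : y ∈ loadBox K Sᶜ) : fullCount (K + 1) (fillOn S (K + 1) y) = S.card := by
  unfold fullCount
  congr 1
  ext i
  rw [Finset.mem_filter, fillOn_eq_iff hy]
  simp

lemma availableBins_fillOn (hy : y ∈ loadBox K Sᶜ) :
    availableBins (K + 1) (fillOn S (K + 1) y) = Sᶜ := by
  ext i
  rw [mem_availableBins, fillOn_lt_iff hy]

lemma zero_mem_loadBox {ι : Type*} [Fintype ι] [DecidableEq ι] (K : ℕ) (s : Finset ι) :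
    (0 : ι → ℕ) ∈ loadBox K s := by
  rw [mem_loadBox]; simp

/-- Clusters depend only on which bins are full, so the remaining loads may be set to zero. -/
lemma cluster_fillOn (hS : Sᶜ.Nonempty) (hy : y ∈ loadBox K Sᶜ) {b : ZMod k} (hb : b ∈ Sᶜ) :
    (cluster (K + 1) (fillOn S (K + 1) y) b).card = overflowCount (K + 1) S b + 1 := by
  obtain ⟨c, hc⟩ := hS
  have h := cluster_congr (C := K + 1) (x := fillOn S (K + 1) y) (y := fillOn S (K + 1) 0)
    ⟨c, (fillOn_lt_iff hy c).2 hc⟩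
    (fun i => by rw [fillOn_lt_iff hy, fillOn_lt_iff (zero_mem_loadBox K Sᶜ)]) b
  have hpos := cluster_card_pos ((fillOn_lt_iff (zero_mem_loadBox K Sᶜ) b).2 hb)
  rw [h, overflowCount]
  omega

lemma loadWeight_eq_prod (hy : y ∈ loadBox K Sᶜ) :
    loadWeight y = ∏ b ∈ Sᶜ, ((y b).factorial : ℝ)⁻¹ := by
  symm
  apply Finset.prod_subset (Finset.subset_univ _)
  intro i _ hi
  rw [(mem_loadBox.1 hy).2 i hi]; simp

lemma chblWeight_fillOn (hS : Sᶜ.Nonempty) (hy : y ∈ loadBox K Sᶜ) :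
    chblWeight (K + 1) (fillOn S (K + 1) y) = loadWeight y * chblDensity (K + 1) S y := by
  rw [chblWeight, availableBins_fillOn hy, loadWeight_eq_prod hy, chblDensity,
    ← Finset.prod_mul_distrib]
  apply Finset.prod_congr rfl
  intro b hb
  have : ((y b).factorial : ℝ) ≠ 0 := by positivity
  rw [cluster_fillOn hS hy hb, Nat.add_sub_cancel,
    show fillOn S (K + 1) y b = y b from if_neg (Finset.mem_compl.1 hb)]
  field_simp

lemma rjchWeight_fillOn (hy : y ∈ loadBox K Sᶜ) :
    rjchWeight (K + 1) (fillOn S (K + 1) y) = loadWeight y := by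
  rw [rjchWeight, availableBins_fillOn hy, loadWeight_eq_prod hy]
  apply Finset.prod_congr rfl
  intro b hb
  rw [show fillOn S (K + 1) y b = y b from if_neg (Finset.mem_compl.1 hb)]

lemma fillOn_le (hy : y ∈ loadBox K Sᶜ) (i : ZMod k) : fillOn S (K + 1) y i ≤ K + 1 := by
  have := (mem_loadBox.1 hy).1 i
  unfold fillOn
  split_ifs <;> omega

lemma compl_nonempty_of_card_mul_le (hn : n < k * (K + 1)) (hS : S.card * (K + 1) ≤ n) :
    Sᶜ.Nonempty := by
  rw [← Finset.card_pos, Finset.card_compl, ZMod.card]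
  have := lt_of_mul_lt_mul_right (hS.trans_lt hn) (Nat.zero_le _)
  omega

lemma IsPlacementLaw.sum_eq_sum_ite {C : ℕ} {L : ℕ → PMF (Loads k)} {Q : Loads k → PMF (ZMod k)}
    (h : IsPlacementLaw L Q) (hQ : AvoidsFull C Q) (hn : n ≤ k * C) (g : Loads k → ℝ) :
    ∑ x ∈ loadBox C Finset.univ, (L n x).toReal * g x
      = ∑ x ∈ loadBox C Finset.univ, if ∑ i, x i = n then (L n x).toReal * g x else 0 := by
  apply Finset.sum_congr rfl
  intro x _
  split_ifs with hx
  · rfl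
  · by_contra hne
    exact hx (h.support hQ hn (left_ne_zero_of_mul hne)).2

lemma chblLaw_sum_eq (hn : n < k * (K + 1)) (g : Loads k → ℝ) :
    ∑ x ∈ loadBox (K + 1) Finset.univ, (chblLaw k (K + 1) n x).toReal * g x
      = ∑ S : Finset (ZMod k), if S.card * (K + 1) ≤ n then n.factorial / (k : ℝ) ^ n
        * levelSum K Sᶜ (n - S.card * (K + 1))
          (fun y => chblDensity (K + 1) S y * g (fillOn S (K + 1) y)) else 0 := by
  rw [(isPlacementLaw_chbl _).sum_eq_sum_ite (avoidsFull_chbl _) hn.le, sum_loadBox_univ_eq]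
  apply Finset.sum_congr rfl
  intro S _
  split_ifs with hS
  · rw [levelSum, Finset.mul_sum]
    apply Finset.sum_congr rfl
    intro y hy
    split_ifs with hv
    · rw [chblLaw_apply K hn (fillOn_le hy) (by rw [sum_fillOn hy]; omega),
        chblWeight_fillOn (compl_nonempty_of_card_mul_le hn hS) hy]
      ring
    · simp
  · rfl

lemma rjchLaw_sum_eq (hn : n < k * (K + 1)) (g : Loads k → ℝ) :
    ∑ x ∈ loadBox (K + 1) Finset.univ, (rjchLaw k (K + 1) n x).toReal * g x
      = ∑ S : Finset (ZMod k), if S.card * (K + 1) ≤ n then rjchCoeff k K n Sᶜ.card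
        * levelSum K Sᶜ (n - S.card * (K + 1)) (fun y => g (fillOn S (K + 1) y)) else 0 := by
  rw [(isPlacementLaw_rjch _).sum_eq_sum_ite (avoidsFull_rjch _) hn.le, sum_loadBox_univ_eq]
  apply Finset.sum_congr rfl
  intro S _
  split_ifs with hS
  · rw [levelSum, Finset.mul_sum]
    apply Finset.sum_congr rfl
    intro y hy
    split_ifs with hv
    · rw [rjchLaw_apply K (fillOn_le hy) (by rw [sum_fillOn hy]; omega),
        rjchWeight_fillOn hy, availableBins_fillOn hy]
      ring
    · simp
  · rfl

/-- It suffices to compare conditionally on each set `S` of full bins. -/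
lemma chblLaw_sum_fullCount_le (hn : n < k * (K + 1)) {g : Loads k → ℝ} {h : ℕ → ℝ}
    (H : ∀ S : Finset (ZMod k), S.card * (K + 1) ≤ n →
      h S.card * levelSum K Sᶜ (n - S.card * (K + 1)) (chblDensity (K + 1) S)
        ≤ levelSum K Sᶜ (n - S.card * (K + 1))
          (fun y => chblDensity (K + 1) S y * g (fillOn S (K + 1) y))) :
    ∑ x ∈ loadBox (K + 1) Finset.univ, (chblLaw k (K + 1) n x).toReal * h (fullCount (K + 1) x)
      ≤ ∑ x ∈ loadBox (K + 1) Finset.univ, (chblLaw k (K + 1) n x).toReal * g x := by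
  rw [chblLaw_sum_eq hn, chblLaw_sum_eq hn]
  apply Finset.sum_le_sum
  intro S _
  split_ifs with hS
  · apply mul_le_mul_of_nonneg_left _ (by positivity)
    refine le_of_eq_of_le ?_ (H S hS)
    rw [← levelSum_mul]
    apply levelSum_congr
    intro y hy _
    rw [fullCount_fillOn hy, mul_comm]
  · exact le_rfl

lemma rjchLaw_sum_fullCount_eq (hn : n < k * (K + 1)) {g : Loads k → ℝ} {h : ℕ → ℝ}
    (H : ∀ S : Finset (ZMod k), S.card * (K + 1) ≤ n →
      h S.card * levelMass K Sᶜ (n - S.card * (K + 1))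
        = levelSum K Sᶜ (n - S.card * (K + 1)) (fun y => g (fillOn S (K + 1) y))) :
    ∑ x ∈ loadBox (K + 1) Finset.univ, (rjchLaw k (K + 1) n x).toReal * h (fullCount (K + 1) x)
      = ∑ x ∈ loadBox (K + 1) Finset.univ, (rjchLaw k (K + 1) n x).toReal * g x := by
  rw [rjchLaw_sum_eq hn, rjchLaw_sum_eq hn]
  apply Finset.sum_congr rfl
  intro S _
  split_ifs with hS
  · rw [← H S hS, ← levelSum_const]
    congr 1
    apply levelSum_congr
    intro y hy _
    rw [fullCount_fillOn hy]
  · rfl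

lemma levelSum_sum_eq_symMean {ι : Type*} [Fintype ι] [DecidableEq ι] (K : ℕ) (s : Finset ι)
    (v : ℕ) (f : ℕ → ℝ) :
    levelSum K s v (fun x => ∑ i ∈ s, f (x i)) = symMean K s.card v f * levelMass K s v := by
  rcases lt_or_ge (K * s.card) v with hv | hv
  · rw [levelSum_eq_zero hv, levelMass, levelSum_eq_zero hv, mul_zero]
  · rw [← levelMean_eq_symMean, levelMean, div_mul_cancel₀ _ (levelMass_pos hv).ne']

end Decomposition

/-! ### Stochastic comparison of the numbers of full bins -/

section Step
variable {k : ℕ} [NeZero k]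

lemma fullCount_place {K : ℕ} {x : Loads k} {j : ZMod k} (hj : x j < K + 1) :
    fullCount (K + 1) (place x j) = fullCount (K + 1) x + if x j = K then 1 else 0 := by
  unfold fullCount
  split_ifs with h
  · have : (Finset.univ.filter fun i => place x j i = K + 1)
        = insert j (Finset.univ.filter fun i => x i = K + 1) := by
      ext i
      rw [Finset.mem_insert, Finset.mem_filter, Finset.mem_filter]
      by_cases hi : i = j
      · subst hi; simp [place_apply_self, h]
      · simp [place, hi]
    rw [this, Finset.card_insert_of_notMem (by simp; omega)]
  · rw [add_zero]
    congr 1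
    ext i
    rw [Finset.mem_filter, Finset.mem_filter]
    by_cases hi : i = j
    · subst hi; simp [place_apply_self, h]; omega
    · simp [place, hi]

/-- The number of full bins rises, by one, exactly when the chosen bin holds `K` objects. -/
lemma IsPlacementLaw.sum_succ_fullCount {K : ℕ} {L : ℕ → PMF (Loads k)}
    {Q : Loads k → PMF (ZMod k)} (h : IsPlacementLaw L Q) (hQ : AvoidsFull (K + 1) Q) {n : ℕ}
    (hn : n < k * (K + 1)) (φ : ℕ → ℝ) :
    ∑ x ∈ loadBox (K + 1) Finset.univ, (L (n + 1) x).toReal * φ (fullCount (K + 1) x)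
      = ∑ x ∈ loadBox (K + 1) Finset.univ, (L n x).toReal * (φ (fullCount (K + 1) x)
        + (φ (fullCount (K + 1) x + 1) - φ (fullCount (K + 1) x))
          * ∑ j, if x j = K then (Q x j).toReal else 0) := by
  rw [h.sum_succ hQ hn]
  apply Finset.sum_congr rfl
  intro x _
  by_cases h0 : (L n x).toReal = 0
  · rw [h0, zero_mul, zero_mul]
  congr 1
  have hA := exists_lt_of_sum_lt ((h.support hQ hn.le h0).2.trans_lt hn)
  have h1 : ∑ j, (Q x j).toReal = 1 := by
    have := PMF.tsum_coe (Q x)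
    rw [tsum_fintype] at this
    rw [← ENNReal.toReal_sum fun j _ => PMF.apply_ne_top _ _, this, ENNReal.toReal_one]
  have hterm : ∀ j, (Q x j).toReal * φ (fullCount (K + 1) (place x j))
      = (Q x j).toReal * φ (fullCount (K + 1) x)
        + (φ (fullCount (K + 1) x + 1) - φ (fullCount (K + 1) x))
          * if x j = K then (Q x j).toReal else 0 := by
    intro j
    by_cases hj : x j < K + 1
    · rw [fullCount_place hj]
      split_ifs
      · ring
      · rw [add_zero]; ring
    · rw [hQ x hA j (not_lt.1 hj)]
      simp
  rw [Finset.sum_congr rfl fun j _ => hterm j, Finset.sum_add_distrib, ← Finset.sum_mul, h1,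
    one_mul, ← Finset.mul_sum]

end Step

section Comparison
variable {k : ℕ} [NeZero k]

/-- The conditional probability that the next object fills a bin under RJ-CH, given that `F` of the
`k` bins are full. -/
noncomputable def fillProb (k K n F : ℕ) : ℝ :=
  symMean K (k - F) (n - F * (K + 1)) (fun l => if l = K then 1 else 0) / (k - F : ℕ)

lemma fillProb_nonneg (k K n F : ℕ) : 0 ≤ fillProb k K n F :=
  div_nonneg (symMean_bounds _ _ _ (fun l => by split_ifs <;> norm_num)
    (fun l => by split_ifs <;> norm_num)).1 (Nat.cast_nonneg _)

lemma fillProb_le_one (k K n F : ℕ) : fillProb k K n F ≤ 1 :=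
  div_le_one_of_le₀ (symMean_bounds _ _ _ (fun l => by split_ifs <;> norm_num)
    (fun l => by split_ifs <;> norm_num)).2 (Nat.cast_nonneg _)

/-- A chain that moves from `F` to `F` or `F + 1` is stochastically monotone: from `F` it never
passes `F + 1`, and from `F + 1` it never falls below it. -/
lemma monotone_interpolate {φ w : ℕ → ℝ} (hφ : Monotone φ) (h0 : ∀ F, 0 ≤ w F)
    (h1 : ∀ F, w F ≤ 1) : Monotone fun F => φ F + (φ (F + 1) - φ F) * w F := by
  apply monotone_nat_of_le_succ
  intro F
  have a := sub_nonneg.2 (hφ (Nat.le_succ F))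
  have b := sub_nonneg.2 (hφ (Nat.le_succ (F + 1)))
  have c := mul_nonneg a (sub_nonneg.2 (h1 F))
  have d := mul_nonneg b (h0 (F + 1))
  simp only [Nat.succ_eq_add_one] at a b c d
  linarith

lemma sum_fillOn_eq (S : Finset (ZMod k)) (K : ℕ) (y : Loads k) (q : ZMod k → ℝ) :
    (∑ j, if fillOn S (K + 1) y j = K then q j else 0) = ∑ j ∈ Sᶜ, if y j = K then q j else 0 := by
  rw [← Finset.sum_add_sum_compl S, Finset.sum_eq_zero, zero_add]
  · apply Finset.sum_congr rfl
    intro j hj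
    rw [show fillOn S (K + 1) y j = y j from if_neg (Finset.mem_compl.1 hj)]
  · intro j hj
    rw [if_neg]
    rw [show fillOn S (K + 1) y j = K + 1 from if_pos hj]
    omega

lemma sum_overflowCount (K : ℕ) {S : Finset (ZMod k)} (hS : Sᶜ.Nonempty) :
    ∑ b ∈ Sᶜ, ((overflowCount (K + 1) S b : ℝ) + 1) = k := by
  have h0 := zero_mem_loadBox K Sᶜ
  have hA : ∃ b, fillOn S (K + 1) 0 b < K + 1 := by
    obtain ⟨b, hb⟩ := hS
    exact ⟨b, (fillOn_lt_iff h0 b).2 hb⟩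
  have := sum_univ_eq_sum_cluster hA (fun _ => (1 : ℝ))
  rw [availableBins_fillOn h0, Finset.sum_const, Finset.card_univ, ZMod.card, nsmul_eq_mul,
    mul_one] at this
  rw [this]
  apply Finset.sum_congr rfl
  intro b hb
  rw [Finset.sum_const, cluster_fillOn hS h0 hb, nsmul_eq_mul, mul_one]
  push_cast; rfl

/-- Given `S`, bin `b` is chosen with probability `(r_b + 1) / k`, and by the Chebyshev inequality
the chance to fill a further bin is at least `fillProb`. Under RJ-CH it is equal to it. -/
lemma chblLaw_sum_interpolate_le {K n : ℕ} (hn : n < k * (K + 1)) {φ : ℕ → ℝ} (hφ : Monotone φ) :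
    ∑ x ∈ loadBox (K + 1) Finset.univ, (chblLaw k (K + 1) n x).toReal
        * (φ (fullCount (K + 1) x) + (φ (fullCount (K + 1) x + 1) - φ (fullCount (K + 1) x))
          * fillProb k K n (fullCount (K + 1) x))
      ≤ ∑ x ∈ loadBox (K + 1) Finset.univ,
        (chblLaw k (K + 1) (n + 1) x).toReal * φ (fullCount (K + 1) x) := by
  rw [(isPlacementLaw_chbl _).sum_succ_fullCount (avoidsFull_chbl _) hn]
  apply chblLaw_sum_fullCount_le hn
    (h := fun F => φ F + (φ (F + 1) - φ F) * fillProb k K n F)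
  intro S hS
  have hne := compl_nonempty_of_card_mul_le hn hS
  have hk : (0 : ℝ) < k := by exact_mod_cast NeZero.pos k
  have hcheb := levelSum_overflow_chebyshev (C := K + 1) (K := K) hne (overflowCount (K + 1) S)
    (n - S.card * (K + 1))
  rw [sum_overflowCount K hne, Finset.card_compl, ZMod.card] at hcheb
  have hΔ := sub_nonneg.2 (hφ (Nat.le_succ S.card))
  rw [Nat.succ_eq_add_one] at hΔ
  set v := n - S.card * (K + 1) with hv
  have e : levelSum K Sᶜ v (fun y => chblDensity (K + 1) S y
        * (φ (fullCount (K + 1) (fillOn S (K + 1) y))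
          + (φ (fullCount (K + 1) (fillOn S (K + 1) y) + 1)
            - φ (fullCount (K + 1) (fillOn S (K + 1) y)))
          * ∑ j, if fillOn S (K + 1) y j = K
            then (chblChoice (K + 1) (fillOn S (K + 1) y) j).toReal else 0))
      = φ S.card * levelSum K Sᶜ v (chblDensity (K + 1) S)
        + ((φ (S.card + 1) - φ S.card) * (k : ℝ)⁻¹) * levelSum K Sᶜ v (fun y =>
          chblDensity (K + 1) S y
            * ∑ i ∈ Sᶜ, if y i = K then (overflowCount (K + 1) S i : ℝ) + 1 else 0) := by
    rw [← levelSum_mul, ← levelSum_mul, ← levelSum_add]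
    apply levelSum_congr
    intro y hy _
    have : ∑ i ∈ Sᶜ, (if y i = K then (chblChoice (K + 1) (fillOn S (K + 1) y) i).toReal else 0)
        = (k : ℝ)⁻¹ * ∑ i ∈ Sᶜ, if y i = K then (overflowCount (K + 1) S i : ℝ) + 1 else 0 := by
      rw [Finset.mul_sum]
      apply Finset.sum_congr rfl
      intro i hi
      rw [chblChoice_apply, cluster_fillOn hne hy hi]
      split_ifs
      · push_cast; ring
      · simp
    rw [fullCount_fillOn hy, sum_fillOn_eq, this]
    ring
  rw [e]
  have h2 := mul_le_mul_of_nonneg_left hcheb (mul_nonneg hΔ (inv_nonneg.2 hk.le))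
  refine le_trans (le_of_eq ?_) (add_le_add_right h2 _)
  unfold fillProb
  rw [← hv, show (fun x : Loads k => ∏ i ∈ Sᶜ, ((x i).factorial : ℝ)
    * overflowWeight (K + 1) (overflowCount (K + 1) S i) (x i)) = chblDensity (K + 1) S from rfl]
  field_simp

lemma rjchLaw_sum_interpolate_eq {K n : ℕ} (hn : n < k * (K + 1)) (φ : ℕ → ℝ) :
    ∑ x ∈ loadBox (K + 1) Finset.univ, (rjchLaw k (K + 1) n x).toReal
        * (φ (fullCount (K + 1) x) + (φ (fullCount (K + 1) x + 1) - φ (fullCount (K + 1) x))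
          * fillProb k K n (fullCount (K + 1) x))
      = ∑ x ∈ loadBox (K + 1) Finset.univ,
        (rjchLaw k (K + 1) (n + 1) x).toReal * φ (fullCount (K + 1) x) := by
  rw [(isPlacementLaw_rjch _).sum_succ_fullCount (avoidsFull_rjch _) hn]
  apply rjchLaw_sum_fullCount_eq hn
    (h := fun F => φ F + (φ (F + 1) - φ F) * fillProb k K n F)
  intro S hS
  have hne := compl_nonempty_of_card_mul_le hn hS
  set v := n - S.card * (K + 1) with hv
  have hm := levelSum_sum_eq_symMean K Sᶜ v (fun l => if l = K then 1 else 0)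
  rw [Finset.card_compl, ZMod.card] at hm
  have e : levelSum K Sᶜ v (fun y => φ (fullCount (K + 1) (fillOn S (K + 1) y))
          + (φ (fullCount (K + 1) (fillOn S (K + 1) y) + 1)
            - φ (fullCount (K + 1) (fillOn S (K + 1) y)))
          * ∑ j, if fillOn S (K + 1) y j = K
            then (rjchChoice (K + 1) (fillOn S (K + 1) y) j).toReal else 0)
      = φ S.card * levelMass K Sᶜ v
        + ((φ (S.card + 1) - φ S.card) * ((k - S.card : ℕ) : ℝ)⁻¹) * levelSum K Sᶜ v (fun y =>
            ∑ i ∈ Sᶜ, if y i = K then 1 else 0) := by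
    rw [← levelSum_mul, ← levelSum_const, ← levelSum_add]
    apply levelSum_congr
    intro y hy _
    have : ∑ i ∈ Sᶜ, (if y i = K then (rjchChoice (K + 1) (fillOn S (K + 1) y) i).toReal else 0)
        = ((k - S.card : ℕ) : ℝ)⁻¹ * ∑ i ∈ Sᶜ, if y i = K then 1 else 0 := by
      rw [Finset.mul_sum]
      apply Finset.sum_congr rfl
      intro i hi
      rw [rjchChoice_apply ⟨i, (fillOn_lt_iff hy i).2 hi⟩, if_pos ((fillOn_lt_iff hy i).2 hi),
        availableBins_fillOn hy, Finset.card_compl, ZMod.card]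
      split_ifs
      · ring
      · simp
    rw [fullCount_fillOn hy, sum_fillOn_eq, this]
    ring
  rw [e, hm]
  unfold fillProb
  rw [← hv]
  ring

/-- CH-BL has stochastically more full bins than RJ-CH. -/
theorem rjchLaw_sum_fullCount_le_chblLaw {K n : ℕ} (hn : n ≤ k * (K + 1)) {φ : ℕ → ℝ}
    (hφ : Monotone φ) :
    ∑ x ∈ loadBox (K + 1) Finset.univ, (rjchLaw k (K + 1) n x).toReal * φ (fullCount (K + 1) x)
      ≤ ∑ x ∈ loadBox (K + 1) Finset.univ,
        (chblLaw k (K + 1) n x).toReal * φ (fullCount (K + 1) x) := by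
  induction n generalizing φ with
  | zero => exact le_rfl
  | succ n ih =>
    rw [← rjchLaw_sum_interpolate_eq hn]
    exact le_trans (ih (Nat.le_of_succ_le hn) (monotone_interpolate hφ (fillProb_nonneg k K n)
      (fillProb_le_one k K n))) (chblLaw_sum_interpolate_le hn hφ)

end Comparison

/-! ### Means given the number of full bins -/

/-- The mean of `∑ i, f (x i)` under RJ-CH given that `F` of the `k` bins are full. -/
noncomputable def fullMean (k K n : ℕ) (f : ℕ → ℝ) (F : ℕ) : ℝ :=
  F * f (K + 1) + symMean K (k - F) (n - F * (K + 1)) f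

/-- The number `F` moved into the range of the possible numbers of full bins. -/
def clampFull (k K n F : ℕ) : ℕ := max (n - k * K) (min F (n / (K + 1)))

/-- Between feasible values of `F` this is `symMean_succ_le`. Feasible means that `F` full bins use
at most `n` objects and that the others fit below capacity, i.e. `n - k * K ≤ F`; the clamp is
constant elsewhere. -/
lemma monotone_fullMean_clampFull {k K n : ℕ} (hn : n < k * (K + 1)) {f : ℕ → ℝ}
    (hf : SeqConvexOn 0 (K + 1) f) : Monotone fun F => fullMean k K n f (clampFull k K n F) := by
  apply monotone_nat_of_le_succ
  intro F
  by_cases h : n - k * K ≤ F ∧ F + 1 ≤ n / (K + 1)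
  · obtain ⟨h1, h2⟩ := h
    have e1 : clampFull k K n F = F := by unfold clampFull; omega
    have e2 : clampFull k K n (F + 1) = F + 1 := by unfold clampFull; omega
    rw [e1, e2]
    have h3 : (F + 1) * (K + 1) ≤ n := (Nat.le_div_iff_mul_le (Nat.succ_pos K)).1 h2
    have h4 : F + 1 < k := lt_of_mul_lt_mul_right (h3.trans_lt hn) (Nat.zero_le _)
    have h5 : (F + 1) * (K + 1) = F * (K + 1) + (K + 1) := by ring
    obtain ⟨A, hA⟩ : ∃ A, k = A + 1 + F := ⟨k - (F + 1), by omega⟩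
    have h6 : k * K = K * (A + 1) + F * K := by rw [hA]; ring
    have h7 : F * (K + 1) = F * K + F := by ring
    have := symMean_succ_le hf (A := A) (v := n - F * (K + 1)) (by omega) (by omega)
    unfold fullMean
    rw [show k - F = A + 1 by omega, show k - (F + 1) = A by omega, h5, ← Nat.sub_sub]
    push_cast
    linarith
  · have : clampFull k K n (F + 1) = clampFull k K n F := by unfold clampFull; omega
    rw [this]

section Means
variable {k : ℕ} [NeZero k]

lemma clampFull_card {K n : ℕ} {S : Finset (ZMod k)} (hS : S.card * (K + 1) ≤ n)
    (hv : n - S.card * (K + 1) ≤ K * Sᶜ.card) : clampFull k K n S.card = S.card := by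
  have h1 : S.card ≤ n / (K + 1) := (Nat.le_div_iff_mul_le (Nat.succ_pos K)).2 hS
  have h2 : S.card ≤ k := by
    have := S.card_le_univ
    rwa [ZMod.card] at this
  rw [Finset.card_compl, ZMod.card] at hv
  obtain ⟨A, hA⟩ := Nat.exists_eq_add_of_le h2
  have h3 : k * K = S.card * K + K * A := by nlinarith
  have h4 : S.card * (K + 1) = S.card * K + S.card := by ring
  rw [show k - S.card = A by omega] at hv
  unfold clampFull
  omega

lemma sum_fillOn_apply (S : Finset (ZMod k)) (c : ℕ) (y : Loads k) (f : ℕ → ℝ) :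
    ∑ i, f (fillOn S c y i) = S.card * f c + ∑ i ∈ Sᶜ, f (y i) := by
  rw [← Finset.sum_add_sum_compl S]
  congr 1
  · rw [Finset.sum_congr rfl fun i hi => by
      rw [show fillOn S c y i = c from if_pos hi], Finset.sum_const, nsmul_eq_mul]
  · exact Finset.sum_congr rfl fun i hi => by
      rw [show fillOn S c y i = y i from if_neg (Finset.mem_compl.1 hi)]

lemma chblLaw_sum_fullMean_le {K n : ℕ} (hn : n < k * (K + 1)) {f : ℕ → ℝ}
    (hf : SeqConvexOn 0 (K + 1) f) :
    ∑ x ∈ loadBox (K + 1) Finset.univ, (chblLaw k (K + 1) n x).toReal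
        * fullMean k K n f (clampFull k K n (fullCount (K + 1) x))
      ≤ ∑ x ∈ loadBox (K + 1) Finset.univ,
        (chblLaw k (K + 1) n x).toReal * ∑ i, f (x i) := by
  apply chblLaw_sum_fullCount_le hn (h := fun F => fullMean k K n f (clampFull k K n F))
  intro S hS
  rcases lt_or_ge (K * Sᶜ.card) (n - S.card * (K + 1)) with hv | hv
  · rw [levelSum_eq_zero hv, levelSum_eq_zero hv, mul_zero]
  rw [clampFull_card hS hv]
  have h := levelSum_overflow_symMean (C := K + 1) (hf.mono le_rfl (Nat.le_succ K)) Sᶜ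
    (overflowCount (K + 1) S) (n - S.card * (K + 1))
  rw [Finset.card_compl, ZMod.card] at h
  have e : levelSum K Sᶜ (n - S.card * (K + 1))
        (fun y => chblDensity (K + 1) S y * ∑ i, f (fillOn S (K + 1) y i))
      = S.card * f (K + 1) * levelSum K Sᶜ (n - S.card * (K + 1)) (chblDensity (K + 1) S)
        + levelSum K Sᶜ (n - S.card * (K + 1))
          (fun y => chblDensity (K + 1) S y * ∑ i ∈ Sᶜ, f (y i)) := by
    rw [← levelSum_mul, ← levelSum_add]
    apply levelSum_congr
    intro y _ _
    rw [sum_fillOn_apply]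
    ring
  rw [e, fullMean, add_mul]
  exact add_le_add_right h _

lemma rjchLaw_sum_fullMean_eq {K n : ℕ} (hn : n < k * (K + 1)) (f : ℕ → ℝ) :
    ∑ x ∈ loadBox (K + 1) Finset.univ, (rjchLaw k (K + 1) n x).toReal
        * fullMean k K n f (clampFull k K n (fullCount (K + 1) x))
      = ∑ x ∈ loadBox (K + 1) Finset.univ,
        (rjchLaw k (K + 1) n x).toReal * ∑ i, f (x i) := by
  apply rjchLaw_sum_fullCount_eq hn (h := fun F => fullMean k K n f (clampFull k K n F))
  intro S hS
  rcases lt_or_ge (K * Sᶜ.card) (n - S.card * (K + 1)) with hv | hv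
  · rw [levelMass, levelSum_eq_zero hv, levelSum_eq_zero hv, mul_zero]
  rw [clampFull_card hS hv]
  simp_rw [sum_fillOn_apply]
  rw [levelSum_add, levelSum_const, levelSum_sum_eq_symMean, Finset.card_compl, ZMod.card,
    fullMean, add_mul]

/-- Given the number of full bins, the mean of the sum is `fullMean` under RJ-CH and at least that
under CH-BL; `fullMean` increases in this number, which is stochastically larger under CH-BL. -/
theorem rjchLaw_sum_le_chblLaw_sum {K n : ℕ} (hn : n < k * (K + 1)) {f : ℕ → ℝ}
    (hf : SeqConvexOn 0 (K + 1) f) :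
    ∑ x ∈ loadBox (K + 1) Finset.univ, (rjchLaw k (K + 1) n x).toReal * ∑ i, f (x i)
      ≤ ∑ x ∈ loadBox (K + 1) Finset.univ, (chblLaw k (K + 1) n x).toReal * ∑ i, f (x i) := by
  rw [← rjchLaw_sum_fullMean_eq hn f]
  exact (rjchLaw_sum_fullCount_le_chblLaw hn.le (monotone_fullMean_clampFull hn hf)).trans
    (chblLaw_sum_fullMean_le hn hf)

end Means

/-! ### Rotation invariance and the theorem -/

/-- The loads seen from a ring rotated by `a`. -/
def rotate {k : ℕ} (a : ZMod k) (x : Loads k) : Loads k := fun i => x (i + a)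

lemma rotate_eq_zero_iff {k : ℕ} (a : ZMod k) (x : Loads k) : rotate a x = 0 ↔ x = 0 := by
  constructor
  · intro h
    funext i
    have := congrFun h (i - a)
    simpa [rotate] using this
  · rintro rfl; rfl

lemma unplace_rotate {k : ℕ} (a : ZMod k) (x : Loads k) (j : ZMod k) :
    unplace (rotate a x) j = rotate a (unplace x (j + a)) := by
  funext i
  unfold unplace rotate
  by_cases h : i = j
  · subst h; simp
  · rw [Function.update_of_ne h, Function.update_of_ne (by simpa using h)]

lemma clockwiseTarget_rotate {k : ℕ} (C : ℕ) (a : ZMod k) (x : Loads k) (i : ZMod k) :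
    clockwiseTarget C (rotate a x) i + a = clockwiseTarget C x (i + a) := by
  have h : ∀ d : ℕ, rotate a x (i + d) = x (i + a + d) := fun d => by
    unfold rotate; congr 1; ring
  unfold clockwiseTarget
  split_ifs with h1 h2 h2
  · have : Nat.find h1 = Nat.find h2 := Nat.find_congr' fun {d} => by rw [h]
    rw [this]; ring
  · exact absurd (by simpa only [h] using h1) h2
  · exact absurd (by simpa only [h] using h2) h1
  · rfl

section Rotation
variable {k : ℕ} [NeZero k]

lemma chblChoice_rotate (C : ℕ) (a : ZMod k) (x : Loads k) (j : ZMod k) :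
    (chblChoice C (rotate a x) j).toReal = (chblChoice C x (j + a)).toReal := by
  rw [chblChoice_apply, chblChoice_apply]
  congr 2
  refine Finset.card_nbij' (fun i => i + a) (fun i => i - a) ?_ ?_ ?_ ?_
  · intro i hi
    simp only [Finset.mem_coe, mem_cluster] at hi ⊢
    rw [← clockwiseTarget_rotate, hi]
  · intro i hi
    simp only [Finset.mem_coe, mem_cluster] at hi ⊢
    have := clockwiseTarget_rotate C a x (i - a)
    rw [sub_add_cancel, hi] at this
    exact add_right_cancel this
  · intro i _; simp
  · intro i _; simp

lemma rjchChoice_rotate {C : ℕ} (a : ZMod k) {x : Loads k} (hA : ∃ b, x b < C) (j : ZMod k) :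
    (rjchChoice C (rotate a x) j).toReal = (rjchChoice C x (j + a)).toReal := by
  have hA' : ∃ b, rotate a x b < C := by
    obtain ⟨b, hb⟩ := hA
    exact ⟨b - a, by simpa [rotate] using hb⟩
  have hcard : (availableBins C (rotate a x)).card = (availableBins C x).card := by
    refine Finset.card_nbij' (fun i => i + a) (fun i => i - a) ?_ ?_ ?_ ?_
    · intro i hi
      simpa [mem_availableBins, rotate] using hi
    · intro i hi
      simpa [mem_availableBins, rotate] using hi
    · intro i _; simp
    · intro i _; simp
  rw [rjchChoice_apply hA, rjchChoice_apply hA', hcard]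
  rfl

variable {C : ℕ} {L : ℕ → PMF (Loads k)} {Q : Loads k → PMF (ZMod k)}

lemma IsPlacementLaw.apply_rotate (h : IsPlacementLaw L Q) (hQ : AvoidsFull C Q) (a : ZMod k)
    (hrot : ∀ x : Loads k, (∃ b, x b < C) → ∀ j, (Q (rotate a x) j).toReal = (Q x (j + a)).toReal)
    {n : ℕ} (hn : n ≤ k * C) (x : Loads k) : (L n (rotate a x)).toReal = (L n x).toReal := by
  induction n generalizing x with
  | zero => simp only [h.zero_apply, rotate_eq_zero_iff]
  | succ n ih =>
    rw [h.succ_apply, h.succ_apply]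
    conv_rhs => rw [← Equiv.sum_comp (Equiv.addRight a)]
    apply Finset.sum_congr rfl
    intro j _
    rw [Equiv.coe_addRight, show rotate a x j = x (j + a) from rfl, unplace_rotate,
      ih (Nat.le_of_succ_le hn)]
    split_ifs with h0
    · rfl
    -- A predecessor of positive probability carries `n < k * C` objects, so it has an available
    -- bin, as `hrot` requires.
    · by_cases hp : (L n (unplace x (j + a))).toReal = 0
      · rw [hp, zero_mul, zero_mul]
      · have := (h.support hQ (Nat.le_of_succ_le hn) hp).2
        rw [hrot _ (exists_lt_of_sum_lt (by omega))]

lemma IsPlacementLaw.integral_apply_eq (h : IsPlacementLaw L Q) (hQ : AvoidsFull C Q)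
    (hrot : ∀ (a : ZMod k) (x : Loads k), (∃ b, x b < C) →
      ∀ j, (Q (rotate a x) j).toReal = (Q x (j + a)).toReal)
    {n : ℕ} (hn : n ≤ k * C) (f : ℕ → ℝ) (i : ZMod k) :
    ∫ x, f (x i) ∂(L n).toMeasure = ∫ x, f (x 0) ∂(L n).toMeasure := by
  rw [h.integral_eq hQ hn, h.integral_eq hQ hn]
  have hbox : ∀ (a : ZMod k), ∀ x ∈ loadBox C (Finset.univ : Finset (ZMod k)),
      rotate a x ∈ loadBox C Finset.univ := by
    intro a x hx
    rw [mem_loadBox] at hx ⊢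
    exact ⟨fun j => hx.1 _, fun j hj => absurd (Finset.mem_univ j) hj⟩
  refine Finset.sum_nbij' (rotate i) (rotate (-i)) (hbox i) (hbox (-i)) ?_ ?_ ?_
  · intro x _; funext j; simp [rotate]
  · intro x _; funext j; simp [rotate]
  · intro x _
    rw [h.apply_rotate hQ i (hrot i) hn]
    simp [rotate]

lemma IsPlacementLaw.integral_of_full (h : IsPlacementLaw L Q) (hQ : AvoidsFull C Q)
    (g : Loads k → ℝ) : ∫ x, g x ∂(L (k * C)).toMeasure = g fun _ => C := by
  have h1 := h.integral_eq hQ le_rfl fun _ => (1 : ℝ)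
  simp only [integral_const, probReal_univ, smul_eq_mul, mul_one] at h1
  rw [h.integral_eq hQ le_rfl, Finset.sum_congr rfl (g := fun x => (L (k * C) x).toReal
    * g fun _ => C), ← Finset.sum_mul, ← h1, one_mul]
  intro x _
  by_cases h0 : (L (k * C) x).toReal = 0
  · rw [h0, zero_mul, zero_mul]
  · obtain ⟨h2, h3⟩ := h.support hQ le_rfl h0
    have h4 : ∑ i, x i = ∑ _i : ZMod k, C := by
      rw [h3, Finset.sum_const, Finset.card_univ, ZMod.card, smul_eq_mul]
    have h5 := (Finset.sum_eq_sum_iff_of_le fun i _ => h2 i).1 h4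
    rw [show x = fun _ => C from funext fun i => h5 i (Finset.mem_univ i)]

end Rotation

lemma ConvexOnUpTo.seqConvexOn {C : ℕ} {f : ℕ → ℝ} (hf : ConvexOnUpTo C f) :
    SeqConvexOn 0 C f := by
  intro l _ hl
  have := hf l (l + 2) (l + 1) (by omega) hl (1 / 2) (1 / 2) (by norm_num) (by norm_num)
    (by norm_num) (by push_cast; ring)
  linarith

theorem theorem2 (k n C : ℕ) [NeZero k] (hn : n ≤ k * C) (f : ℕ → ℝ) (hf : ConvexOnUpTo C f) :
    (∑ i : ZMod k, ∫ x, f (x i) ∂(rjchLaw k C n).toMeasure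
        ≤ ∑ i : ZMod k, ∫ x, f (x i) ∂(chblLaw k C n).toMeasure) ∧
      ∀ i : ZMod k, ∫ x, f (x i) ∂(rjchLaw k C n).toMeasure
        ≤ ∫ x, f (x i) ∂(chblLaw k C n).toMeasure := by
  have hR := isPlacementLaw_rjch (k := k) C
  have hB := isPlacementLaw_chbl (k := k) C
  have qR := avoidsFull_rjch (k := k) C
  have qB := avoidsFull_chbl (k := k) C
  -- By rotation invariance all summands on either side are equal, so the comparison of the sums is
  -- `k` times that of one bin.
  suffices hsum : ∑ i : ZMod k, ∫ x, f (x i) ∂(rjchLaw k C n).toMeasure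
      ≤ ∑ i : ZMod k, ∫ x, f (x i) ∂(chblLaw k C n).toMeasure by
    refine ⟨hsum, fun i => ?_⟩
    have eR := hR.integral_apply_eq qR (fun a _ hA => rjchChoice_rotate a hA) hn f
    have eB := hB.integral_apply_eq qB (fun a x _ => chblChoice_rotate C a x) hn f
    rw [Finset.sum_congr rfl fun i _ => eR i, Finset.sum_congr rfl fun i _ => eB i,
      Finset.sum_const, Finset.sum_const, Finset.card_univ, ZMod.card, nsmul_eq_mul,
      nsmul_eq_mul] at hsum
    rw [eR i, eB i]
    exact le_of_mul_le_mul_left hsum (by exact_mod_cast NeZero.pos k)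
  -- The product formulas need an available bin. If `n = k * C`, which covers `C = 0`, both laws sit
  -- at the configuration with every load `C`.
  rcases hn.lt_or_eq with hlt | rfl
  · obtain ⟨K, rfl⟩ : ∃ K, C = K + 1 := Nat.exists_eq_succ_of_ne_zero (by rintro rfl; simp at hlt)
    rw [Finset.sum_congr rfl fun i _ => hR.integral_eq qR hn fun x => f (x i),
      Finset.sum_congr rfl fun i _ => hB.integral_eq qB hn fun x => f (x i), Finset.sum_comm,
      Finset.sum_comm (s := Finset.univ)]
    simp_rw [← Finset.mul_sum]
    exact rjchLaw_sum_le_chblLaw_sum hlt hf.seqConvexOn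
  · exact (Finset.sum_congr rfl fun i _ => by
      rw [hR.integral_of_full qR fun x => f (x i), hB.integral_of_full qB fun x => f (x i)]).le
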